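/- Let $F$ be a field of characteristic different from $2$ which is either finite (with the discrete topology) or local nonarchimedean, with residual characteristic $p$ and, in the local case, ring of integers $\mathcal{O}_F$. Let $\mathcal{K}=\mathbb{Q}(\zeta_p)$ if $F$ has positive characteristic and $\mathcal{K}=\mathbb{Q}(\zeta_{p^\infty})$ if $F$ has characteristic $0$, let $\mathcal{A}$ be the integral closure of $\mathbb{Z}[\frac1p]$ in $\mathcal{K}$, and let $\mathcal{B}$ be a commutative $\mathcal{A}$-algebra with structure morphism $\varphi$. Let $\psi:F\to\mathcal{A}^\times$ be a non-trivial smooth (locally constant) character and $\psi^{\mathcal{B}}=\varphi\circ\psi$. Let $(W,\langle\,,\rangle)$ be a finite dimensional symplectic space over $F$ with its canonical topology and isometry group $\mathrm{Sp}(W)$, and let $H=W\times F$ be the Heisenberg group, with the product topology and the law $(w,t)(w',t')=(w+w',t+t'+\frac12\langle w,w'\rangle)$. The group $\mathrm{Sp}(W)$ acts on $H$ by $g\cdot(w,t)=(gw,t)$. Let $A$ be a self-dual closed subgroup of $W$, that is, $A=\{w\in W : \psi(\langle w,a\rangle)=1 \text{ for all } a\in A\}$. If $F$ has positive characteristic,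 assume moreover that $A$ is stable under $\mathcal{O}_F$ (for instance a lagrangian or a self-dual lattice) or, more generally, that the subgroup $gA+A$ is closed in $W$ for every $g\in\mathrm{Sp}(W)$; this is automatic when $F$ is finite. Let $\psi_A$ be a smooth character of $A_H=A\times F\subset H$ with values in $\mathcal{A}^\times$ which extends $\psi$, put $\psi_A^{\mathcal{B}}=\varphi\circ\psi_A$, and let $V_A^{\mathcal{B}}=\mathrm{ind}_{A_H}^H(\psi_A^{\mathcal{B}})$ be the $\mathcal{B}$-module of locally constant functions $f:H\to\mathcal{B}$ such that $f(ah)=\psi_A^{\mathcal{B}}(a)f(h)$ for $a\in A_H$, $h\in H$, and such that the support of $f$ has compact image in $A_H\backslash H$. For $g\in\mathrm{Sp}(W)$ let $\psi_{gA}^{\mathcal{B}}$ be the character of $(gA)_H$ given by $\psi_{gA}^{\mathcal{B}}(g\cdot a)=\psi_A^{\mathcal{B}}(a)$, let $V_{gA}^{\mathcal{B}}=\mathrm{ind}_{(gA)_H}^H(\psi_{gA}^{\mathcal{B}})$, and let $I_g:V_A^{\mathcal{B}}\to V_{gA}^{\mathcal{B}}$ be $(I_gf)(h)=f(g^{-1}\cdot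 h)$. Let $\omega_g\in W$ be such that $\psi_{gA}^{\mathcal{B}}((a,0))\,\psi_A^{\mathcal{B}}((a,0))^{-1}=\psi^{\mathcal{B}}(\langle a,\omega_g\rangle)$ for all $a\in gA\cap A$, and let $\mu$ be an invertible $\mathcal{B}$-valued Haar measure of $(gA\cap A)\backslash A$, that is, an invariant $\mathcal{B}$-linear functional on the locally constant compactly supported $\mathcal{B}$-valued functions whose values on the compact open subgroups generate the unit ideal of $\mathcal{B}$. Let $I_{gA,A,\mu,\omega_g}:V_{gA}^{\mathcal{B}}\to V_A^{\mathcal{B}}$ be $$(I_{gA,A,\mu,\omega_g}f)(h)=\int_{((gA)_H\cap A_H)\backslash A_H}\psi_A^{\mathcal{B}}(a)^{-1}f((\omega_g,0)\,a\,h)\,d\mu(a).$$ Write $\mathrm{GL}_{\mathcal{B}}(V_A^{\mathcal{B}})$ for the group of $\mathcal{B}$-linear automorphisms of $V_A^{\mathcal{B}}$ and $\mathrm{red}:\mathrm{GL}_{\mathcal{B}}(V_A^{\mathcal{B}})\to\mathrm{PGL}_{\mathcal{B}}(V_A^{\mathcal{B}})=\mathrm{GL}_{\mathcal{B}}(V_A^{\mathcal{B}})/\mathcal{B}^\times$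 for the quotient morphism. Then for every $g\in\mathrm{Sp}(W)$ such $\omega_g$ and $\mu$ exist; for all of them the maps $I_g$ and $I_{gA,A,\mu,\omega_g}$ are well defined and $I_{gA,A,\mu,\omega_g}\circ I_g$ is an automorphism of the $\mathcal{B}$-module $V_A^{\mathcal{B}}$, and its class $M_g\in\mathrm{PGL}_{\mathcal{B}}(V_A^{\mathcal{B}})$ depends only on $g$. The map $\sigma_{\mathcal{B}}:\mathrm{Sp}(W)\to\mathrm{PGL}_{\mathcal{B}}(V_A^{\mathcal{B}})$, $g\mapsto M_g$, is a group morphism. Let $$\widetilde{\mathrm{Sp}}{}^{\mathcal{B}}(W)=\{(g,M)\in\mathrm{Sp}(W)\times\mathrm{GL}_{\mathcal{B}}(V_A^{\mathcal{B}}) : \sigma_{\mathcal{B}}(g)=\mathrm{red}(M)\}$$ be the fiber product of $\sigma_{\mathcal{B}}$ and $\mathrm{red}$, with projections $p_{\mathcal{B}}$ to $\mathrm{Sp}(W)$ and $\omega$ to $\mathrm{GL}_{\mathcal{B}}(V_A^{\mathcal{B}})$. Then $\mathrm{red}\circ\omega=\sigma_{\mathcal{B}}\circ p_{\mathcal{B}}$,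 and with $b\mapsto(1,b\cdot\mathrm{id})$ the sequence $$1\to\mathcal{B}^\times\to\widetilde{\mathrm{Sp}}{}^{\mathcal{B}}(W)\xrightarrow{\ p_{\mathcal{B}}\ }\mathrm{Sp}(W)\to1$$ is a central extension. Thus $\omega$ is a representation on $V_A^{\mathcal{B}}$ of a central extension of $\mathrm{Sp}(W)$ by $\mathcal{B}^\times$ which lifts $\sigma_{\mathcal{B}}$ (the Weil representation over $\mathcal{B}$). -/

import Mathlib

/-! ## The coefficient rings -/

/-- `F` is a finite field with the discrete topology, or a nonarchimedean local field with its
valuation topology, and `p` is its residual characteristic. -/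
def IsFiniteOrLocalField (F : Type*) [Field F] [ValuativeRel F] [TopologicalSpace F]
    (p : ℕ) : Prop :=
  (Finite F ∧ DiscreteTopology F ∧ CharP F p) ∨
    (IsNonarchimedeanLocalField F ∧
      CharP (IsLocalRing.ResidueField (ValuativeRel.valuation F).integer) p)

/-- The orders of the roots of unity adjoined to `ℚ`: only `p` if `F` has positive characteristic,
all powers of `p` if `F` has characteristic zero. -/
def cyclotomicOrders (F : Type*) [Field F] (p : ℕ) : Set ℕ :=
  if ringChar F = 0 then Set.range (fun k : ℕ => p ^ k) else {p}

/-- The integral closure of `ℤ[1/p]` in `K`. -/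
noncomputable def baseRing (p : ℕ) (K : Type*) [Field K] : Subring K :=
  (integralClosure (Algebra.adjoin ℤ {(p : K)⁻¹}) K).toSubring

/-! ## The symplectic group and the Heisenberg group -/

section Heisenberg

variable {F W : Type*} [Field F] [AddCommGroup W] [Module F W]

/-- The isometry group of the form. -/
def SpGroup (form : LinearMap.BilinForm F W) : Subgroup (W ≃ₗ[F] W) where
  carrier := {g | ∀ x y, form (g x) (g y) = form x y}
  one_mem' := fun _ _ => rfl
  mul_mem' := by
    intro a b ha hb x y
    rw [LinearEquiv.mul_apply, LinearEquiv.mul_apply, ha, hb]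
  inv_mem' := by
    intro a ha x y
    have h := ha (a⁻¹ x) (a⁻¹ y)
    rw [← LinearEquiv.mul_apply, ← LinearEquiv.mul_apply, mul_inv_cancel] at h
    exact h.symm

/-- The underlying set `W × F` of the Heisenberg group of a bilinear form. -/
@[ext]
structure Heis (form : LinearMap.BilinForm F W) where
  w : W
  t : F

/-- The law is `(w,t)(w',t') = (w + w', t + t' + ½⟨w,w'⟩)`. When the form is alternating, the
inverse of `(w,t)` given here is `(-w,-t)`. -/
noncomputable instance Heis.instGroup (form : LinearMap.BilinForm F W) : Group (Heis form) where
  mul x y := ⟨x.w + y.w, x.t + y.t + 1 / 2 * form x.w y.w⟩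
  one := ⟨0, 0⟩
  inv x := ⟨-x.w, -x.t + 1 / 2 * form x.w x.w⟩
  mul_assoc x y z := by
    change (⟨x.w + y.w + z.w, x.t + y.t + 1 / 2 * form x.w y.w + z.t
        + 1 / 2 * form (x.w + y.w) z.w⟩ : Heis form)
      = ⟨x.w + (y.w + z.w), x.t + (y.t + z.t + 1 / 2 * form y.w z.w)
        + 1 / 2 * form x.w (y.w + z.w)⟩
    ext
    · simp only [add_assoc]
    · simp only [map_add, LinearMap.add_apply]; ring
  one_mul x := by
    change (⟨0 + x.w, 0 + x.t + 1 / 2 * form 0 x.w⟩ : Heis form) = x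
    ext <;> simp
  mul_one x := by
    change (⟨x.w + 0, x.t + 0 + 1 / 2 * form x.w 0⟩ : Heis form) = x
    ext <;> simp
  inv_mul_cancel x := by
    change (⟨-x.w + x.w, -x.t + 1 / 2 * form x.w x.w + x.t + 1 / 2 * form (-x.w) x.w⟩ : Heis form)
      = ⟨0, 0⟩
    ext <;> simp

/-- The product topology of `W × F`. -/
instance Heis.instTopologicalSpace [TopologicalSpace F] [TopologicalSpace W]
    (form : LinearMap.BilinForm F W) : TopologicalSpace (Heis form) :=
  TopologicalSpace.induced (fun h => (h.w, h.t)) inferInstance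

/-- The action of an isometry on the Heisenberg group, `g · (w,t) = (g w, t)`. -/
def Heis.act {form : LinearMap.BilinForm F W} (g : SpGroup form) (h : Heis form) : Heis form :=
  ⟨(g : W ≃ₗ[F] W) h.w, h.t⟩

/-- The subgroup `A_H = A × F` of the Heisenberg group. -/
def Heis.over (form : LinearMap.BilinForm F W) (A : AddSubgroup W) : Subgroup (Heis form) where
  carrier := {h | h.w ∈ A}
  one_mem' := A.zero_mem
  mul_mem' := fun ha hb => A.add_mem ha hb
  inv_mem' := fun ha => A.neg_mem ha

/-- The element `(0,t)` of `A_H`. -/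
def Heis.central (form : LinearMap.BilinForm F W) (A : AddSubgroup W) (t : F) :
    Heis.over form A :=
  ⟨⟨0, t⟩, A.zero_mem⟩

/-- The element `(a,0)` of `A_H`. -/
def Heis.horizontal (form : LinearMap.BilinForm F W) {A : AddSubgroup W} (a : W) (ha : a ∈ A) :
    Heis.over form A :=
  ⟨⟨a, 0⟩, ha⟩

/-- `A` is closed and equal to `A^⊥ = {w | ψ(⟨w, a⟩) = 1 for all a ∈ A}`. -/
def IsSelfDual [TopologicalSpace W] {R : Type*} [Monoid R] (form : LinearMap.BilinForm F W)
    (ψ : AddChar F R) (A : AddSubgroup W) : Prop :=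
  IsClosed (A : Set W) ∧ {w : W | ∀ a ∈ A, ψ (form w a) = 1} = (A : Set W)

/-- The subgroup `gA`. -/
def moveSubgroup {form : LinearMap.BilinForm F W} (g : SpGroup form) (A : AddSubgroup W) :
    AddSubgroup W :=
  A.map ((g : W ≃ₗ[F] W).toLinearMap.toAddMonoidHom)

/-- The character `ψ_{gA}` of `(gA)_H` with `ψ_{gA}(g · a) = ψ_A(a)`. -/
noncomputable def moveChar {R : Type*} [CommMonoid R] {form : LinearMap.BilinForm F W} (g : SpGroup form)
    {A : AddSubgroup W} (χ : Heis.over form A →* R) : Heis.over form (moveSubgroup g A) →* R where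
  toFun x := χ ⟨Heis.act g⁻¹ x.1, by
    obtain ⟨a, ha, hax⟩ := x.2
    change ((g⁻¹ : SpGroup form) : W ≃ₗ[F] W) x.1.w ∈ A
    rw [← hax]
    change ((g : W ≃ₗ[F] W)⁻¹ * (g : W ≃ₗ[F] W)) a ∈ A
    rwa [inv_mul_cancel]⟩
  map_one' := by
    rw [← map_one χ]
    congr 1
    apply Subtype.ext
    exact Heis.ext (map_zero _) rfl
  map_mul' x y := by
    rw [← map_mul χ]
    congr 1
    apply Subtype.ext
    refine Heis.ext (map_add _ _ _) ?_
    change x.1.t + y.1.t + 1 / 2 * form x.1.w y.1.w = x.1.t + y.1.t + 1 / 2 * form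
      (((g⁻¹ : SpGroup form) : W ≃ₗ[F] W) x.1.w) (((g⁻¹ : SpGroup form) : W ≃ₗ[F] W) y.1.w)
    rw [(g⁻¹).2]

end Heisenberg

/-! ## Haar measures with values in a ring -/

section Haar

variable (G B : Type*) [TopologicalSpace G] [CommRing B]

/-- The module of locally constant, compactly supported functions on `G` with values in `B`. -/
def CcSmooth : Submodule B (G → B) where
  carrier := {f | IsLocallyConstant f ∧ HasCompactSupport f}
  zero_mem' := ⟨IsLocallyConstant.const 0, HasCompactSupport.zero⟩
  add_mem' := fun ha hb => ⟨ha.1.add hb.1, ha.2.add hb.2⟩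
  smul_mem' := fun c _ hf => ⟨hf.1.comp (fun b => c * b), hf.2.comp_left (mul_zero c)⟩

variable {G B}

/-- The ideal generated by the values of `μ` on the compact open subgroups of `G`. -/
def valueIdeal [AddCommGroup G] (μ : CcSmooth G B →ₗ[B] B) : Ideal B :=
  Ideal.span {b | ∃ (K : AddSubgroup G) (φ : CcSmooth G B), IsOpen (K : Set G) ∧
    IsCompact (K : Set G) ∧ (φ : G → B) = Set.indicator (K : Set G) 1 ∧ b = μ φ}

/-- `μ` is an invertible `B`-valued Haar measure: a translation invariant functional whose values
on the compact open subgroups generate the unit ideal (so that `μ ≠ 0` unless `B = 0`). -/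
def IsInvertibleHaar [AddCommGroup G] (μ : CcSmooth G B →ₗ[B] B) : Prop :=
  (∀ (x : G) (φ φ' : CcSmooth G B),
    (∀ y, (φ' : G → B) y = (φ : G → B) (x + y)) → μ φ' = μ φ) ∧
  valueIdeal μ = ⊤

end Haar

/-! ## The models `V_A` and the intertwining operators -/

section Models

variable {F W : Type*} [Field F] [TopologicalSpace F] [AddCommGroup W] [Module F W]
  [TopologicalSpace W] {B : Type*} [CommRing B]

/-- The image of `S` in `A_H \ H` is compact. -/
def IsCompactMod (form : LinearMap.BilinForm F W) (A : AddSubgroup W) (S : Set (Heis form)) :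
    Prop :=
  IsCompact ((Quotient.mk (QuotientGroup.rightRel (Heis.over form A))) '' S)

theorem IsCompactMod.mono {form : LinearMap.BilinForm F W} {A : AddSubgroup W}
    {g : Heis form → B} {S : Set (Heis form)} (hg : IsLocallyConstant g)
    (heq : ∀ (a : Heis.over form A) (h : Heis form), g h = 0 → g (a * h) = 0)
    (hS : IsCompactMod form A S) (hgf : Function.support g ⊆ S) :
    IsCompactMod form A (Function.support g) := by
  refine IsCompact.of_isClosed_subset hS ?_ (Set.image_mono hgf)
  have hpre : (Quotient.mk (QuotientGroup.rightRel (Heis.over form A))) ⁻¹'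
      ((Quotient.mk (QuotientGroup.rightRel (Heis.over form A))) '' Function.support g)
        = Function.support g := by
    ext x
    constructor
    · rintro ⟨y, hy, hxy⟩ hx
      have hr := QuotientGroup.rightRel_apply.mp (Quotient.exact hxy)
      have := heq ⟨_, inv_mem hr⟩ x hx
      apply hy
      simpa using this
    · intro hx
      exact ⟨x, hx, rfl⟩
  have hcl : IsClosed (Function.support g) := (hg.isOpen_fiber 0).isClosed_compl
  rw [← hpre] at hcl
  exact isQuotientMap_quot_mk.isClosed_preimage.mp hcl

/-- The compactly induced module `ind_{A_H}^H(χ)`: locally constant functions `f : H → B` with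
`f(a h) = χ(a) f(h)` for `a ∈ A_H`, whose support has compact image in `A_H \ H`. -/
def indModule (form : LinearMap.BilinForm F W) (A : AddSubgroup W)
    (χ : Heis.over form A →* Bˣ) : Submodule B (Heis form → B) where
  carrier := {f | IsLocallyConstant f ∧
    (∀ (a : Heis.over form A) (h : Heis form), f (a * h) = χ a * f h) ∧
    IsCompactMod form A (Function.support f)}
  zero_mem' := by
    refine ⟨IsLocallyConstant.const 0, fun a h => (mul_zero _).symm, ?_⟩
    have h0 : Function.support (0 : Heis form → B) = ∅ := Function.support_zero
    rw [h0, IsCompactMod, Set.image_empty]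
    exact isCompact_empty
  add_mem' := by
    rintro f g ⟨hf1, hf2, hf3⟩ ⟨hg1, hg2, hg3⟩
    have heq : ∀ (a : Heis.over form A) (h : Heis form), (f + g) (a * h) = χ a * (f + g) h := by
      intro a h
      rw [Pi.add_apply, Pi.add_apply, hf2, hg2, mul_add]
    refine ⟨hf1.add hg1, heq, IsCompactMod.mono (S := Function.support f ∪ Function.support g)
      (hf1.add hg1) (fun a h h0 => by rw [heq, h0, mul_zero]) ?_ (Function.support_add f g)⟩
    rw [IsCompactMod, Set.image_union]
    exact IsCompact.union hf3 hg3
  smul_mem' := by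
    rintro c f ⟨hf1, hf2, hf3⟩
    have heq : ∀ (a : Heis.over form A) (h : Heis form), (c • f) (a * h) = χ a * (c • f) h := by
      intro a h
      rw [Pi.smul_apply, Pi.smul_apply, hf2, smul_eq_mul, smul_eq_mul, mul_left_comm]
    have hlc : IsLocallyConstant (c • f) := hf1.comp (fun b => c * b)
    exact ⟨hlc, heq, IsCompactMod.mono hlc (fun a h h0 => by rw [heq, h0, mul_zero]) hf3
      (Function.support_const_smul_subset c f)⟩

/-- `ψ_1((a,0)) ψ_2((a,0))⁻¹ = ψ(⟨a,ω⟩)` for all `a ∈ A₁ ∩ A₂`. -/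
def IsCompatible (form : LinearMap.BilinForm F W) (ψ : AddChar F Bˣ) {A₁ A₂ : AddSubgroup W}
    (χ₁ : Heis.over form A₁ →* Bˣ) (χ₂ : Heis.over form A₂ →* Bˣ) (ω : W) : Prop :=
  ∀ (a : W) (h₁ : a ∈ A₁) (h₂ : a ∈ A₂),
    χ₁ (Heis.horizontal form a h₁) * (χ₂ (Heis.horizontal form a h₂))⁻¹ = ψ (form a ω)

/-- `T` is the operator `I_{A₁,A₂,μ,ω}`:
`(T f)(h) = ∫ χ₂(a)⁻¹ f((ω,0) a h) dμ(a)` over `a ∈ (A₁,H ∩ A₂,H) \ A₂,H = (A₁ ∩ A₂) \ A₂`.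
That the integrand descends to a locally constant compactly supported function `φ` on the quotient
is part of the assertion. -/
def IsIntertwiner (form : LinearMap.BilinForm F W) {A₁ A₂ : AddSubgroup W}
    (χ₁ : Heis.over form A₁ →* Bˣ) (χ₂ : Heis.over form A₂ →* Bˣ)
    (μ : CcSmooth (A₂ ⧸ A₁.addSubgroupOf A₂) B →ₗ[B] B) (ω : W)
    (T : indModule form A₁ χ₁ →ₗ[B] indModule form A₂ χ₂) : Prop :=
  ∀ (f : indModule form A₁ χ₁) (h : Heis form), ∃ φ : CcSmooth (A₂ ⧸ A₁.addSubgroupOf A₂) B,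
    (∀ a : Heis.over form A₂,
      (φ : (A₂ ⧸ A₁.addSubgroupOf A₂) → B) (QuotientAddGroup.mk ⟨a.1.w, a.2⟩)
        = ((χ₂ a)⁻¹ : Bˣ) * (f : Heis form → B) ((⟨ω, 0⟩ : Heis form) * a * h)) ∧
    (T f : Heis form → B) h = μ φ

/-- `J` is the map `I_g : V_A → V_{gA}`, `(I_g f)(h) = f(g⁻¹ · h)`. -/
def IsTransport {form : LinearMap.BilinForm F W} (g : SpGroup form) {A : AddSubgroup W}
    (χ : Heis.over form A →* Bˣ)
    (J : indModule form A χ →ₗ[B] indModule form (moveSubgroup g A) (moveChar g χ)) : Prop :=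
  ∀ (f : indModule form A χ) (h : Heis form),
    (J f : Heis form → B) h = (f : Heis form → B) (Heis.act g⁻¹ h)

/-- `M` is the automorphism `I_{gA,A,μ,ω} ∘ I_g` of `V_A`. -/
def IsWeilOperator {form : LinearMap.BilinForm F W} (g : SpGroup form) {A : AddSubgroup W}
    (χ : Heis.over form A →* Bˣ)
    (μ : CcSmooth (A ⧸ (moveSubgroup g A).addSubgroupOf A) B →ₗ[B] B) (ω : W)
    (M : indModule form A χ ≃ₗ[B] indModule form A χ) : Prop :=
  ∃ (J : indModule form A χ →ₗ[B] indModule form (moveSubgroup g A) (moveChar g χ))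
    (T : indModule form (moveSubgroup g A) (moveChar g χ) →ₗ[B] indModule form A χ),
    IsTransport g χ J ∧ IsIntertwiner form (moveChar g χ) χ μ ω T ∧
      (M : indModule form A χ →ₗ[B] indModule form A χ) = T ∘ₗ J

end Models

/-! ## The projective linear group and the fiber product -/

section Projective

variable (B V : Type*) [CommRing B] [AddCommGroup V] [Module B V]

/-- The scalar automorphisms of `V`. -/
def scalarHom : Bˣ →* (V ≃ₗ[B] V) := DistribMulAction.toModuleAut B V

instance scalarHom_range_normal : (scalarHom B V).range.Normal where
  conj_mem := by
    rintro _ ⟨b, rfl⟩ g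
    refine ⟨b, ?_⟩
    rw [eq_mul_inv_iff_mul_eq]
    ext v
    exact (g.map_smul (b : B) v).symm

/-- `PGL_B(V) = GL_B(V) / B^×`. -/
abbrev PGL : Type _ := (V ≃ₗ[B] V) ⧸ (scalarHom B V).range

/-- The quotient morphism `GL_B(V) → PGL_B(V)`. -/
def red : (V ≃ₗ[B] V) →* PGL B V := QuotientGroup.mk' (scalarHom B V).range

variable {B V} {S : Type*} [Group S]

/-- The fiber product of `σ : S → PGL_B(V)` and `red : GL_B(V) → PGL_B(V)`, as a subgroup of
`S × GL_B(V)`. -/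
def fiberProduct (σ : S →* PGL B V) : Subgroup (S × (V ≃ₗ[B] V)) :=
  MonoidHom.eqLocus (σ.comp (MonoidHom.fst S (V ≃ₗ[B] V)))
    ((red B V).comp (MonoidHom.snd S (V ≃ₗ[B] V)))

/-- The projection of the fiber product to `S`. -/
def fiberProduct.toBase (σ : S →* PGL B V) : fiberProduct σ →* S :=
  (MonoidHom.fst S (V ≃ₗ[B] V)).comp (fiberProduct σ).subtype

/-- The projection of the fiber product to `GL_B(V)`. -/
def fiberProduct.toGL (σ : S →* PGL B V) : fiberProduct σ →* (V ≃ₗ[B] V) :=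
  (MonoidHom.snd S (V ≃ₗ[B] V)).comp (fiberProduct σ).subtype

end Projective

section WeilClass

variable {F W : Type*} [Field F] [TopologicalSpace F] [AddCommGroup W] [Module F W]
  [TopologicalSpace W] {B : Type*} [CommRing B]

/-- The image in `PGL_B(V_A)` of the set of all automorphisms `I_{gA,A,μ,ω} ∘ I_g`, for `μ` an
invertible Haar measure of `(gA ∩ A) \ A` and `ω` compatible with the characters. When it is a
singleton, its element is `M_g`. -/
def weilClass {form : LinearMap.BilinForm F W} (ψ : AddChar F Bˣ) {A : AddSubgroup W}
    (χ : Heis.over form A →* Bˣ) (g : SpGroup form) : Set (PGL B (indModule form A χ)) :=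
  {x | ∃ (μ : CcSmooth (A ⧸ (moveSubgroup g A).addSubgroupOf A) B →ₗ[B] B) (ω : W)
    (M : indModule form A χ ≃ₗ[B] indModule form A χ),
    IsInvertibleHaar μ ∧ IsCompatible form ψ (moveChar g χ) χ ω ∧
    IsWeilOperator g χ μ ω M ∧ x = red B (indModule form A χ) M}

end WeilClass

open Topology Filter

/-! ## Unions of compact open pro-`p` subgroups -/

/-! Let `ρ` be the action of `H` on `V_A` by right translation. Transport by `g` turns `ρ(x)` into
`ρ(g·x)`, and the integral operators commute with `H`; hence `M = I_{gA,A,μ,ω} ∘ I_g` satisfies `M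
ρ(x) = ρ(g·x) M` (`IsWeilOperator.isEquivariantFor`). If the endomorphisms of `V_A` commuting with
`H` are the scalars, two invertible operators with this property differ by a unit. This gives at
once the independence of `μ` and `ω` and the multiplicativity of `σ`; the central extension is then
formal. What remains is Schur's lemma over an arbitrary `B`, and the existence and bijectivity of
the operators. Irreducibility over a field is not available and is replaced as follows.

Elements of `A` act on `V_A` by multiplication operators: `ρ(a,0) f = ψ(⟨·,a⟩) χ(a) f`. For `M`
compact, suitable averages of these over `A ∩ M` multiply `f` by the indicator of a coset of `(A ∩
M)^⊥`; the number of terms is a power of `p`, hence a unit. Such a "cut" is a combination of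
translations, so it preserves stable submodules and commutes with equivariant maps
(`exists_finset_cut`, `isCut_map`). For `M` open, `(A ∩ M)^⊥` lies in `A + M^⊥` (`perp_inf_le`) and
can be made as thin as desired around `A`, so functions can be localized at a point of `A_H \ H`.
Localization proves Schur's lemma (`exists_smul_of_commute`) and shows that a stable submodule
containing a function with value 1 at the identity is everything (`eq_top_of_translate_mem`).

These facts rest on Pontryagin-type duality for `ψ(⟨w,w'⟩)`: every smooth character of a subgroup of
`W` is a pairing with some `ω` (`exists_eq_pairing`). It is proved over a domain `R` of
characteristic zero, by orthogonality on finite quotients and compactness; `B` only receives its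
image. It also produces the `ω_g`.

For the integral operators, closedness of `gA + A` makes `gA × A → gA + A` open, which gives compact
support of the integrand. Since the values of `μ` generate the unit ideal, some `T f` takes the
value 1 at the identity; surjectivity and, with one more localization, injectivity follow
(`IsIntertwiner.bijective`). -/

/-- `G` has small and large compact open subgroups, is `σ`-compact, and `p ^ k • x → 0` for all
`x`. -/
structure IsUnionOfProP (p : ℕ) (G : Type*) [AddCommGroup G] [TopologicalSpace G] : Prop where
  small : ∀ U ∈ 𝓝 (0 : G), ∃ L : AddSubgroup G,
    IsOpen (L : Set G) ∧ IsCompact (L : Set G) ∧ (L : Set G) ⊆ U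
  large : ∀ K : Set G, IsCompact K → ∃ L : AddSubgroup G,
    IsOpen (L : Set G) ∧ IsCompact (L : Set G) ∧ K ⊆ L
  tors : ∀ (x : G) (U : AddSubgroup G), IsOpen (U : Set G) → ∃ k : ℕ, p ^ k • x ∈ U
  sigma : SigmaCompactSpace G

theorem IsUnionOfProP.of_discrete {p : ℕ} {G : Type*} [AddCommGroup G] [TopologicalSpace G]
    [DiscreteTopology G] [Finite G] (h : ∀ x : G, p • x = 0) : IsUnionOfProP p G where
  small U hU := ⟨⊥, isOpen_discrete _, Set.Finite.isCompact (Set.toFinite _), by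
    simpa using mem_of_mem_nhds hU⟩
  large K _ := ⟨⊤, isOpen_discrete _, Set.Finite.isCompact (Set.toFinite _), fun _ _ => trivial⟩
  tors x U _ := ⟨1, by simp [h, U.zero_mem]⟩
  sigma := inferInstance

theorem IsUnionOfProP.of_homeomorph {p : ℕ} {G G' : Type*} [AddCommGroup G] [TopologicalSpace G]
    [AddCommGroup G'] [TopologicalSpace G'] (h : IsUnionOfProP p G) (e : G ≃+ G')
    (he : Continuous e) (he' : Continuous e.symm) : IsUnionOfProP p G' where
  small U hU := by
    obtain ⟨L, hL, hL', hLU⟩ := h.small (e ⁻¹' U) (he.continuousAt.preimage_mem_nhds (by simpa))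
    refine ⟨L.comap e.symm.toAddMonoidHom, hL.preimage he', ?_, ?_⟩
    · have := hL'.image he
      rwa [show (e '' L : Set G') = e.symm ⁻¹' L from e.toEquiv.image_eq_preimage_symm _] at this
    · intro x hx
      simpa using hLU hx
  large K hK := by
    obtain ⟨L, hL, hL', hKL⟩ := h.large (e.symm '' K) (hK.image he')
    refine ⟨L.comap e.symm.toAddMonoidHom, hL.preimage he', ?_, ?_⟩
    · have := hL'.image he
      rwa [show (e '' L : Set G') = e.symm ⁻¹' L from e.toEquiv.image_eq_preimage_symm _] at this
    · intro x hx
      exact hKL ⟨x, hx, rfl⟩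
  tors x U hU := by
    obtain ⟨k, hk⟩ := h.tors (e.symm x) (U.comap e.toAddMonoidHom) (hU.preimage he)
    refine ⟨k, ?_⟩
    have : e (p ^ k • e.symm x) ∈ U := hk
    simpa using this
  sigma := by
    have := h.sigma
    refine ⟨⟨fun n => e '' compactCovering G n, fun n => (isCompact_compactCovering G n).image he, ?_⟩⟩
    rw [← Set.image_iUnion, iUnion_compactCovering, Set.image_univ_of_surjective e.surjective]

theorem IsUnionOfProP.pi {p : ℕ} {ι G : Type*} [Finite ι] [AddCommGroup G] [TopologicalSpace G]
    [IsTopologicalAddGroup G] (h : IsUnionOfProP p G) : IsUnionOfProP p (ι → G) where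
  small U hU := by
    rw [nhds_pi, Filter.mem_pi'] at hU
    obtain ⟨I, t, ht, htU⟩ := hU
    choose L hL hL' hLt using fun i => h.small (t i) (ht i)
    refine ⟨AddSubgroup.pi Set.univ L, ?_, ?_, ?_⟩
    · exact isOpen_set_pi Set.finite_univ fun i _ => hL i
    · exact isCompact_univ_pi hL'
    · exact fun x hx => htU fun i _ => hLt i (hx i trivial)
  large K hK := by
    choose L hL hL' hKL using fun i : ι => h.large ((fun x => x i) '' K)
      (hK.image (continuous_apply i))
    refine ⟨AddSubgroup.pi Set.univ L, ?_, ?_, ?_⟩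
    · exact isOpen_set_pi Set.finite_univ fun i _ => hL i
    · exact isCompact_univ_pi hL'
    · exact fun x hx i _ => hKL i ⟨x, hx, rfl⟩
  tors x U hU := by
    have := Fintype.ofFinite ι
    classical
    choose k hk using fun i : ι => h.tors (x i) (U.comap (AddMonoidHom.single (fun _ => G) i))
      (hU.preimage (continuous_single i))
    refine ⟨∑ i, k i, ?_⟩
    rw [← Finset.univ_sum_single x, Finset.smul_sum]
    refine U.sum_mem fun i _ => ?_
    obtain ⟨m, hm⟩ := Nat.exists_eq_add_of_le
      (Finset.single_le_sum (f := k) (fun _ _ => Nat.zero_le _) (Finset.mem_univ i))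
    rw [hm, add_comm, pow_add, mul_smul]
    refine U.nsmul_mem ?_ _
    have : Pi.single i (p ^ k i • x i) ∈ U := hk i
    rwa [Pi.single_smul] at this
  sigma := by
    have := h.sigma
    infer_instance

/-! ## Finite and local fields -/

section LocalField

open ValuativeRel

variable {F : Type*} [Field F] [ValuativeRel F] [TopologicalSpace F]

theorem isOpen_ltAddSubgroup [IsNonarchimedeanLocalField F] (γ : (ValueGroupWithZero F)ˣ) :
    IsOpen ((valuation F).ltAddSubgroup γ : Set F) :=
  AddSubgroup.isOpen_of_mem_nhds _ (g := 0) <|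
    (IsValuativeTopology.hasBasis_nhds_zero F).mem_of_mem (i := γ) trivial

theorem isCompact_ltAddSubgroup [IsNonarchimedeanLocalField F] (γ : (ValueGroupWithZero F)ˣ) :
    IsCompact ((valuation F).ltAddSubgroup γ : Set F) :=
  (IsNonarchimedeanLocalField.isCompact_closedBall F γ).of_isClosed_subset
    (AddSubgroup.isClosed_of_isOpen _ (isOpen_ltAddSubgroup γ)) fun _ hx => (le_of_lt hx : valuation F _ ≤ γ)

theorem exists_pow_mul_lt [IsNonarchimedeanLocalField F] {ϖ : F} (hϖ : valuation F ϖ < 1) (x : F)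
    (γ : (ValueGroupWithZero F)ˣ) : ∃ n : ℕ, ∀ m ≥ n, ϖ ^ m * x ∈ (valuation F).ltAddSubgroup γ := by
  by_cases hx : x = 0
  · exact ⟨0, fun m _ => by rw [hx, mul_zero]; exact zero_mem _⟩
  have hx' : valuation F x ≠ 0 := by simpa using hx
  obtain ⟨n, hn⟩ := exists_pow_lt₀ hϖ (γ * (Units.mk0 _ hx')⁻¹)
  refine ⟨n, fun m hm => ?_⟩
  change valuation F (ϖ ^ m * x) < γ
  rw [map_mul, map_pow]
  have h1 : valuation F ϖ ^ m < γ * (valuation F x)⁻¹ :=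
    lt_of_le_of_lt (pow_le_pow_right_of_le_one' hϖ.le hm) (by simpa using hn)
  rwa [← div_eq_mul_inv, lt_div_iff₀ (zero_lt_iff.mpr hx')] at h1

theorem exists_valuation_lt [IsNonarchimedeanLocalField F] {K : Set F} (hK : IsCompact K) :
    ∃ γ : (ValueGroupWithZero F)ˣ, K ⊆ (valuation F).ltAddSubgroup γ := by
  refine hK.elim_directed_cover (fun γ => ((valuation F).ltAddSubgroup γ : Set F))
    isOpen_ltAddSubgroup ?_ ?_
  · intro x _
    obtain ⟨y, hy0, hy1⟩ := Valuation.IsNontrivial.exists_lt_one (v := valuation F)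
    have hy0' : valuation F y ≠ 0 := by simpa using hy0
    rw [Set.mem_iUnion]
    have hu : max 1 (valuation F x) * (valuation F y)⁻¹ ≠ 0 :=
      mul_ne_zero (ne_of_gt (lt_of_lt_of_le zero_lt_one (le_max_left _ _))) (inv_ne_zero hy0')
    refine ⟨Units.mk0 _ hu, ?_⟩
    change valuation F x < max 1 (valuation F x) * (valuation F y)⁻¹
    rw [← div_eq_mul_inv, lt_div_iff₀ (zero_lt_iff.mpr hy0')]
    by_cases hx : valuation F x = 0
    · rw [hx, zero_mul]; exact lt_of_lt_of_le zero_lt_one (le_max_left _ _)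
    · exact lt_of_lt_of_le (mul_lt_of_lt_one_right (zero_lt_iff.mpr hx) hy1) (le_max_right _ _)
  · intro a b
    rcases le_total a b with h | h
    · exact ⟨b, fun x hx => (lt_of_lt_of_le hx (by exact_mod_cast h) : valuation F x < b), subset_rfl⟩
    · exact ⟨a, subset_rfl, fun x hx => (lt_of_lt_of_le hx (by exact_mod_cast h) : valuation F x < a)⟩

theorem valuation_natCast_lt_one {F : Type*} [Field F] [ValuativeRel F] {p : ℕ}
    [CharP (IsLocalRing.ResidueField (valuation F).integer) p] : valuation F (p : F) < 1 := by
  have h := CharP.cast_eq_zero (IsLocalRing.ResidueField (valuation F).integer) p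
  rw [← map_natCast (IsLocalRing.residue (valuation F).integer), IsLocalRing.residue_eq_zero_iff,
    IsLocalRing.mem_maximalIdeal, mem_nonunits_iff,
    (Valuation.integer.integers (valuation F)).isUnit_iff_valuation_eq_one] at h
  have h2 : (algebraMap (valuation F).integer F) p = p := map_natCast _ p
  rw [h2] at h
  exact lt_of_le_of_ne (h2 ▸ (p : (valuation F).integer).2) h

theorem IsFiniteOrLocalField.isTopologicalRing {p : ℕ} (hF : IsFiniteOrLocalField F p) :
    IsTopologicalRing F := by
  rcases hF with ⟨_, _, _⟩ | ⟨_, _⟩ <;> infer_instance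

theorem IsFiniteOrLocalField.t2Space {p : ℕ} (hF : IsFiniteOrLocalField F p) :
    T2Space F := by
  rcases hF with ⟨_, _, _⟩ | ⟨_, _⟩
  · infer_instance
  · refine IsTopologicalAddGroup.t2Space_of_zero_sep fun x hx => ?_
    have hx' : valuation F x ≠ 0 := by simpa using hx
    refine ⟨_, (IsValuativeTopology.hasBasis_nhds_zero F).mem_of_mem (i := Units.mk0 _ hx') trivial,
      ?_⟩
    simp

theorem IsFiniteOrLocalField.prime {p : ℕ} (hF : IsFiniteOrLocalField F p) : p.Prime := by
  rcases hF with ⟨_, _, _⟩ | ⟨_, _⟩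
  · exact CharP.char_is_prime F p
  · have : Finite (IsLocalRing.ResidueField (valuation F).integer) :=
      inferInstanceAs (Finite (IsLocalRing.ResidueField (valuation F).integer))
    exact CharP.char_is_prime (IsLocalRing.ResidueField (valuation F).integer) p

theorem IsFiniteOrLocalField.isUnionOfProP {p : ℕ} (hF : IsFiniteOrLocalField F p) :
    IsUnionOfProP p F := by
  rcases hF with ⟨_, _, _⟩ | ⟨_, _⟩
  · exact IsUnionOfProP.of_discrete fun x => by simp
  · refine ⟨fun U hU => ?_, fun K hK => ?_, fun x U hU => ?_, ?_⟩
    · obtain ⟨γ, -, hγ⟩ := (IsValuativeTopology.hasBasis_nhds_zero F).mem_iff.mp hU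
      exact ⟨_, isOpen_ltAddSubgroup γ, isCompact_ltAddSubgroup γ, hγ⟩
    · obtain ⟨γ, hγ⟩ := exists_valuation_lt hK
      exact ⟨_, isOpen_ltAddSubgroup γ, isCompact_ltAddSubgroup γ, hγ⟩
    · obtain ⟨γ, -, hγ⟩ := (IsValuativeTopology.hasBasis_nhds_zero F).mem_iff.mp
        (hU.mem_nhds U.zero_mem)
      obtain ⟨n, hn⟩ := exists_pow_mul_lt (valuation_natCast_lt_one (F := F) (p := p)) x γ
      refine ⟨n, hγ ?_⟩
      have := hn n le_rfl
      rw [nsmul_eq_mul]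
      push_cast
      exact this
    · obtain ⟨y, hy0, hy1⟩ := Valuation.IsNontrivial.exists_lt_one (v := valuation F)
      have hy0' : y ≠ 0 := by simpa using hy0
      refine ⟨⟨fun n => (fun x => (y ^ n)⁻¹ * x) '' ((valuation F).ltAddSubgroup 1 : Set F),
        fun n => (isCompact_ltAddSubgroup 1).image (continuous_const_mul _), ?_⟩⟩
      refine Set.eq_univ_of_forall fun x => Set.mem_iUnion.mpr ?_
      obtain ⟨n, hn⟩ := exists_pow_mul_lt hy1 x 1
      exact ⟨n, _, hn n le_rfl, inv_mul_cancel_left₀ (pow_ne_zero _ hy0') x⟩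

/-- Fix `y` with `ψ y ≠ 1`. If `z` is so large that `z⁻¹ y` lies in `U`, then `z` does not
annihilate `U`; so the annihilator is bounded. -/
theorem IsFiniteOrLocalField.exists_isCompact_annihilator {p : ℕ} (hF : IsFiniteOrLocalField F p)
    {M : Type*} [CommMonoid M] {ψ : AddChar F M} (hψ : ψ ≠ 1) {U : AddSubgroup F}
    (hU : IsOpen (U : Set F)) : ∃ K : Set F, IsCompact K ∧ ∀ z, (∀ x ∈ U, ψ (z * x) = 1) → z ∈ K := by
  rcases hF with ⟨_, _, _⟩ | ⟨_, _⟩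
  · exact ⟨Set.univ, Set.finite_univ.isCompact, fun _ _ => trivial⟩
  · obtain ⟨γ, -, hγ⟩ := (IsValuativeTopology.hasBasis_nhds_zero F).mem_iff.mp
      (hU.mem_nhds U.zero_mem)
    obtain ⟨y, hy⟩ := AddChar.ne_one_iff.mp hψ
    refine ⟨_, IsNonarchimedeanLocalField.isCompact_closedBall F (valuation F y / γ),
      fun z hz => ?_⟩
    by_contra hlt
    rw [Set.mem_ofPred_eq, not_le, div_lt_iff₀ (zero_lt_iff.mpr γ.ne_zero)] at hlt
    have hz0 : z ≠ 0 := by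
      rintro rfl
      simp at hlt
    apply hy
    rw [← hz (z⁻¹ * y), mul_inv_cancel_left₀ hz0]
    apply hγ
    change valuation F (z⁻¹ * y) < γ
    rwa [map_mul, map_inv₀, mul_comm, ← div_eq_mul_inv,
      div_lt_iff₀ (zero_lt_iff.mpr (by simpa using hz0)), mul_comm]

end LocalField

/-! ## Duality for the pairing `ψ(⟨w, w'⟩)` -/

section Pairing

variable {F W : Type*} [Field F] [AddCommGroup W] [Module F W] {R : Type*} [CommRing R]

/-- The annihilator `M^⊥ = {w | ψ(⟨w, a⟩) = 1 for all a ∈ M}`. -/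
def perp (form : LinearMap.BilinForm F W) (ψ : AddChar F Rˣ) (M : AddSubgroup W) :
    AddSubgroup W where
  carrier := {w | ∀ a ∈ M, ψ (form w a) = 1}
  zero_mem' := fun a _ => by simp
  add_mem' := fun {x y} hx hy a ha => by
    rw [map_add, LinearMap.add_apply, AddChar.map_add_eq_mul, hx a ha, hy a ha, one_mul]
  neg_mem' := fun {x} hx a ha => by
    rw [map_neg, LinearMap.neg_apply, AddChar.map_neg_eq_inv, hx a ha, inv_one]

theorem mem_perp {form : LinearMap.BilinForm F W} {ψ : AddChar F Rˣ} {M : AddSubgroup W} {w : W} :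
    w ∈ perp form ψ M ↔ ∀ a ∈ M, ψ (form w a) = 1 := Iff.rfl

variable [TopologicalSpace F] [TopologicalSpace W]

/-- The topological properties of the pairing `(w, w') ↦ ψ(⟨w, w'⟩)` on which the theory of the
Heisenberg representation depends. -/
structure IsDualityPairing (p : ℕ) (form : LinearMap.BilinForm F W) (ψ : AddChar F Rˣ) : Prop
    extends IsUnionOfProP p W where
  alt : form.IsAlt
  cont : Continuous fun x : W × W => form x.1 x.2
  locConst : IsLocallyConstant ψ
  perp_subset : ∀ U : AddSubgroup W, IsOpen (U : Set W) →
    ∃ K : Set W, IsCompact K ∧ (perp form ψ U : Set W) ⊆ K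
  sep : ∀ w, (∀ u, ψ (form w u) = 1) → w = 0
  prime : p.Prime
  unit : IsUnit (p : R)
  topGroup : IsTopologicalAddGroup W
  t2 : T2Space W
  topRing : IsTopologicalRing F
  two : (2 : F) ≠ 0

theorem IsFiniteOrLocalField.isDualityPairing [ValuativeRel F] {p : ℕ}
    (hF : IsFiniteOrLocalField F p) [FiniteDimensional F W] [IsModuleTopology F W]
    {form : LinearMap.BilinForm F W} (halt : form.IsAlt) (hnd : form.Nondegenerate)
    {ψ : AddChar F Rˣ} (hψ : IsLocallyConstant ψ) (hψ1 : ψ ≠ 1) (hp : IsUnit (p : R))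
    (h2 : (2 : F) ≠ 0) :
    IsDualityPairing p form ψ := by
  have := hF.isTopologicalRing
  have := hF.t2Space
  have : IsTopologicalAddGroup W := IsModuleTopology.topologicalAddGroup F W
  let b := Module.finBasis F W
  let e := b.equivFun
  have he : Continuous e := IsModuleTopology.continuous_of_linearMap e.toLinearMap
  have he' : Continuous e.symm := IsModuleTopology.continuous_of_linearMap e.symm.toLinearMap
  have hcont : Continuous fun x : W × W => form x.1 x.2 :=
    IsModuleTopology.continuous_bilinear_of_finite_left form
  refine { toIsUnionOfProP := (hF.isUnionOfProP.pi (ι := Fin _)).of_homeomorph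
             e.symm.toAddEquiv he' he
           alt := halt
           cont := hcont
           locConst := hψ
           perp_subset := ?_
           sep := ?_
           prime := hF.prime
           unit := hp
           topGroup := this
           t2 := (T2Space.of_injective_continuous e.injective he)
           topRing := inferInstance
           two := h2 }
  · intro U hU
    choose K hK hKz using fun i => hF.exists_isCompact_annihilator hψ1
      (U := U.comap ((LinearMap.toSpanSingleton F W (b i)).toAddMonoidHom))
      (hU.preimage (IsModuleTopology.continuous_of_linearMap (LinearMap.toSpanSingleton F W (b i))))
    -- By nondegeneracy the coordinates `⟨w, b i⟩` identify `W` with `F^n`. On the annihilator of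
    -- `U`, each coordinate annihilates an open subgroup of `F`, so it stays in a compact set.
    let f : W →ₗ[F] (Fin (Module.finrank F W) → F) := LinearMap.pi fun i => form.flip (b i)
    have hf : Function.Injective f := by
      rw [injective_iff_map_eq_zero]
      intro w hw
      refine hnd.1 w fun y => ?_
      have : form w = 0 := b.ext fun i => congrFun hw i
      rw [this, LinearMap.zero_apply]
    let e' := LinearEquiv.ofInjectiveOfFinrankEq f hf (by simp)
    have he'' : Continuous e'.symm := IsModuleTopology.continuous_of_linearMap e'.symm.toLinearMap
    refine ⟨_, (isCompact_univ_pi hK).image he'', fun w hw => ⟨e' w, fun i _ => ?_, by simp⟩⟩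
    refine hKz i _ fun x hx => ?_
    have h1 : e' w i = form w (b i) := rfl
    rw [h1, mul_comm, ← smul_eq_mul, ← map_smul]
    exact hw _ hx
  · intro w hw
    refine hnd.1 w fun y => ?_
    by_contra h
    obtain ⟨z, hz⟩ := AddChar.ne_one_iff.mp hψ1
    apply hz
    rw [← hw ((z / form w y) • y), map_smul, smul_eq_mul, div_mul_cancel₀ _ h]

namespace IsDualityPairing

variable {p : ℕ} {form : LinearMap.BilinForm F W} {ψ : AddChar F Rˣ}

theorem form_swap (h : IsDualityPairing p form ψ) (x y : W) : form x y = -form y x := by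
  rw [← LinearMap.IsAlt.neg h.alt y x]

theorem continuous_left (h : IsDualityPairing p form ψ) (y : W) : Continuous fun x => form x y :=
  h.cont.comp (continuous_id.prodMk continuous_const)

theorem continuous_right (h : IsDualityPairing p form ψ) (x : W) : Continuous fun y => form x y :=
  h.cont.comp (continuous_const.prodMk continuous_id)

theorem isClosed_perp (h : IsDualityPairing p form ψ) (M : AddSubgroup W) :
    IsClosed (perp form ψ M : Set W) := by
  have : (perp form ψ M : Set W) = ⋂ a ∈ M, (fun w => form w a) ⁻¹' (ψ ⁻¹' {1}) := by
    ext w; simp [mem_perp]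
  rw [this]
  exact isClosed_biInter fun a _ => (h.locConst.isClosed_fiber 1).preimage (h.continuous_left a)

theorem isCompact_perp (h : IsDualityPairing p form ψ) {M : AddSubgroup W}
    (hM : IsOpen (M : Set W)) : IsCompact (perp form ψ M : Set W) := by
  obtain ⟨K, hK, hMK⟩ := h.perp_subset M hM
  exact hK.of_isClosed_subset (h.isClosed_perp M) hMK

/-- The condition `ψ(⟨x, a⟩) = 1` is open in `(x, a)` and holds on `{0} × M`; as `M` is compact, it
holds on `V × M` for a neighbourhood `V` of 0. -/
theorem isOpen_perp (h : IsDualityPairing p form ψ) {M : AddSubgroup W}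
    (hM : IsCompact (M : Set W)) : IsOpen (perp form ψ M : Set W) := by
  have := h.topGroup
  refine AddSubgroup.isOpen_of_mem_nhds _ (g := 0) ?_
  have hop : IsOpen ((fun x : W × W => form x.1 x.2) ⁻¹' (ψ ⁻¹' {1})) :=
    (h.locConst.isOpen_fiber 1).preimage h.cont
  obtain ⟨u, v, hu, -, h0, hMv, huv⟩ := generalized_tube_lemma isCompact_singleton hM hop
    (s := {(0 : W)}) (by
      rintro ⟨x, y⟩ ⟨hx, -⟩
      rw [Set.mem_singleton_iff] at hx
      simp only at hx
      subst hx
      simp)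
  refine Filter.mem_of_superset (hu.mem_nhds (h0 rfl)) fun x hx a ha => ?_
  exact huv (Set.mk_mem_prod hx (hMv ha))

/-- Start from a compact `M₀^⊥`. The part outside `U` is covered by the open sets `ψ(⟨w, y⟩) ≠ 1`,
because the pairing separates points; finitely many `y` suffice, and `M` is taken to contain them
and `M₀`. -/
theorem exists_perp_subset (h : IsDualityPairing p form ψ) {U : Set W} (hU : U ∈ 𝓝 (0 : W)) :
    ∃ M : AddSubgroup W, IsOpen (M : Set W) ∧ IsCompact (M : Set W) ∧
      (perp form ψ M : Set W) ⊆ U := by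
  obtain ⟨M₀, hM₀, hM₀', -⟩ := h.small _ Filter.univ_mem
  obtain ⟨V, hVU, hV, hV0⟩ := mem_nhds_iff.mp hU
  have hK : IsCompact ((perp form ψ M₀ : Set W) \ V) := (h.isCompact_perp hM₀).diff hV
  obtain ⟨t, ht⟩ := hK.elim_finite_subcover
    (fun y : W => (fun w => form w y) ⁻¹' (ψ ⁻¹' {1}ᶜ))
    (fun y => (h.locConst _).preimage (h.continuous_left y)) (by
      rintro x ⟨-, hx⟩
      by_contra hxy
      rw [Set.mem_iUnion] at hxy
      push Not at hxy
      have : x = 0 := h.sep x fun u => by simpa using hxy u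
      exact hx (this ▸ hV0))
  obtain ⟨M, hM, hM', hMt⟩ := h.large _ (hM₀'.union t.finite_toSet.isCompact)
  refine ⟨M, hM, hM', fun x hx => hVU ?_⟩
  by_contra hxV
  have hx0 : x ∈ perp form ψ M₀ := fun a ha => hx a (hMt (Or.inl ha))
  obtain ⟨y, hy, hxy⟩ := Set.mem_iUnion₂.mp (ht ⟨hx0, hxV⟩)
  exact hxy (hx y (hMt (Or.inr hy)))

end IsDualityPairing

end Pairing

/-! ### Characters of finite abelian groups with values in a domain -/

section FiniteDuality

/-- A character that is trivial on a subgroup, as a character of the quotient. -/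
def AddChar.quotientLift {E M : Type*} [AddCommGroup E] [CommGroup M] (N : AddSubgroup E)
    (θ : AddChar E M) (h : ∀ a ∈ N, θ a = 1) : AddChar (E ⧸ N) M :=
  AddChar.toAddMonoidHomEquiv.symm (QuotientAddGroup.lift N (AddChar.toAddMonoidHomEquiv θ) h)

variable {R : Type*} [CommRing R] [IsDomain R]

theorem AddChar.finite_of_finite (E R : Type*) [AddCommGroup E] [Finite E] [CommRing R]
    [IsDomain R] : Finite (AddChar E R) := by
  have : Finite (Multiplicative E) := inferInstanceAs (Finite E)
  have := (linearIndependent_monoidHom (Multiplicative E) R).finite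
  exact Finite.of_equiv _ AddChar.toMonoidHomEquiv.symm

/-- For `θ ∉ Γ`, compute `∑ θ(e) γ(e)` over `e ∈ E`, `γ ∈ Γ` in two ways. Summing over `e` first
gives 0, since no `θγ` is trivial; summing over `γ` first leaves only `e = 0`, since `Γ` separates
points, and gives `|Γ| ≠ 0`. -/
theorem AddChar.eq_top_of_separating [CharZero R] {E : Type*} [AddCommGroup E] [Finite E]
    (Γ : Subgroup (AddChar E R)) (hsep : ∀ e, e ≠ 0 → ∃ γ ∈ Γ, γ e ≠ 1) : Γ = ⊤ := by
  classical
  have := Fintype.ofFinite E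
  have := AddChar.finite_of_finite E R
  have := Fintype.ofFinite Γ
  by_contra hne
  obtain ⟨θ, hθ⟩ : ∃ θ, θ ∉ Γ := by
    by_contra h
    push Not at h
    exact hne (Subgroup.eq_top_iff' Γ |>.mpr h)
  have h1 : ∑ e : E, ∑ γ : Γ, θ e * (γ : AddChar E R) e = 0 := by
    rw [Finset.sum_comm]
    refine Finset.sum_eq_zero fun γ _ => ?_
    have h2 : θ * γ ≠ 0 := by
      intro h3
      apply hθ
      rw [eq_inv_of_mul_eq_one_left (a := θ) (b := (γ : AddChar E R)) h3]
      exact inv_mem γ.2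
    have h4 := AddChar.sum_eq_zero_iff_ne_zero.mpr h2
    simpa only [AddChar.mul_apply] using h4
  have h2 : ∀ e : E, ∑ γ : Γ, θ e * (γ : AddChar E R) e
      = if e = 0 then (Fintype.card Γ : R) else 0 := by
    intro e
    rw [← Finset.mul_sum]
    split_ifs with he
    · subst he
      simp
    · obtain ⟨γ₀, hγ₀, hne⟩ := hsep e he
      have h3 : γ₀ e * ∑ γ : Γ, (γ : AddChar E R) e = ∑ γ : Γ, (γ : AddChar E R) e := by
        rw [Finset.mul_sum]
        exact Fintype.sum_equiv (Equiv.mulLeft (⟨γ₀, hγ₀⟩ : Γ)) _ _ fun γ => rfl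
      have h4 : (γ₀ e - 1) * ∑ γ : Γ, (γ : AddChar E R) e = 0 := by
        rw [sub_mul, h3, one_mul, sub_self]
      rcases mul_eq_zero.mp h4 with h5 | h5
      · exact absurd (sub_eq_zero.mp h5) hne
      · rw [h5, mul_zero]
  rw [Finset.sum_congr rfl fun e _ => h2 e, Finset.sum_ite_eq' Finset.univ (0 : E)] at h1
  simp at h1

/-- The previous lemma on `E ⧸ N`. The intended `Γ` consists of the characters `ψ(⟨·, ω⟩)`, so no
root of unity need be exhibited in `R`. -/
theorem AddChar.mem_of_separating [CharZero R] {E : Type*} [AddCommGroup E] {N : AddSubgroup E}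
    [Finite (E ⧸ N)] (Γ : Subgroup (AddChar E Rˣ)) (hΓ : ∀ γ ∈ Γ, ∀ e ∈ N, γ e = 1)
    (hsep : ∀ e, e ∉ N → ∃ γ ∈ Γ, γ e ≠ 1) {θ : AddChar E Rˣ} (hθ : ∀ e ∈ N, θ e = 1) : θ ∈ Γ := by
  let Γ' : Subgroup (AddChar (E ⧸ N) R) :=
    { carrier := {γ' | ∃ γ ∈ Γ, ∀ e : E, γ' (QuotientAddGroup.mk e) = (γ e : R)}
      one_mem' := ⟨1, one_mem _, fun e => by simp⟩
      mul_mem' := by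
        rintro a b ⟨γ, hγ, h⟩ ⟨γ', hγ', h'⟩
        exact ⟨γ * γ', mul_mem hγ hγ', fun e => by simp [h, h']⟩
      inv_mem' := by
        rintro a ⟨γ, hγ, h⟩
        refine ⟨γ⁻¹, inv_mem hγ, fun e => ?_⟩
        rw [AddChar.inv_apply, AddChar.inv_apply, ← h]
        rfl }
  have htop : Γ' = ⊤ := by
    refine AddChar.eq_top_of_separating Γ' fun q hq => ?_
    obtain ⟨e, rfl⟩ := QuotientAddGroup.mk_surjective q
    obtain ⟨γ, hγ, hγe⟩ := hsep e fun he => hq ((QuotientAddGroup.eq_zero_iff e).mpr he)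
    refine ⟨(Units.coeHom R).compAddChar (γ.quotientLift N (hΓ γ hγ)), ⟨γ, hγ, fun e => rfl⟩, ?_⟩
    exact fun h1 => hγe (Units.ext h1)
  obtain ⟨γ, hγ, h⟩ : (Units.coeHom R).compAddChar (θ.quotientLift N hθ) ∈ Γ' :=
    htop ▸ Subgroup.mem_top _
  have : θ = γ := by
    ext e
    exact h e
  exact this ▸ hγ

theorem AddChar.sum_coe_eq_zero [CharZero R] {E : Type*} [AddCommGroup E] {N : AddSubgroup E}
    [Fintype (E ⧸ N)] {θ : AddChar E Rˣ} (hθ : ∀ e ∈ N, θ e = 1) (hne : ∃ e, θ e ≠ 1) :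
    ∑ q : E ⧸ N, (θ q.out : R) = 0 := by
  classical
  let θ' : AddChar (E ⧸ N) R := (Units.coeHom R).compAddChar (θ.quotientLift N hθ)
  have h1 : ∀ q : E ⧸ N, (θ q.out : R) = θ' q := by
    intro q
    have : θ' (QuotientAddGroup.mk q.out) = (θ q.out : R) := rfl
    rw [← this]
    congr 1
    exact QuotientAddGroup.out_eq' q
  rw [Finset.sum_congr rfl fun q _ => h1 q, AddChar.sum_eq_zero_iff_ne_zero, AddChar.ne_zero_iff]
  obtain ⟨e, he⟩ := hne
  exact ⟨QuotientAddGroup.mk e, fun h => he (Units.ext h)⟩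

end FiniteDuality

/-! ### Finite quotients of compact groups by open subgroups -/

section FiniteQuotient

variable {G : Type*} [AddCommGroup G] [TopologicalSpace G]

theorem finite_quotient_of_subset_isCompact [IsTopologicalAddGroup G] {N P : AddSubgroup G} {K : Set G} (hK : IsCompact K)
    (hNK : (N : Set G) ⊆ K) (hP : IsOpen (P : Set G)) : Finite (N ⧸ P.addSubgroupOf N) := by
  have : DiscreteTopology (G ⧸ P) := QuotientAddGroup.discreteTopology hP
  have hfin : ((QuotientAddGroup.mk : G → G ⧸ P) '' K).Finite :=
    (hK.image QuotientAddGroup.continuous_mk).finite_of_discrete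
  let f : N ⧸ P.addSubgroupOf N →+ G ⧸ P :=
    QuotientAddGroup.map _ P N.subtype fun _ hx => hx
  have hf : Function.Injective f := by
    rw [injective_iff_map_eq_zero]
    intro q hq
    obtain ⟨x, rfl⟩ := QuotientAddGroup.mk_surjective q
    exact (QuotientAddGroup.eq_zero_iff x).mpr ((QuotientAddGroup.eq_zero_iff (x : G)).mp hq)
  have : Finite ((QuotientAddGroup.mk : G → G ⧸ P) '' K) := hfin
  refine Finite.of_injective (β := (QuotientAddGroup.mk : G → G ⧸ P) '' K)
    (fun q => ⟨f q, ?_⟩) fun a b hab => hf (congrArg Subtype.val hab)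
  obtain ⟨x, rfl⟩ := QuotientAddGroup.mk_surjective q
  exact ⟨x, hNK x.2, rfl⟩

/-- Every element of the quotient is killed by a power of `p`. This is what makes division by the
order of the quotient possible, `p` being a unit in the coefficients. -/
theorem exists_card_quotient_eq_pow {p : ℕ} (hp : p.Prime)
    (htors : ∀ (x : G) (U : AddSubgroup G), IsOpen (U : Set G) → ∃ k : ℕ, p ^ k • x ∈ U)
    {N P : AddSubgroup G} (hP : IsOpen (P : Set G)) [Finite (N ⧸ P.addSubgroupOf N)] :
    ∃ k : ℕ, Nat.card (N ⧸ P.addSubgroupOf N) = p ^ k := by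
  have : Fact p.Prime := ⟨hp⟩
  have h : IsPGroup p (Multiplicative (N ⧸ P.addSubgroupOf N)) := by
    intro q
    obtain ⟨x, hx⟩ := QuotientAddGroup.mk_surjective (Multiplicative.toAdd q)
    obtain ⟨k, hk⟩ := htors x P hP
    refine ⟨k, ?_⟩
    have : p ^ k • Multiplicative.toAdd q = 0 := by
      rw [← hx]
      exact (QuotientAddGroup.eq_zero_iff (p ^ k • x)).mpr hk
    exact this
  exact (IsPGroup.iff_card (G := Multiplicative (N ⧸ P.addSubgroupOf N))).mp h

end FiniteQuotient

/-! ### Characters of subgroups of `W` and orthogonals -/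

namespace IsDualityPairing

variable {F W : Type*} [Field F] [AddCommGroup W] [Module F W] {R : Type*} [CommRing R]
  [IsDomain R] [TopologicalSpace F] [TopologicalSpace W]
  {p : ℕ} {form : LinearMap.BilinForm F W} {ψ : AddChar F Rˣ}

/-- Every smooth character of a subgroup of `W` is of the form `a ↦ ψ(⟨a, ω⟩)`. -/
theorem exists_eq_pairing [CharZero R] (h : IsDualityPairing p form ψ) {C : AddSubgroup W}
    (θ : AddChar C Rˣ) {U : Set W} (hU : U ∈ 𝓝 (0 : W)) (hθ : ∀ a : C, (a : W) ∈ U → θ a = 1) :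
    ∃ ω : W, ∀ a : C, θ a = ψ (form a ω) := by
  have := h.topGroup
  obtain ⟨M, hM, hM', hMU⟩ := h.exists_perp_subset hU
  -- Since `θ` is trivial on `C ∩ M^⊥`, a solution `ω` is sought in the compact group `M`. Each
  -- condition `θ a = ψ(⟨a, ω⟩)` is closed in `ω`, so it suffices to satisfy finitely many at a
  -- time.
  have hX : ∀ a : C, IsClosed {ω : W | θ a = ψ (form a ω)} := by
    intro a
    have := (h.locConst.isClosed_fiber (θ a)).preimage (h.continuous_right (a : W))
    convert this using 1
    ext ω
    exact eq_comm
  obtain ⟨ω, -, hω⟩ := hM'.inter_iInter_nonempty _ hX (by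
    intro u
    obtain ⟨L, hL, hL', huL⟩ := h.large ((fun a : C => (a : W)) '' u)
      (u.finite_toSet.image _).isCompact
    -- `E` contains the finitely many given elements and is finite modulo `M^⊥`. The characters
    -- coming from `ω ∈ M` separate `E` modulo `M^⊥` by definition of `M^⊥`, so finite duality
    -- applies.
    let E : AddSubgroup W := C ⊓ L
    have hfin : Finite (E ⧸ (perp form ψ M).addSubgroupOf E) :=
      finite_quotient_of_subset_isCompact hL' (fun x hx => hx.2) (h.isOpen_perp hM')
    let Γ : Subgroup (AddChar E Rˣ) :=
      { carrier := {γ | ∃ ω ∈ M, ∀ e : E, γ e = ψ (form e ω)}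
        one_mem' := ⟨0, M.zero_mem, fun e => by simp⟩
        mul_mem' := by
          rintro a b ⟨ω, hω, h1⟩ ⟨ω', hω', h2⟩
          refine ⟨ω + ω', M.add_mem hω hω', fun e => ?_⟩
          rw [map_add, AddChar.map_add_eq_mul, AddChar.mul_apply, h1, h2]
        inv_mem' := by
          rintro a ⟨ω, hω, h1⟩
          refine ⟨-ω, M.neg_mem hω, fun e => ?_⟩
          rw [map_neg, AddChar.map_neg_eq_inv, AddChar.inv_apply', h1] }
    have hmem : θ.compAddMonoidHom (AddSubgroup.inclusion (inf_le_left : E ≤ C)) ∈ Γ := by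
      refine AddChar.mem_of_separating (N := (perp form ψ M).addSubgroupOf E) Γ ?_ ?_ ?_
      · rintro γ ⟨ω, hω, h1⟩ e he
        rw [h1]
        exact he ω hω
      · intro e he
        have he' : (e : W) ∉ perp form ψ M := he
        rw [mem_perp] at he'
        push Not at he'
        obtain ⟨ω, hω, hne⟩ := he'
        let γ : AddChar E Rˣ := ψ.compAddMonoidHom
          (((form.flip ω).toAddMonoidHom).comp E.subtype)
        exact ⟨γ, ⟨ω, hω, fun e => rfl⟩, hne⟩
      · exact fun e he => hθ _ (hMU he)
    obtain ⟨ω, hω, h1⟩ := hmem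
    refine ⟨ω, hω, Set.mem_iInter₂.mpr fun a ha => ?_⟩
    exact h1 ⟨a, a.2, huL ⟨a, ha, rfl⟩⟩)
  exact ⟨ω, fun a => Set.mem_iInter.mp hω a⟩

/-- For `w ∈ (A ∩ M)^⊥`, the rule `a + m ↦ ψ(⟨w, a⟩)` is a well defined character of `A + M`,
trivial on the open subgroup `M`. It is therefore `ψ(⟨·, ω⟩)`, with `ω ∈ M^⊥`; comparing on `A`
shows `ω + w ∈ A^⊥ = A`. -/
theorem perp_inf_le [CharZero R] (h : IsDualityPairing p form ψ) {A M : AddSubgroup W}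
    (hA : perp form ψ A = A) (hM : IsOpen (M : Set W)) :
    perp form ψ (A ⊓ M) ≤ A ⊔ perp form ψ M := by
  intro w hw
  have hex : ∀ c : (A ⊔ M : AddSubgroup W), ∃ a ∈ A, ∃ m ∈ M, a + m = (c : W) :=
    fun c => AddSubgroup.mem_sup.mp c.2
  choose f hfA g hgM hfg using hex
  have hval : ∀ (c : (A ⊔ M : AddSubgroup W)) (a : W), a ∈ A → (c : W) - a ∈ M →
      ψ (form w (f c)) = ψ (form w a) := by
    intro c a ha hca
    have h1 : f c - a ∈ A ⊓ M := ⟨A.sub_mem (hfA c) ha, by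
      have := M.sub_mem hca (hgM c)
      rwa [← hfg c, show f c + g c - a - g c = f c - a by abel] at this⟩
    have h2 := hw _ h1
    rw [map_sub, AddChar.map_sub_eq_div, div_eq_one] at h2
    exact h2
  let θ : AddChar (A ⊔ M : AddSubgroup W) Rˣ :=
    { toFun := fun c => ψ (form w (f c))
      map_zero_eq_one' := by rw [hval 0 0 A.zero_mem (by simp)]; simp
      map_add_eq_mul' := fun c d => by
        rw [hval (c + d) (f c + f d) (A.add_mem (hfA c) (hfA d)) (by
          have := M.add_mem (hgM c) (hgM d)
          rwa [AddSubgroup.coe_add, ← hfg c, ← hfg d, show f c + g c + (f d + g d) - (f c + f d)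
            = g c + g d by abel]), map_add, AddChar.map_add_eq_mul] }
  have hθ : ∀ (c : (A ⊔ M : AddSubgroup W)) (a : W), a ∈ A → (c : W) - a ∈ M → θ c = ψ (form w a) := hval
  obtain ⟨ω, hω⟩ := h.exists_eq_pairing θ (hM.mem_nhds M.zero_mem) fun c hc => by
    rw [hθ c 0 A.zero_mem (by simpa using hc)]; simp
  have h1 : ω ∈ perp form ψ M := fun m hm => by
    have := hω ⟨m, AddSubgroup.mem_sup_right hm⟩
    rw [hθ _ 0 A.zero_mem (by simpa using hm)] at this
    rw [h.form_swap, AddChar.map_neg_eq_inv, ← this]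
    simp
  have h2 : ω + w ∈ A := by
    rw [← hA]
    intro a ha
    have := hω ⟨a, AddSubgroup.mem_sup_left ha⟩
    rw [hθ _ a ha (by simp)] at this
    rw [map_add, LinearMap.add_apply, AddChar.map_add_eq_mul, this, h.form_swap ω,
      AddChar.map_neg_eq_inv, inv_mul_cancel]
  have : w = (ω + w) + (-ω) := by abel
  rw [this]
  exact AddSubgroup.add_mem_sup h2 (neg_mem h1)

/-- The indicator function of `N^⊥`, on a given compact set modulo `N^⊥`, is an average of
characters `w ↦ ψ(⟨w, a⟩)` with `a ∈ N`. -/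
theorem exists_sum_eq_indicator [CharZero R] (h : IsDualityPairing p form ψ) {N L : AddSubgroup W}
    (hN : IsCompact (N : Set W)) (hL : IsCompact (L : Set W)) :
    ∃ (s : Finset W) (n : ℕ), (∀ a ∈ s, a ∈ N) ∧ IsUnit (n : R) ∧
      (∀ w ∈ perp form ψ N, ∑ a ∈ s, (ψ (form w a) : R) = n) ∧
      (∀ w ∈ L ⊔ perp form ψ N, w ∉ perp form ψ N → ∑ a ∈ s, (ψ (form w a) : R) = 0) := by
  classical
  have := h.topGroup
  have hP := h.isOpen_perp hL
  have hfin : Finite (N ⧸ (perp form ψ L).addSubgroupOf N) :=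
    finite_quotient_of_subset_isCompact hN subset_rfl hP
  have := Fintype.ofFinite (N ⧸ (perp form ψ L).addSubgroupOf N)
  have hinj : Function.Injective
      (fun q : N ⧸ (perp form ψ L).addSubgroupOf N => (q.out : W)) :=
    fun a b hab => Quotient.out_injective (Subtype.ext hab)
  -- `s` represents `N` modulo `N ∩ L^⊥`, a finite group of `p`-power order. For `w ∈ L + N^⊥` the
  -- character `ψ(⟨w, ·⟩)` of `N` factors through this group, and orthogonality evaluates its sum.
  refine ⟨Finset.univ.image fun q : N ⧸ (perp form ψ L).addSubgroupOf N => (q.out : W),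
    Fintype.card (N ⧸ (perp form ψ L).addSubgroupOf N), ?_, ?_, ?_, ?_⟩
  · intro a ha
    obtain ⟨q, -, rfl⟩ := Finset.mem_image.mp ha
    exact q.out.2
  · obtain ⟨k, hk⟩ := exists_card_quotient_eq_pow h.prime h.tors (N := N) hP
    rw [Nat.card_eq_fintype_card] at hk
    rw [hk, Nat.cast_pow]
    exact h.unit.pow k
  · intro w hw
    rw [Finset.sum_image fun a _ b _ hab => hinj hab]
    rw [Finset.sum_congr rfl fun q _ => congrArg Units.val (hw _ q.out.2)]
    simp
  · intro w hw hw'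
    rw [Finset.sum_image fun a _ b _ hab => hinj hab]
    obtain ⟨l, hl, v, hv, rfl⟩ := AddSubgroup.mem_sup.mp hw
    have hlv : ∀ a ∈ N, ψ (form (l + v) a) = ψ (form l a) := fun a ha => by
      rw [map_add, LinearMap.add_apply, AddChar.map_add_eq_mul, hv a ha, mul_one]
    let θ : AddChar N Rˣ := ψ.compAddMonoidHom ((form (l + v)).toAddMonoidHom.comp N.subtype)
    refine AddChar.sum_coe_eq_zero (N := (perp form ψ L).addSubgroupOf N) (θ := θ) ?_ ?_
    · intro e he
      have h1 : ψ (form e l) = 1 := he l hl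
      change ψ (form (l + v) e) = 1
      rw [hlv e e.2, h.form_swap, AddChar.map_neg_eq_inv, h1, inv_one]
    · rw [mem_perp] at hw'
      push Not at hw'
      obtain ⟨a, ha, hne⟩ := hw'
      exact ⟨⟨a, ha⟩, hne⟩

end IsDualityPairing

/-! ## The Heisenberg group -/

namespace Heis

section Algebra

variable {F W : Type*} [Field F] [AddCommGroup W] [Module F W] {form : LinearMap.BilinForm F W}

@[simp] theorem mul_w (x y : Heis form) : (x * y).w = x.w + y.w := rfl
@[simp] theorem mul_t (x y : Heis form) : (x * y).t = x.t + y.t + 1 / 2 * form x.w y.w := rfl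
@[simp] theorem one_w : (1 : Heis form).w = 0 := rfl
@[simp] theorem one_t : (1 : Heis form).t = 0 := rfl

theorem mk_eq_central_mul (w : W) (t : F) : (⟨w, t⟩ : Heis form) = ⟨0, t⟩ * ⟨w, 0⟩ := by
  ext <;> simp

theorem eq_mul_horizontal (a u : W) (t : F) :
    (⟨a + u, t⟩ : Heis form) = ⟨a, t - 1 / 2 * form a u⟩ * ⟨u, 0⟩ := by
  ext <;> simp

theorem horizontal_mul_horizontal (u v : W) :
    (⟨u, 0⟩ * ⟨v, 0⟩ : Heis form) = ⟨0, 1 / 2 * form u v⟩ * ⟨u + v, 0⟩ := by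
  ext <;> simp

theorem mul_comm_central (h : Heis form) (t : F) :
    h * ⟨0, t⟩ = ⟨0, t⟩ * h := by
  ext <;> simp [add_comm]

theorem mul_comm_of_isAlt (halt : form.IsAlt) (h2 : (2 : F) ≠ 0) (x y : Heis form) :
    x * y = ⟨0, form x.w y.w⟩ * (y * x) := by
  have h : form y.w x.w = - form x.w y.w := by rw [← LinearMap.IsAlt.neg halt x.w y.w]
  ext
  · simp [add_comm]
  · simp only [mul_t, mul_w, map_zero, LinearMap.zero_apply, h]
    field_simp
    ring

theorem horizontal_neg_mul (halt : form.IsAlt) (x : W) :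
    (⟨-x, 0⟩ * ⟨x, 0⟩ : Heis form) = 1 := by
  have : form x x = 0 := halt x
  ext <;> simp [this]

theorem horizontal_mul_neg (halt : form.IsAlt) (x : W) :
    (⟨x, 0⟩ * ⟨-x, 0⟩ : Heis form) = 1 := by
  have : form x x = 0 := halt x
  ext <;> simp [this]

end Algebra

section Topology

variable {F W : Type*} [Field F] [AddCommGroup W] [Module F W] [TopologicalSpace F]
  [TopologicalSpace W] {form : LinearMap.BilinForm F W}

theorem continuous_w : Continuous (Heis.w : Heis form → W) :=
  continuous_fst.comp (continuous_induced_dom (f := fun h : Heis form => (h.w, h.t)))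

theorem continuous_t : Continuous (Heis.t : Heis form → F) :=
  continuous_snd.comp (continuous_induced_dom (f := fun h : Heis form => (h.w, h.t)))

theorem continuous_mk {X : Type*} [TopologicalSpace X] {f : X → W} {g : X → F}
    (hf : Continuous f) (hg : Continuous g) : Continuous fun x => (⟨f x, g x⟩ : Heis form) :=
  continuous_induced_rng.mpr (hf.prodMk hg)

end Topology

end Heis

/-! ## The model attached to a self-dual subgroup -/

section Model

variable {F W : Type*} [Field F] [AddCommGroup W] [Module F W] [TopologicalSpace F]
  [TopologicalSpace W] {R B : Type*} [CommRing R] [CommRing B]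

/-- `A` is a closed self-dual subgroup and `χ` is a smooth character of `A_H` that extends `ψ`. -/
structure IsPolarization (φ : R →+* B) {form : LinearMap.BilinForm F W} (ψ : AddChar F Rˣ)
    {A : AddSubgroup W} (χ : Heis.over form A →* Bˣ) : Prop where
  closed : IsClosed (A : Set W)
  perp_eq : perp form ψ A = A
  smooth : IsLocallyConstant χ
  central : ∀ t, (χ (Heis.central form A t) : B) = φ (ψ t : R)

variable {p : ℕ} {form : LinearMap.BilinForm F W} {ψ : AddChar F Rˣ} {φ : R →+* B}
  {A : AddSubgroup W} {χ : Heis.over form A →* Bˣ}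

namespace IsPolarization

theorem le_perp (hA : IsPolarization φ ψ χ) {N : AddSubgroup W} (hN : N ≤ A) :
    A ≤ perp form ψ N := fun w hw => by
  rw [← hA.perp_eq] at hw
  exact fun a ha => hw a (hN ha)

theorem apply_central_mul (hA : IsPolarization φ ψ χ) {f : Heis form → B}
    (hf : ∀ (a : Heis.over form A) (h : Heis form), f (a * h) = χ a * f h) (t : F)
    (h : Heis form) : f (⟨0, t⟩ * h) = φ (ψ t : R) * f h := by
  rw [← hA.central]
  exact hf (Heis.central form A t) h

/-- Commuting `(a, 0)` past `h` costs the central element `⟨h.w, a⟩`. Thus right translation by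
elements of `A` acts as multiplication by functions, the source of all localization below. -/
theorem apply_mul_horizontal (hd : IsDualityPairing p form ψ) (hA : IsPolarization φ ψ χ)
    {f : Heis form → B}
    (hf : ∀ (a : Heis.over form A) (h : Heis form), f (a * h) = χ a * f h) (h : Heis form)
    {a : W} (ha : a ∈ A) :
    f (h * ⟨a, 0⟩) = φ (ψ (form h.w a) : R) * (χ (Heis.horizontal form a ha) * f h) := by
  rw [Heis.mul_comm_of_isAlt hd.alt hd.two, hA.apply_central_mul hf]
  congr 1
  exact hf (Heis.horizontal form a ha) h

theorem exists_apply_horizontal_eq_one (hA : IsPolarization φ ψ χ) :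
    ∃ V ∈ 𝓝 (0 : W), ∀ (a : W) (ha : a ∈ A), a ∈ V → χ (Heis.horizontal form a ha) = 1 := by
  have hc : Continuous fun a : A => Heis.horizontal form (a : W) a.2 :=
    (Heis.continuous_mk continuous_subtype_val continuous_const).subtype_mk _
  have h1 : (fun a : A => Heis.horizontal form (a : W) a.2) ⁻¹' (χ ⁻¹' {1}) ∈ 𝓝 (0 : A) := by
    refine ((hA.smooth.isOpen_fiber 1).preimage hc).mem_nhds ?_
    exact map_one χ
  obtain ⟨V, hV, hVsub⟩ := mem_nhds_subtype _ _ _ |>.mp h1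
  exact ⟨V, hV, fun a ha haV => hVsub (show (⟨a, ha⟩ : A) ∈ _ from haV)⟩

theorem eq_zero_of_natCast_mul {n : ℕ} (hn : IsUnit (n : R)) (φ : R →+* B) {b : B}
    (h : (n : B) * b = 0) : b = 0 := by
  have h1 : IsUnit (n : B) := by
    have := hn.map φ
    rwa [map_natCast] at this
  exact (h1.mul_right_eq_zero).mp h

/-- For `M` small and `a ∈ A ∩ M`, invariance gives `f h = ψ(⟨h.w, a⟩) f h`. Averaging over `A ∩ M`
forces `f h = 0` unless `h.w ∈ (A ∩ M)^⊥ ⊆ A + M^⊥`, and `M^⊥` is compact. -/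
theorem exists_support_subset [IsDomain R] [CharZero R] (hd : IsDualityPairing p form ψ)
    (hA : IsPolarization φ ψ χ) {f : Heis form → B}
    (hf : ∀ (a : Heis.over form A) (h : Heis form), f (a * h) = χ a * f h)
    {U : AddSubgroup W} (hU : IsOpen (U : Set W))
    (hfU : ∀ u ∈ U, ∀ h, f (h * ⟨u, 0⟩) = f h) :
    ∃ L : AddSubgroup W, IsOpen (L : Set W) ∧ IsCompact (L : Set W) ∧
      ∀ h, f h ≠ 0 → h.w ∈ A ⊔ L := by
  obtain ⟨V, hV, hχV⟩ := hA.exists_apply_horizontal_eq_one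
  obtain ⟨M, hM, hM', hMV⟩ := hd.small _ (Filter.inter_mem hV (hU.mem_nhds U.zero_mem))
  refine ⟨perp form ψ M, hd.isOpen_perp hM', hd.isCompact_perp hM, fun h hfh => ?_⟩
  refine hd.perp_inf_le hA.perp_eq hM ?_
  by_contra hw
  obtain ⟨L, -, hL', hhL⟩ := hd.large {h.w} isCompact_singleton
  obtain ⟨s, n, hs, hn, hcard, hsum⟩ := hd.exists_sum_eq_indicator (N := A ⊓ M)
    (hM'.inter_left hA.closed) hL'
  have h1 := hsum h.w (AddSubgroup.mem_sup_left (hhL rfl)) hw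
  have h2 := hcard 0 (zero_mem _)
  simp only [map_zero, LinearMap.zero_apply, AddChar.map_zero_eq_one, Units.val_one,
    Finset.sum_const, nsmul_eq_mul, mul_one] at h2
  apply hfh
  refine eq_zero_of_natCast_mul (n := s.card) (h2 ▸ hn) φ ?_
  have h3 : ∀ a ∈ s, f h = φ (ψ (form h.w a) : R) * f h := fun a ha => by
    have haV := hMV (hs a ha).2
    have h4 := hA.apply_mul_horizontal hd hf h (hs a ha).1
    rwa [hfU a haV.2 h, hχV a _ haV.1, Units.val_one, one_mul] at h4
  rw [← nsmul_eq_mul, ← Finset.sum_const, Finset.sum_congr rfl h3, ← Finset.sum_mul, ← map_sum, h1,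
    map_zero, zero_mul]

/-- Uniform invariance is a sufficient criterion for membership in `V_A`: a point near `h` is `(0,
t) h (u, 0)` with `ψ(t) = 1` and `u ∈ U`, and compactness of the support is automatic by
`exists_support_subset`. -/
theorem mem_indModule_of_invariant [IsDomain R] [CharZero R] (hd : IsDualityPairing p form ψ)
    (hA : IsPolarization φ ψ χ) {f : Heis form → B}
    (hf : ∀ (a : Heis.over form A) (h : Heis form), f (a * h) = χ a * f h)
    {U : AddSubgroup W} (hU : IsOpen (U : Set W))
    (hfU : ∀ u ∈ U, ∀ h, f (h * ⟨u, 0⟩) = f h) : f ∈ indModule form A χ := by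
  have := hd.topGroup
  have := hd.topRing
  have hloc : IsLocallyConstant f := by
    rw [IsLocallyConstant.iff_eventually_eq]
    intro h
    have hc1 : Continuous fun h' : Heis form => h'.w - h.w :=
      Heis.continuous_w.sub continuous_const
    have hc2 : Continuous fun h' : Heis form => h'.t - h.t - 1 / 2 * form h.w (h'.w - h.w) :=
      (Heis.continuous_t.sub continuous_const).sub
        (continuous_const.mul ((hd.continuous_right h.w).comp hc1))
    have e1 : ∀ᶠ h' in 𝓝 h, h'.w - h.w ∈ U :=
      (hU.preimage hc1).mem_nhds (by simp)
    have e2 : ∀ᶠ h' in 𝓝 h, ψ (h'.t - h.t - 1 / 2 * form h.w (h'.w - h.w)) = 1 :=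
      ((hd.locConst.isOpen_fiber 1).preimage hc2).mem_nhds (by simp)
    filter_upwards [e1, e2] with h' h1 h2
    have : h' = ⟨0, h'.t - h.t - 1 / 2 * form h.w (h'.w - h.w)⟩ * (h * ⟨h'.w - h.w, 0⟩) := by
      ext
      · simp
      · simp only [Heis.mul_t, map_zero, LinearMap.zero_apply]; ring
    rw [this, hA.apply_central_mul hf, h2, hfU _ h1, Units.val_one, map_one, one_mul]
  obtain ⟨L, -, hL, hsupp⟩ := hA.exists_support_subset hd hf hU hfU
  -- The support lies in `A_H L`, not in `L`; adjoining it to `L` makes `IsCompactMod.mono`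
  -- applicable without changing the image in `A_H \ H`.
  refine ⟨hloc, hf, IsCompactMod.mono (S := (fun w => (⟨w, 0⟩ : Heis form)) '' L
    ∪ Function.support f) hloc (fun a h h0 => by rw [hf, h0, mul_zero]) ?_
    Set.subset_union_right⟩
  have hcpt : IsCompact ((fun w => (⟨w, 0⟩ : Heis form)) '' (L : Set W)) :=
    hL.image (Heis.continuous_mk continuous_id continuous_const)
  have h3 : IsCompactMod form A ((fun w => (⟨w, 0⟩ : Heis form)) '' (L : Set W)) :=
    hcpt.image continuous_quot_mk
  rw [IsCompactMod, Set.image_union, Set.union_eq_self_of_subset_right]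
  · exact h3
  rintro _ ⟨h, hh, rfl⟩
  obtain ⟨a, ha, l, hl, hal⟩ := AddSubgroup.mem_sup.mp (hsupp h hh)
  refine ⟨_, ⟨l, hl, rfl⟩, Quotient.sound ?_⟩
  refine QuotientGroup.rightRel_apply.mpr ?_
  have : h = ⟨a, h.t - 1 / 2 * form a l⟩ * ⟨l, 0⟩ := by
    rw [← Heis.eq_mul_horizontal, hal]
  rw [this, mul_inv_cancel_right]
  exact ha

/-- Let `G U` be the set of points at which `f` is invariant under `U`. These sets are open, stable
under `A_H` and directed, and they cover `H`; compactness modulo `A_H` yields one `U` valid on the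
support. Elsewhere, a nonzero value at `h(u,0)` could be carried back to `h` by `-u`. -/
theorem exists_invariant_of_mem_indModule (hd : IsDualityPairing p form ψ)
    (hA : IsPolarization φ ψ χ) {f : Heis form → B} (hf : f ∈ indModule form A χ) :
    ∃ U : AddSubgroup W, IsOpen (U : Set W) ∧ IsCompact (U : Set W) ∧
      ∀ u ∈ U, ∀ h, f (h * ⟨u, 0⟩) = f h := by
  have := hd.topGroup
  have := hd.topRing
  obtain ⟨hloc, hf, hcpt⟩ := hf
  -- With `ψ(½⟨u, v⟩) = 1` on `U`, the product `(u,0)(v,0)` acts like `(u+v,0)`; this makes `G U`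
  -- stable under displacement by `U`, hence open.
  let ι := {U : AddSubgroup W // IsOpen (U : Set W) ∧ IsCompact (U : Set W) ∧
    ∀ u ∈ U, ∀ v ∈ U, ψ (1 / 2 * form u v) = 1}
  let G : ι → Set (Heis form) := fun U => {h | ∀ u ∈ U.1, f (h * ⟨u, 0⟩) = f h}
  have hsmall : ∀ V ∈ 𝓝 (0 : W), ∃ U : ι, (U.1 : Set W) ⊆ V := by
    intro V hV
    have hc : Continuous fun x : W × W => 1 / 2 * form x.1 x.2 := continuous_const.mul hd.cont
    have h1 : (fun x : W × W => 1 / 2 * form x.1 x.2) ⁻¹' (ψ ⁻¹' {1}) ∈ 𝓝 ((0 : W), (0 : W)) :=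
      ((hd.locConst.isOpen_fiber 1).preimage hc).mem_nhds (by simp)
    rw [nhds_prod_eq, Filter.mem_prod_iff] at h1
    obtain ⟨V₁, hV₁, V₂, hV₂, h12⟩ := h1
    obtain ⟨U, hU, hU', hUV⟩ := hd.small _ (Filter.inter_mem hV (Filter.inter_mem hV₁ hV₂))
    exact ⟨⟨U, hU, hU', fun u hu v hv => h12 (Set.mk_mem_prod (hUV hu).2.1 (hUV hv).2.2)⟩,
      fun u hu => (hUV hu).1⟩
  have hGmul : ∀ (U : ι) (h : Heis form), h ∈ G U → ∀ u ∈ U.1, ∀ t, (⟨h.w + u, t⟩ : Heis form) ∈ G U := by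
    intro U h hh u hu t v hv
    have h1 : (⟨h.w + u, t⟩ : Heis form) = ⟨0, t - h.t - 1 / 2 * form h.w u⟩ * (h * ⟨u, 0⟩) := by
      ext
      · simp
      · simp only [Heis.mul_t, map_zero, LinearMap.zero_apply]; ring
    rw [h1, mul_assoc, hA.apply_central_mul hf, hA.apply_central_mul hf, mul_assoc,
      Heis.horizontal_mul_horizontal, ← mul_assoc, Heis.mul_comm_central, mul_assoc,
      hA.apply_central_mul hf, U.2.2.2 u hu v hv, hh _ (U.1.add_mem hu hv), hh u hu]
    simp
  have hGopen : ∀ U, IsOpen (G U) := by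
    intro U
    rw [isOpen_iff_mem_nhds]
    intro h hh
    have hc1 : Continuous fun h' : Heis form => h'.w - h.w :=
      Heis.continuous_w.sub continuous_const
    have e1 : ∀ᶠ h' in 𝓝 h, h'.w - h.w ∈ U.1 := (U.2.1.preimage hc1).mem_nhds (by simp)
    filter_upwards [e1] with h' h1
    have := hGmul U h hh _ h1 h'.t
    rwa [add_sub_cancel] at this
  have hGleft : ∀ (U : ι) (a : Heis.over form A) (h : Heis form), (a : Heis form) * h ∈ G U →
      h ∈ G U := by
    intro U a h hah u hu
    have := hah u hu
    rw [mul_assoc, hf, hf] at this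
    exact (χ a).isUnit.mul_left_cancel this
  have hGmem : ∀ h, ∃ U, h ∈ G U := by
    intro h
    have hc : Continuous fun u : W => h * (⟨u, 0⟩ : Heis form) := by
      refine Heis.continuous_mk (f := fun u => h.w + u) (g := fun u => h.t + 0 + 1 / 2 * form h.w u)
        (continuous_const.add continuous_id)
        (continuous_const.add (continuous_const.mul (hd.continuous_right h.w)))
    obtain ⟨U, hU⟩ := hsmall _ (((hloc.isOpen_fiber (f h)).preimage hc).mem_nhds (by
      have : h * (⟨0, 0⟩ : Heis form) = h := mul_one h
      simp [this]))
    exact ⟨U, fun u hu => hU hu⟩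
  have hpre : ∀ U, (Quotient.mk (QuotientGroup.rightRel (Heis.over form A))) ⁻¹'
      ((Quotient.mk (QuotientGroup.rightRel (Heis.over form A))) '' G U) = G U := by
    intro U
    refine Set.Subset.antisymm ?_ (Set.subset_preimage_image _ _)
    rintro x ⟨y, hy, hxy⟩
    have hr := QuotientGroup.rightRel_apply.mp (Quotient.exact hxy)
    refine hGleft U ⟨_, inv_mem hr⟩ x ?_
    simpa using hy
  obtain ⟨U₀, -⟩ := hsmall _ Filter.univ_mem
  have : Nonempty ι := ⟨U₀⟩
  obtain ⟨U, hU⟩ := hcpt.elim_directed_cover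
    (fun U => (Quotient.mk (QuotientGroup.rightRel (Heis.over form A))) '' G U)
    (fun U => isOpen_coinduced.mpr ((hpre U).symm ▸ hGopen U)) (by
      rintro _ ⟨h, -, rfl⟩
      obtain ⟨U, hU⟩ := hGmem h
      exact Set.mem_iUnion.mpr ⟨U, h, hU, rfl⟩) (by
      intro U V
      obtain ⟨X, hX⟩ := hsmall _ (Filter.inter_mem (U.2.1.mem_nhds U.1.zero_mem)
        (V.2.1.mem_nhds V.1.zero_mem))
      exact ⟨X, Set.image_mono fun h hh u hu => hh u (hX hu).1,
        Set.image_mono fun h hh u hu => hh u (hX hu).2⟩)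
  have hUG : ∀ h, f h ≠ 0 → h ∈ G U := fun h hh => by
    rw [← hpre U]
    exact hU ⟨h, hh, rfl⟩
  refine ⟨U.1, U.2.1, U.2.2.1, fun u hu h => ?_⟩
  by_cases hh : f h = 0
  · by_contra hne
    rw [hh] at hne
    have := hUG _ hne (-u) (U.1.neg_mem hu)
    rw [mul_assoc, Heis.horizontal_mul_neg hd.alt, mul_one, hh] at this
    exact hne this.symm
  · exact hUG h hh u hu

end IsPolarization

end Model

/-! ### The Heisenberg action, localization and Schur's lemma -/

section Schur

variable {F W : Type*} [Field F] [AddCommGroup W] [Module F W] [TopologicalSpace F]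
  [TopologicalSpace W] {R B : Type*} [CommRing R] [CommRing B]
  {p : ℕ} {form : LinearMap.BilinForm F W} {ψ : AddChar F Rˣ} {φ : R →+* B}
  {A : AddSubgroup W} {χ : Heis.over form A →* Bˣ}

theorem indModule.apply_mul (f : indModule form A χ) (a : Heis.over form A) (h : Heis form) :
    (f : Heis form → B) (a * h) = χ a * (f : Heis form → B) h := f.2.2.1 a h

theorem indModule.translate_mem [IsDomain R] [CharZero R] (hd : IsDualityPairing p form ψ)
    (hA : IsPolarization φ ψ χ) {f : Heis form → B} (hf : f ∈ indModule form A χ)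
    (x : Heis form) : (fun h => f (h * x)) ∈ indModule form A χ := by
  obtain ⟨U, hU, -, hfU⟩ := hA.exists_invariant_of_mem_indModule hd hf
  -- Moving `(u, 0)` past `x` produces the scalar `ψ(⟨u, x.w⟩)`; the invariance group is shrunk to
  -- make it trivial.
  have hP : IsOpen ((U : Set W) ∩ (fun u => form u x.w) ⁻¹' (ψ ⁻¹' {1})) :=
    hU.inter ((hd.locConst.isOpen_fiber 1).preimage (hd.continuous_left x.w))
  obtain ⟨V, hV, -, hVU⟩ := hd.small _ (hP.mem_nhds ⟨U.zero_mem, by simp⟩)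
  refine hA.mem_indModule_of_invariant hd (U := V) (fun a h => ?_) hV fun u hu h => ?_
  · rw [mul_assoc, hf.2.1]
  · have h1 : ψ (form u x.w) = 1 := (hVU hu).2
    rw [mul_assoc, Heis.mul_comm_of_isAlt hd.alt hd.two ⟨u, 0⟩ x, ← mul_assoc,
      Heis.mul_comm_central, mul_assoc, hA.apply_central_mul hf.2.1, h1, ← mul_assoc,
      hfU u (hVU hu).1, Units.val_one, map_one, one_mul]

/-- The action of the Heisenberg group on `V_A` by right translation. -/
noncomputable def indModule.translate [IsDomain R] [CharZero R] (hd : IsDualityPairing p form ψ)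
    (hA : IsPolarization φ ψ χ) (x : Heis form) : indModule form A χ →ₗ[B] indModule form A χ where
  toFun f := ⟨fun h => (f : Heis form → B) (h * x), indModule.translate_mem hd hA f.2 x⟩
  map_add' _ _ := rfl
  map_smul' _ _ := rfl

variable [IsDomain R] [CharZero R]

@[simp] theorem indModule.translate_apply (hd : IsDualityPairing p form ψ)
    (hA : IsPolarization φ ψ χ) (x : Heis form) (f : indModule form A χ) (h : Heis form) :
    (indModule.translate hd hA x f : Heis form → B) h = (f : Heis form → B) (h * x) := rfl

/-- `g` is the product of `f` with the indicator function of `x + (A ∩ M)^⊥`. -/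
def IsCut (ψ : AddChar F Rˣ) (A M : AddSubgroup W) (x : W) (f g : Heis form → B) : Prop :=
  ∀ h, (h.w - x ∈ perp form ψ (A ⊓ M) → g h = f h) ∧ (h.w - x ∉ perp form ψ (A ⊓ M) → g h = 0)

namespace IsPolarization

/-- Weighting the translation by `(a, 0)` with `χ(a)⁻¹ ψ(⟨-x, a⟩)/n` turns it into multiplication by
`ψ(⟨h.w - x, a⟩)/n`, and these sum to the indicator. The same coefficients serve every `f` supported
in `A + L`; this uniformity is what `isCut_map` needs. -/
theorem exists_finset_cut (hd : IsDualityPairing p form ψ) (hA : IsPolarization φ ψ χ)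
    {M L : AddSubgroup W} (hM : IsCompact (M : Set W)) (hL : IsCompact (L : Set W)) (x : W) :
    ∃ (s : Finset W) (c : W → B), ∀ f : indModule form A χ,
      (∀ h, (f : Heis form → B) h ≠ 0 → h.w ∈ A ⊔ L) →
      IsCut ψ A M x (f : Heis form → B)
        (∑ a ∈ s, c a • indModule.translate hd hA ⟨a, 0⟩ f : indModule form A χ) := by
  classical
  have := hd.topGroup
  -- `x` is included in `L'` so that the differences `h.w - x` remain in the range where the average
  -- is an indicator.
  obtain ⟨L', -, hL', hLL'⟩ := hd.large _ (hL.union (isCompact_singleton (x := x)))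
  obtain ⟨s, n, hs, hn, hcard, hsum⟩ := hd.exists_sum_eq_indicator (N := A ⊓ M)
    (hM.inter_left hA.closed) hL'
  obtain ⟨u, hu⟩ : IsUnit (n : B) := by
    have := hn.map φ
    rwa [map_natCast] at this
  refine ⟨s, fun a => if ha : a ∈ A then
    ((u⁻¹ : Bˣ) : B) * (φ (ψ (form (-x) a) : R) * ((χ (Heis.horizontal form a ha))⁻¹ : Bˣ)) else 0,
    fun f hf h => ?_⟩
  have hval : ((∑ a ∈ s, (if ha : a ∈ A then
    ((u⁻¹ : Bˣ) : B) * (φ (ψ (form (-x) a) : R) * ((χ (Heis.horizontal form a ha))⁻¹ : Bˣ)) else 0)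
      • indModule.translate hd hA ⟨a, 0⟩ f : indModule form A χ) : Heis form → B) h
      = ((u⁻¹ : Bˣ) : B) * φ (∑ a ∈ s, (ψ (form (h.w - x) a) : R)) * (f : Heis form → B) h := by
    rw [AddSubmonoidClass.coe_finsetSum, Finset.sum_apply, map_sum, Finset.mul_sum,
      Finset.sum_mul]
    refine Finset.sum_congr rfl fun a ha => ?_
    have haA : a ∈ A := (hs a ha).1
    rw [dif_pos haA, Submodule.coe_smul, Pi.smul_apply, indModule.translate_apply,
      hA.apply_mul_horizontal hd (indModule.apply_mul f) h haA, sub_eq_add_neg, map_add,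
      LinearMap.add_apply, AddChar.map_add_eq_mul, Units.val_mul, map_mul, smul_eq_mul]
    have hc : (((χ (Heis.horizontal form a haA))⁻¹ : Bˣ) : B) * χ (Heis.horizontal form a haA) = 1 :=
      Units.inv_mul _
    linear_combination (((u⁻¹ : Bˣ) : B) * φ (ψ (form (-x) a) : R) * φ (ψ (form h.w a) : R)
      * (f : Heis form → B) h) * hc
  refine ⟨fun hP => ?_, fun hP => ?_⟩
  · rw [hval, hcard _ hP, map_natCast, ← hu, Units.inv_mul, one_mul]
  · rw [hval]
    by_cases hfh : (f : Heis form → B) h = 0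
    · rw [hfh, mul_zero]
    · rw [hsum _ ?_ hP, map_zero, mul_zero, zero_mul]
      have hle : A ⊔ L ≤ L' ⊔ perp form ψ (A ⊓ M) :=
        sup_le ((hA.le_perp inf_le_left).trans le_sup_right)
          fun l hl => AddSubgroup.mem_sup_left (hLL' (Or.inl hl))
      exact sub_mem (hle (hf h hfh)) (AddSubgroup.mem_sup_left (hLL' (Or.inr rfl)))

theorem exists_support_subset' (hd : IsDualityPairing p form ψ) (hA : IsPolarization φ ψ χ)
    (f : indModule form A χ) : ∃ L : AddSubgroup W, IsCompact (L : Set W) ∧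
      ∀ h, (f : Heis form → B) h ≠ 0 → h.w ∈ A ⊔ L := by
  obtain ⟨U, hU, -, hfU⟩ := hA.exists_invariant_of_mem_indModule hd f.2
  obtain ⟨L, -, hL, h⟩ := hA.exists_support_subset hd f.2.2.1 hU hfU
  exact ⟨L, hL, h⟩

theorem exists_isCut_mem (hd : IsDualityPairing p form ψ) (hA : IsPolarization φ ψ χ)
    {M : AddSubgroup W} (hM : IsCompact (M : Set W)) (x : W) {N : Submodule B (indModule form A χ)}
    (hN : ∀ x, ∀ f ∈ N, indModule.translate hd hA x f ∈ N) {f : indModule form A χ} (hf : f ∈ N) :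
    ∃ g ∈ N, IsCut ψ A M x (f : Heis form → B) g := by
  obtain ⟨L, hL, hfL⟩ := hA.exists_support_subset' hd f
  obtain ⟨s, c, h⟩ := hA.exists_finset_cut hd hM hL x
  exact ⟨_, N.sum_mem fun a _ => N.smul_mem _ (hN _ _ hf), h f hfL⟩

theorem exists_isCut (hd : IsDualityPairing p form ψ) (hA : IsPolarization φ ψ χ)
    {M : AddSubgroup W} (hM : IsCompact (M : Set W)) (x : W) (f : indModule form A χ) :
    ∃ g : indModule form A χ, IsCut ψ A M x (f : Heis form → B) g := by
  obtain ⟨g, -, hg⟩ := hA.exists_isCut_mem hd hM x (N := ⊤) (fun _ _ _ => trivial)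
    (f := f) trivial
  exact ⟨g, hg⟩

/-- With `L` large enough for the supports of both `f` and `T f`, one combination of translations
cuts both, and `T` commutes with it. Thus equivariant maps are local modulo `A`. -/
theorem isCut_map (hd : IsDualityPairing p form ψ) (hA : IsPolarization φ ψ χ)
    {M : AddSubgroup W} (hM : IsCompact (M : Set W)) (x : W)
    {T : indModule form A χ →ₗ[B] indModule form A χ}
    (hT : ∀ x f, T (indModule.translate hd hA x f) = indModule.translate hd hA x (T f))
    {f g : indModule form A χ} (hg : IsCut ψ A M x (f : Heis form → B) g) :
    IsCut ψ A M x (T f : Heis form → B) (T g) := by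
  obtain ⟨L₁, hL₁, hf₁⟩ := hA.exists_support_subset' hd f
  obtain ⟨L₂, hL₂, hf₂⟩ := hA.exists_support_subset' hd (T f)
  obtain ⟨L, -, hL, hLL⟩ := hd.large _ (hL₁.union hL₂)
  obtain ⟨s, c, h⟩ := hA.exists_finset_cut hd hM hL x
  have h1 := h f fun y hy => sup_le_sup_left (fun l hl => hLL (Or.inl hl)) A (hf₁ y hy)
  have h2 := h (T f) fun y hy => sup_le_sup_left (fun l hl => hLL (Or.inr hl)) A (hf₂ y hy)
  have h3 : g = ∑ a ∈ s, c a • indModule.translate hd hA ⟨a, 0⟩ f := by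
    refine Subtype.ext (funext fun y => ?_)
    by_cases hy : y.w - x ∈ perp form ψ (A ⊓ M)
    · rw [(hg y).1 hy, (h1 y).1 hy]
    · rw [(hg y).2 hy, (h1 y).2 hy]
  rw [h3, map_sum]
  simpa only [map_smul, hT] using h2

/-- By equivariance and right invariance `f` vanishes on `A_H (U, 0)`, and `(A ∩ M)^⊥ ⊆ A + M^⊥ ⊆ A
+ U` once `M^⊥ ⊆ U`. -/
theorem exists_vanishing (hd : IsDualityPairing p form ψ) (hA : IsPolarization φ ψ χ)
    (f : indModule form A χ) (hf : (f : Heis form → B) 1 = 0) :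
    ∃ M : AddSubgroup W, IsOpen (M : Set W) ∧ IsCompact (M : Set W) ∧
      ∀ h : Heis form, h.w ∈ perp form ψ (A ⊓ M) → (f : Heis form → B) h = 0 := by
  obtain ⟨U, hU, -, hfU⟩ := hA.exists_invariant_of_mem_indModule hd f.2
  obtain ⟨M, hM, hM', hMU⟩ := hd.exists_perp_subset (hU.mem_nhds U.zero_mem)
  refine ⟨M, hM, hM', fun h hh => ?_⟩
  obtain ⟨a, ha, u, hu, hau⟩ := AddSubgroup.mem_sup.mp (hd.perp_inf_le hA.perp_eq hM hh)
  have h1 : h = (⟨⟨a, h.t - 1 / 2 * form a u⟩, ha⟩ : Heis.over form A) * (1 * ⟨u, 0⟩) := by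
    rw [one_mul, ← Heis.eq_mul_horizontal, hau]
  rw [h1, indModule.apply_mul, hfU u (hMU hu), hf, mul_zero]

/-- The function `a (u, 0) ↦ χ(a)` on `A_H (U, 0)`, extended by zero. It is well defined and
invariant when `U` is so small that `χ` is trivial on `A ∩ U` and `ψ(½⟨·,·⟩)` on `U × U`. -/
theorem exists_apply_one_eq_one (hd : IsDualityPairing p form ψ) (hA : IsPolarization φ ψ χ) :
    ∃ e : indModule form A χ, (e : Heis form → B) 1 = 1 := by
  classical
  obtain ⟨V, hV, hχV⟩ := hA.exists_apply_horizontal_eq_one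
  have := hd.topRing
  have hc : Continuous fun x : W × W => 1 / 2 * form x.1 x.2 := continuous_const.mul hd.cont
  have h1 : (fun x : W × W => 1 / 2 * form x.1 x.2) ⁻¹' (ψ ⁻¹' {1}) ∈ 𝓝 ((0 : W), (0 : W)) :=
    ((hd.locConst.isOpen_fiber 1).preimage hc).mem_nhds (by simp)
  rw [nhds_prod_eq, Filter.mem_prod_iff] at h1
  obtain ⟨V₁, hV₁, V₂, hV₂, h12⟩ := h1
  obtain ⟨U, hU, -, hUV⟩ := hd.small _ (Filter.inter_mem hV (Filter.inter_mem hV₁ hV₂))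
  have hiso : ∀ u ∈ U, ∀ v ∈ U, ψ (1 / 2 * form u v) = 1 := fun u hu v hv =>
    h12 (Set.mk_mem_prod (hUV hu).2.1 (hUV hv).2.2)
  have huniq : ∀ (a a' : Heis.over form A) (u u' : W), u ∈ U → u' ∈ U →
      (a : Heis form) * ⟨u, 0⟩ = a' * ⟨u', 0⟩ → χ a = χ a' := by
    intro a a' u u' hu hu' h
    have h2 : ((a'⁻¹ * a : Heis.over form A) : Heis form)
        = ⟨0, 1 / 2 * form u' (-u)⟩ * ⟨u' + -u, 0⟩ := by
      rw [← Heis.horizontal_mul_horizontal]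
      have h3 : (⟨-u, 0⟩ : Heis form) = (⟨u, 0⟩)⁻¹ := by
        rw [eq_inv_iff_mul_eq_one]
        exact Heis.horizontal_neg_mul hd.alt u
      rw [h3, eq_mul_inv_iff_mul_eq]
      change ((a' : Heis form)⁻¹ * a) * ⟨u, 0⟩ = _
      rw [mul_assoc, h, inv_mul_cancel_left]
    have hmem : u' + -u ∈ A := by
      have := (a'⁻¹ * a).2
      rw [h2] at this
      simpa [Heis.over] using this
    have h4 : a'⁻¹ * a = Heis.central form A (1 / 2 * form u' (-u))
        * Heis.horizontal form (u' + -u) hmem := Subtype.ext h2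
    have h5 : χ (a'⁻¹ * a) = 1 := by
      rw [h4, map_mul, hχV _ hmem (hUV (U.add_mem hu' (U.neg_mem hu))).1, mul_one]
      ext
      rw [hA.central, hiso u' hu' (-u) (U.neg_mem hu)]
      simp
    rw [map_mul, map_inv, inv_mul_eq_one] at h5
    exact h5.symm
  let e : Heis form → B := fun h =>
    if H : ∃ a : Heis.over form A, ∃ u ∈ U, h = a * ⟨u, 0⟩ then χ H.choose else 0
  have he : ∀ (a : Heis.over form A) (u : W), u ∈ U → e (a * ⟨u, 0⟩) = χ a := by
    intro a u hu
    have H : ∃ b : Heis.over form A, ∃ v ∈ U, (a : Heis form) * ⟨u, 0⟩ = b * ⟨v, 0⟩ :=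
      ⟨a, u, hu, rfl⟩
    obtain ⟨v, hv, h2⟩ := H.choose_spec
    change dite _ _ _ = _
    rw [dif_pos H]
    exact congrArg Units.val (huniq _ _ _ _ hu hv h2).symm
  have he0 : ∀ h : Heis form, (¬ ∃ a : Heis.over form A, ∃ u ∈ U, h = a * ⟨u, 0⟩) → e h = 0 :=
    fun h H => dif_neg H
  have hequiv : ∀ (a : Heis.over form A) (h : Heis form), e (a * h) = χ a * e h := by
    intro a h
    by_cases H : ∃ b : Heis.over form A, ∃ u ∈ U, h = b * ⟨u, 0⟩
    · obtain ⟨b, u, hu, rfl⟩ := H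
      rw [he b u hu, ← mul_assoc, ← Subgroup.coe_mul, he _ u hu, map_mul, Units.val_mul]
    · rw [he0 h H, mul_zero]
      refine he0 _ fun ⟨b, u, hu, h2⟩ => H ⟨a⁻¹ * b, u, hu, ?_⟩
      rw [Subgroup.coe_mul, mul_assoc, ← h2, Subgroup.coe_inv, inv_mul_cancel_left]
  have hinv' : ∀ v ∈ U, ∀ h : Heis form, (∃ b : Heis.over form A, ∃ u ∈ U, h = b * ⟨u, 0⟩) →
      e (h * ⟨v, 0⟩) = e h := by
    rintro v hv _ ⟨b, u, hu, rfl⟩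
    rw [mul_assoc, Heis.horizontal_mul_horizontal, hequiv, hA.apply_central_mul hequiv,
      hiso u hu v hv]
    have h2 := he 1 _ (U.add_mem hu hv)
    rw [Subgroup.coe_one, one_mul, map_one] at h2
    rw [h2, he b u hu]
    simp
  refine ⟨⟨e, hA.mem_indModule_of_invariant hd hequiv hU fun v hv h => ?_⟩, ?_⟩
  · by_cases H : ∃ b : Heis.over form A, ∃ u ∈ U, h = b * ⟨u, 0⟩
    · exact hinv' v hv h H
    · by_cases H' : ∃ b : Heis.over form A, ∃ u ∈ U, h * ⟨v, 0⟩ = b * ⟨u, 0⟩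
      · have := hinv' (-v) (U.neg_mem hv) _ H'
        rw [mul_assoc, Heis.horizontal_mul_neg hd.alt, mul_one] at this
        exact this.symm
      · rw [he0 _ H, he0 _ H']
  · have := he 1 0 U.zero_mem
    rw [Subgroup.coe_one, one_mul, map_one] at this
    exact this

/-- A submodule of `V_A` that is stable under the Heisenberg group and contains a function with
value `1` at the identity is everything. -/
theorem eq_top_of_translate_mem (hd : IsDualityPairing p form ψ) (hA : IsPolarization φ ψ χ)
    {N : Submodule B (indModule form A χ)}
    (hN : ∀ x, ∀ f ∈ N, indModule.translate hd hA x f ∈ N)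
    {f₀ : indModule form A χ} (hf₀ : f₀ ∈ N) (hf₀1 : (f₀ : Heis form → B) 1 = 1) : N = ⊤ := by
  classical
  have := hd.topGroup
  rw [eq_top_iff]
  rintro f -
  -- Around `x`, `f` is a multiple of a translate of `f₀`: the function `ρ(x,0) f - f(x,0) f₀`
  -- vanishes at 1, hence on a whole `(A ∩ M)^⊥`. Cutting `f₀` there and translating back gives an
  -- element of `N`.
  have key : ∀ x : W, ∃ M : AddSubgroup W, IsOpen (M : Set W) ∧ IsCompact (M : Set W) ∧
      ∃ g ∈ N, IsCut ψ A M x (f : Heis form → B) g := by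
    intro x
    let fx := indModule.translate hd hA ⟨x, 0⟩ f
    obtain ⟨M, hM, hM', hM1⟩ := hA.exists_vanishing hd
      (fx - (f : Heis form → B) ⟨x, 0⟩ • f₀) (by
        change (f : Heis form → B) (1 * ⟨x, 0⟩) - (f : Heis form → B) ⟨x, 0⟩
          * (f₀ : Heis form → B) 1 = 0
        rw [hf₀1, one_mul, mul_one, sub_self])
    obtain ⟨g, hg, hcut⟩ := hA.exists_isCut_mem hd hM' 0 hN hf₀
    refine ⟨M, hM, hM', _, hN ⟨-x, 0⟩ _ (N.smul_mem ((f : Heis form → B) ⟨x, 0⟩) hg),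
      fun h => ⟨fun hP => ?_, fun hP => ?_⟩⟩
    · have hw : (h * (⟨-x, 0⟩ : Heis form)).w = h.w - x := by
        rw [Heis.mul_w, sub_eq_add_neg]
      have h1 := hM1 (h * ⟨-x, 0⟩) (by rwa [hw])
      have h2 := (hcut (h * ⟨-x, 0⟩)).1 (by rwa [hw, sub_zero])
      change (f : Heis form → B) ((h * ⟨-x, 0⟩) * ⟨x, 0⟩) - (f : Heis form → B) ⟨x, 0⟩
          * (f₀ : Heis form → B) (h * ⟨-x, 0⟩) = 0 at h1
      change (f : Heis form → B) ⟨x, 0⟩ * (g : Heis form → B) (h * ⟨-x, 0⟩) = _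
      rw [mul_assoc, Heis.horizontal_neg_mul hd.alt, mul_one] at h1
      rw [h2]
      exact (sub_eq_zero.mp h1).symm
    · have hw : (h * (⟨-x, 0⟩ : Heis form)).w = h.w - x := by
        rw [Heis.mul_w, sub_eq_add_neg]
      have h2 := (hcut (h * ⟨-x, 0⟩)).2 (by rwa [hw, sub_zero])
      change (f : Heis form → B) ⟨x, 0⟩ * (g : Heis form → B) (h * ⟨-x, 0⟩) = _
      rw [h2, mul_zero]
  choose M hM hM' G hGN hG using key
  obtain ⟨L, hL, hfL⟩ := hA.exists_support_subset' hd f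
  have hPopen : ∀ M : AddSubgroup W, IsCompact (M : Set W) →
      IsOpen (perp form ψ (A ⊓ M) : Set W) := fun M hM =>
    hd.isOpen_perp (hM.inter_left hA.closed)
  -- Finitely many of these neighbourhoods cover `L`. A common `M₀` gives a finer subgroup `P`, and
  -- `f` is the finite sum of its cuts along the cosets of `P` that meet `L`; each is a further cut
  -- of a local piece, hence in `N`.
  obtain ⟨t, ht⟩ := hL.elim_finite_subcover
    (fun x => (fun y => y - x) ⁻¹' (perp form ψ (A ⊓ M x) : Set W))
    (fun x => (hPopen _ (hM' x)).preimage (continuous_id.sub continuous_const))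
    (fun x _ => Set.mem_iUnion.mpr ⟨x, by simp⟩)
  obtain ⟨M₀, hM₀, hM₀', hMM⟩ := hd.large (⋃ x ∈ t, (M x : Set W))
    (t.isCompact_biUnion fun x _ => hM' x)
  set P := perp form ψ (A ⊓ M₀) with hPdef
  have hle : ∀ x ∈ t, P ≤ perp form ψ (A ⊓ M x) := fun x hx w hw a ha =>
    hw a ⟨ha.1, hMM (Set.mem_iUnion₂.mpr ⟨x, hx, ha.2⟩)⟩
  have : DiscreteTopology (W ⧸ P) := QuotientAddGroup.discreteTopology (hPopen M₀ hM₀')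
  have hfin : ((QuotientAddGroup.mk : W → W ⧸ P) '' L).Finite :=
    (hL.image QuotientAddGroup.continuous_mk).finite_of_discrete
  have hpiece : ∀ q ∈ hfin.toFinset, ∃ g ∈ N, IsCut ψ A M₀ q.out (f : Heis form → B) g := by
    intro q hq
    obtain ⟨l, hl, hlq⟩ := hfin.mem_toFinset.mp hq
    obtain ⟨x, hx, hlx⟩ := Set.mem_iUnion₂.mp (ht hl)
    have hlx' : l - x ∈ perp form ψ (A ⊓ M x) := hlx
    have hql : q.out - l ∈ P := by
      have : (QuotientAddGroup.mk l : W ⧸ P) = QuotientAddGroup.mk q.out := by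
        rw [hlq]; exact (QuotientAddGroup.out_eq' q).symm
      have := QuotientAddGroup.eq.mp this
      rwa [neg_add_eq_sub] at this
    obtain ⟨g, hg, hcut⟩ := hA.exists_isCut_mem hd hM₀' q.out hN (hGN x)
    refine ⟨g, hg, fun h => ⟨fun hP => ?_, (hcut h).2⟩⟩
    rw [(hcut h).1 hP, (hG x h).1]
    have h3 : h.w - x = (h.w - q.out) + ((q.out - l) + (l - x)) := by abel
    rw [h3]
    exact add_mem (hle x hx hP) (add_mem (hle x hx hql) hlx')
  choose! g hgN hg using hpiece
  have hsum : f = ∑ q ∈ hfin.toFinset, g q := by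
    refine Subtype.ext (funext fun h => ?_)
    rw [AddSubmonoidClass.coe_finsetSum, Finset.sum_apply]
    have hiff : ∀ q : W ⧸ P, h.w - q.out ∈ P ↔ q = QuotientAddGroup.mk h.w := by
      intro q
      rw [← neg_add_eq_sub, ← QuotientAddGroup.eq]
      exact ⟨fun h => by rw [← h]; exact (QuotientAddGroup.out_eq' q).symm,
        fun h => by rw [← h]; exact QuotientAddGroup.out_eq' q⟩
    by_cases hfh : (f : Heis form → B) h = 0
    · rw [hfh]
      refine (Finset.sum_eq_zero fun q hq => ?_).symm
      by_cases hP : h.w - q.out ∈ P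
      · rw [(hg q hq h).1 hP, hfh]
      · exact (hg q hq h).2 hP
    · obtain ⟨a, ha, l, hl, hal⟩ := AddSubgroup.mem_sup.mp (hfL h hfh)
      have hmem : (QuotientAddGroup.mk h.w : W ⧸ P) ∈ hfin.toFinset := by
        refine hfin.mem_toFinset.mpr ⟨l, hl, QuotientAddGroup.eq.mpr ?_⟩
        rw [← hal, add_comm a, neg_add_cancel_left]
        exact hA.le_perp inf_le_left ha
      rw [Finset.sum_eq_single_of_mem _ hmem fun q hq hne =>
        (hg q hq h).2 fun hP => hne ((hiff q).mp hP)]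
      exact ((hg _ hmem h).1 ((hiff _).mpr rfl)).symm
  rw [hsum]
  exact N.sum_mem fun q hq => hgN q hq

/-- Schur's lemma: the endomorphisms of `V_A` that commute with the Heisenberg group are the
scalars. -/
theorem exists_smul_of_commute (hd : IsDualityPairing p form ψ) (hA : IsPolarization φ ψ χ)
    (T : indModule form A χ →ₗ[B] indModule form A χ)
    (hT : ∀ x f, T (indModule.translate hd hA x f) = indModule.translate hd hA x (T f)) :
    ∃ c : B, ∀ f, T f = c • f := by
  obtain ⟨e, he⟩ := hA.exists_apply_one_eq_one hd
  refine ⟨(T e : Heis form → B) 1, ?_⟩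
  -- `d = f - f(1) e` vanishes near the identity, so its cut there is 0; as `T` respects cuts, `(T
  -- d)(1) = 0`. Other points are reached by translation.
  have key : ∀ f, (T f : Heis form → B) 1 = (T e : Heis form → B) 1 * (f : Heis form → B) 1 := by
    intro f
    let d := f - (f : Heis form → B) 1 • e
    obtain ⟨M, hM, hM', hM1⟩ := hA.exists_vanishing hd d (by
      change (f : Heis form → B) 1 - (f : Heis form → B) 1 * (e : Heis form → B) 1 = 0
      rw [he, mul_one, sub_self])
    have hcut : IsCut ψ A M 0 (d : Heis form → B) (0 : indModule form A χ) := fun h =>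
      ⟨fun hP => (hM1 h (by rwa [sub_zero] at hP)).symm, fun _ => rfl⟩
    have h1 := (hA.isCut_map hd hM' 0 hT hcut 1).1 (by simp)
    have h2 : T d = T f - (f : Heis form → B) 1 • T e := by rw [map_sub, map_smul]
    rw [map_zero, h2] at h1
    change (0 : B) = (T f : Heis form → B) 1 - (f : Heis form → B) 1 * (T e : Heis form → B) 1 at h1
    rw [mul_comm]
    exact sub_eq_zero.mp h1.symm
  intro f
  refine Subtype.ext (funext fun h => ?_)
  have h1 := key (indModule.translate hd hA h f)
  rw [hT, indModule.translate_apply, indModule.translate_apply, one_mul] at h1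
  exact h1

end IsPolarization

end Schur

/-! ## Sums of closed subgroups -/

section ClosedSum

variable {F W : Type*} [Field F] [AddCommGroup W] [Module F W] [TopologicalSpace F]
  [TopologicalSpace W] [ContinuousSMul F W]

theorem eventually_pow_smul_mem {ϖ : F} (hϖ : Tendsto (fun n : ℕ => ϖ ^ n) atTop (𝓝 0))
    {K U : Set W} (hK : IsCompact K) (hU : U ∈ 𝓝 (0 : W)) :
    ∀ᶠ n : ℕ in atTop, ∀ x ∈ K, ϖ ^ n • x ∈ U := by
  obtain ⟨O, hOU, hO, hO0⟩ := mem_nhds_iff.mp hU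
  obtain ⟨u, v, hu, -, h0, hKv, huv⟩ := generalized_tube_lemma isCompact_singleton hK
    (hO.preimage (continuous_smul (M := F) (X := W))) (s := {(0 : F)}) (by
      rintro ⟨x, y⟩ ⟨hx, -⟩
      rw [Set.mem_singleton_iff] at hx
      simp only at hx
      subst hx
      simpa using hO0)
  filter_upwards [hϖ.eventually (hu.mem_nhds (h0 rfl))] with n hn x hx
  exact hOU (huv (Set.mk_mem_prod hn (hKv hx)))

variable [IsTopologicalAddGroup W]

/-- A pair with sum in `K` can be replaced by one of bounded size with the same sum. Otherwise
choose `y n` requiring the least exponent `m n > n`, and let `u` be a cluster point of `ϖ ^ m n • y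
n` in `L`. Then `ϖ⁻ʲ u ∈ X` for all `j` because `X` is closed and stable, and `u.1 + u.2 = 0`
because `ϖ ^ m n • K` shrinks to 0. Subtracting `ϖ ^ (-m n) • u` from `y n` keeps the sum and, when
`ϖ ^ m n • y n` is close to `u`, lowers the exponent by one. -/
theorem exists_pow_smul_mem_of_add_mem [T2Space W] {ϖ : F} (hϖ0 : ϖ ≠ 0)
    (hϖ : Tendsto (fun n : ℕ => ϖ ^ n) atTop (𝓝 0)) {X : AddSubgroup (W × W)}
    (hX : IsClosed (X : Set (W × W))) (hϖX : ∀ x ∈ X, ϖ • x ∈ X) {L : AddSubgroup (W × W)}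
    (hL : IsOpen (L : Set (W × W))) (hL' : IsCompact (L : Set (W × W))) {K : Set W}
    (hK : IsCompact K) :
    ∃ n : ℕ, ∀ x ∈ X, x.1 + x.2 ∈ K →
      ∃ x' ∈ X, x'.1 + x'.2 = x.1 + x.2 ∧ ∃ m ≤ n, ϖ ^ m • x' ∈ L := by
  classical
  by_contra hcon
  push Not at hcon
  choose x hxX hxK hx using hcon
  have hpowX : ∀ (k : ℕ) (y), y ∈ X → ϖ ^ k • y ∈ X := by
    intro k
    induction k with
    | zero => intro y hy; simpa using hy
    | succ k ih => intro y hy; rw [pow_succ, mul_smul]; exact ih _ (hϖX y hy)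
  have hex : ∀ n, ∃ m : ℕ, ∃ x' ∈ X, x'.1 + x'.2 = (x n).1 + (x n).2 ∧ ϖ ^ m • x' ∈ L := by
    intro n
    obtain ⟨m, hm⟩ := (eventually_pow_smul_mem hϖ (isCompact_singleton (x := x n))
      (hL.mem_nhds L.zero_mem)).exists
    exact ⟨m, x n, hxX n, rfl, hm _ rfl⟩
  let m : ℕ → ℕ := fun n => Nat.find (hex n)
  choose y hyX hysum hyL using fun n => Nat.find_spec (hex n)
  have hmin : ∀ n k, k < m n → ∀ x' ∈ X, x'.1 + x'.2 = (x n).1 + (x n).2 → ϖ ^ k • x' ∉ L :=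
    fun n k hk x' hx' hs hmem => Nat.find_min (hex n) hk ⟨x', hx', hs, hmem⟩
  have hmn : ∀ n, n < m n := fun n => by
    by_contra hle
    exact hx n (y n) (hyX n) (hysum n) (m n) (not_lt.mp hle) (hyL n)
  obtain ⟨u, -, hu⟩ := hL'.exists_mapClusterPt (f := atTop) (u := fun n => ϖ ^ m n • y n)
    (Filter.tendsto_principal.mpr (Eventually.of_forall hyL))
  have hfreq : ∀ V ∈ 𝓝 u, ∃ᶠ n in atTop, ϖ ^ m n • y n ∈ V := mapClusterPt_iff_frequently.mp hu
  have huX : ∀ j : ℕ, (ϖ ^ j)⁻¹ • u ∈ X := by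
    intro j
    by_contra hne
    have hV : (fun z : W × W => (ϖ ^ j)⁻¹ • z) ⁻¹' (X : Set (W × W))ᶜ ∈ 𝓝 u :=
      (hX.isOpen_compl.preimage (continuous_const_smul _)).mem_nhds hne
    obtain ⟨n, hn, hjn⟩ := ((hfreq _ hV).and_eventually (eventually_ge_atTop j)).exists
    apply hn
    obtain ⟨k, hk⟩ := Nat.exists_eq_add_of_le (hjn.trans (hmn n).le)
    change (ϖ ^ j)⁻¹ • ϖ ^ m n • y n ∈ X
    rw [hk, pow_add, mul_smul, inv_smul_smul₀ (pow_ne_zero _ hϖ0)]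
    exact hpowX _ _ (hyX n)
  have husum : u.1 + u.2 = 0 := by
    by_contra hne
    obtain ⟨U₁, U₀, hU₁, hU₀, hu1, h00, hdisj⟩ := t2_separation hne
    have hV : (fun z : W × W => z.1 + z.2) ⁻¹' U₁ ∈ 𝓝 u :=
      (hU₁.preimage continuous_add).mem_nhds hu1
    obtain ⟨N, hN⟩ := (eventually_pow_smul_mem hϖ hK (hU₀.mem_nhds h00)).exists_forall_of_atTop
    obtain ⟨n, hn, hNn⟩ := ((hfreq _ hV).and_eventually (eventually_ge_atTop N)).exists
    have h1 : ϖ ^ m n • ((y n).1 + (y n).2) ∈ U₀ := by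
      rw [hysum]
      exact hN _ (hNn.trans (hmn n).le) _ (hxK n)
    have h2 : ϖ ^ m n • ((y n).1 + (y n).2) ∈ U₁ := by
      rw [smul_add]
      exact hn
    exact Set.disjoint_left.mp hdisj h2 h1
  have hV : (fun z : W × W => ϖ⁻¹ • (z - u)) ⁻¹' (L : Set (W × W)) ∈ 𝓝 u :=
    (hL.preimage ((continuous_const_smul _).comp (continuous_id.sub continuous_const))).mem_nhds
      (by simp)
  obtain ⟨n, hn⟩ := (hfreq _ hV).exists
  obtain ⟨k, hk⟩ : ∃ k, m n = k + 1 := Nat.exists_eq_succ_of_ne_zero (Nat.ne_zero_of_lt (hmn n))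
  refine hmin n k (hk ▸ Nat.lt_succ_self k) (y n - (ϖ ^ m n)⁻¹ • u)
    (X.sub_mem (hyX n) (huX _)) ?_ ?_
  · rw [← hysum]
    have h1 : (ϖ ^ m n)⁻¹ • u.1 + (ϖ ^ m n)⁻¹ • u.2 = 0 := by rw [← smul_add, husum, smul_zero]
    change (y n).1 - (ϖ ^ m n)⁻¹ • u.1 + ((y n).2 - (ϖ ^ m n)⁻¹ • u.2) = _
    rw [sub_add_sub_comm, h1, sub_zero]
  · have h1 : ϖ ^ k • (y n - (ϖ ^ m n)⁻¹ • u) = ϖ⁻¹ • (ϖ ^ m n • y n - u) := by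
      rw [smul_sub, smul_sub, smul_smul, smul_smul, hk, pow_succ]
      congr 2 <;> field_simp
    rw [h1]
    exact hn

/-- Sums lying in the compact neighbourhood `x + L` of a limit point `x` already come from a compact
subset of `A₁ × A₂`, whose image `C` is closed and so contains `x`. -/
theorem isClosed_sup_of_smul_mem [T2Space W] {ϖ : F} (hϖ0 : ϖ ≠ 0)
    (hϖ : Tendsto (fun n : ℕ => ϖ ^ n) atTop (𝓝 0)) {A₁ A₂ : AddSubgroup W}
    (h₁ : IsClosed (A₁ : Set W)) (h₂ : IsClosed (A₂ : Set W)) (hϖ₁ : ∀ x ∈ A₁, ϖ • x ∈ A₁)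
    (hϖ₂ : ∀ x ∈ A₂, ϖ • x ∈ A₂) {L : AddSubgroup W}
    (hL : IsOpen (L : Set W)) (hL' : IsCompact (L : Set W)) :
    IsClosed ((A₁ ⊔ A₂ : AddSubgroup W) : Set W) := by
  have hXc : IsClosed ((A₁.prod A₂ : AddSubgroup (W × W)) : Set (W × W)) := h₁.prod h₂
  have hLo : IsOpen ((L.prod L : AddSubgroup (W × W)) : Set (W × W)) := hL.prod hL
  have hLc : IsCompact ((L.prod L : AddSubgroup (W × W)) : Set (W × W)) := hL'.prod hL'
  refine isClosed_of_closure_subset fun x hx => ?_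
  have hKn : (fun y => y - x) ⁻¹' (L : Set W) ∈ 𝓝 x :=
    (hL.preimage (continuous_id.sub continuous_const)).mem_nhds (by simp)
  have hK : IsCompact ((fun y => y - x) ⁻¹' (L : Set W)) := by
    have := hL'.image (continuous_id.add (continuous_const (y := x)))
    convert this using 1
    ext y
    exact ⟨fun h => ⟨y - x, h, by simp⟩, by rintro ⟨z, hz, rfl⟩; simpa using hz⟩
  obtain ⟨n, hn⟩ := exists_pow_smul_mem_of_add_mem hϖ0 hϖ hXc
    (fun z hz => ⟨hϖ₁ _ hz.1, hϖ₂ _ hz.2⟩) hLo hLc hK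
  let C : Set W := (fun z : W × W => z.1 + z.2) '' ⋃ k ∈ Finset.range (n + 1),
    ((A₁.prod A₂ : AddSubgroup (W × W)) : Set (W × W)) ∩
      (fun z => (ϖ ^ k)⁻¹ • z) '' ((L.prod L : AddSubgroup (W × W)) : Set (W × W))
  have hC : IsCompact C := by
    refine IsCompact.image ?_ continuous_add
    exact (Finset.range (n + 1)).isCompact_biUnion fun k _ =>
      (hLc.image (continuous_const_smul _)).inter_left hXc
  have hCsub : C ⊆ ((A₁ ⊔ A₂ : AddSubgroup W) : Set W) := by
    rintro _ ⟨z, hz, rfl⟩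
    obtain ⟨k, -, hz, -⟩ := Set.mem_iUnion₂.mp hz
    exact AddSubgroup.add_mem_sup hz.1 hz.2
  apply hCsub
  rw [← hC.isClosed.closure_eq]
  rw [mem_closure_iff_nhds] at hx ⊢
  intro V hV
  obtain ⟨s, ⟨hsV, hsK⟩, hs⟩ := hx _ (Filter.inter_mem hV hKn)
  refine ⟨s, hsV, ?_⟩
  obtain ⟨a, ha, b, hb, hab⟩ := AddSubgroup.mem_sup.mp hs
  obtain ⟨z, hz, hzs, k, hk, hzL⟩ := hn (a, b) ⟨ha, hb⟩ (by simpa [hab] using hsK)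
  refine ⟨z, Set.mem_iUnion₂.mpr ⟨k, Finset.mem_range_succ_iff.mpr hk, hz, _, hzL, ?_⟩, ?_⟩
  · exact inv_smul_smul₀ (pow_ne_zero _ hϖ0) z
  · change z.1 + z.2 = s
    rw [hzs, hab]

end ClosedSum

/-! ### Openness of the sum map and its consequences -/

section OpenSum

variable {W : Type*} [AddCommGroup W] [TopologicalSpace W] [IsTopologicalAddGroup W] [T2Space W]
  {A₁ A₂ : AddSubgroup W}

/-- The sum map `A₁ × A₂ → A₁ + A₂`. -/
def AddSubgroup.sumMap (A₁ A₂ : AddSubgroup W) : A₁ × A₂ →+ (A₁ ⊔ A₂ : AddSubgroup W) :=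
  (AddSubgroup.inclusion le_sup_left).coprod (AddSubgroup.inclusion le_sup_right)

/-- Open mapping theorem for a surjection from a `σ`-compact group onto a locally compact one;
closedness of the sum is what makes the target locally compact. -/
theorem AddSubgroup.isOpenMap_sumMap {p : ℕ} (hW : IsUnionOfProP p W)
    (h₁ : IsClosed (A₁ : Set W)) (h₂ : IsClosed (A₂ : Set W))
    (h₁₂ : IsClosed ((A₁ ⊔ A₂ : AddSubgroup W) : Set W)) :
    IsOpenMap (AddSubgroup.sumMap A₁ A₂) := by
  have := hW.sigma
  obtain ⟨L, hL, hL', -⟩ := hW.small _ Filter.univ_mem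
  have : LocallyCompactSpace W :=
    hL'.locallyCompactSpace_of_mem_nhds_of_addGroup (hL.mem_nhds L.zero_mem)
  have : LocallyCompactSpace (A₁ ⊔ A₂ : AddSubgroup W) :=
    h₁₂.isClosedEmbedding_subtypeVal.locallyCompactSpace
  have : SigmaCompactSpace A₁ := h₁.isClosedEmbedding_subtypeVal.sigmaCompactSpace
  have : SigmaCompactSpace A₂ := h₂.isClosedEmbedding_subtypeVal.sigmaCompactSpace
  refine AddMonoidHom.isOpenMap_of_sigmaCompact (AddSubgroup.sumMap A₁ A₂) ?_ ?_
  · rintro ⟨x, hx⟩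
    obtain ⟨a, ha, b, hb, rfl⟩ := AddSubgroup.mem_sup.mp hx
    exact ⟨(⟨a, ha⟩, ⟨b, hb⟩), rfl⟩
  · exact Continuous.subtype_mk ((continuous_subtype_val.comp continuous_fst).add
      (continuous_subtype_val.comp continuous_snd)) _

/-- An element of `A₂` close to `A₁` is close to 0 modulo `A₁ ∩ A₂`. With the compact version below,
this compares `A₂/(A₁ ∩ A₂)` with its image in `W/A₁`. -/
theorem exists_nhds_add_mem {p : ℕ} (hW : IsUnionOfProP p W)
    (h₁ : IsClosed (A₁ : Set W)) (h₂ : IsClosed (A₂ : Set W))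
    (h₁₂ : IsClosed ((A₁ ⊔ A₂ : AddSubgroup W) : Set W)) {V : Set W} (hV : V ∈ 𝓝 (0 : W)) :
    ∃ U ∈ 𝓝 (0 : W), ∀ a ∈ A₂, ∀ b ∈ A₁, a + b ∈ U → ∃ l ∈ A₂, l ∈ V ∧ a - l ∈ A₁ := by
  obtain ⟨O, hOV, hO, hO0⟩ := mem_nhds_iff.mp hV
  have h1 := AddSubgroup.isOpenMap_sumMap hW h₁ h₂ h₁₂ _
    (hO.preimage (continuous_subtype_val.comp continuous_snd : Continuous fun x : A₁ × A₂ => (x.2 : W)))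
  obtain ⟨U, hU, hUsub⟩ := mem_nhds_subtype _ _ _ |>.mp (h1.mem_nhds (x := 0) ⟨0, hO0, map_zero _⟩)
  refine ⟨U, hU, fun a ha b hb hab => ?_⟩
  obtain ⟨⟨x, y⟩, hy, hxy⟩ := hUsub (show (⟨a + b, add_mem (AddSubgroup.mem_sup_right ha)
    (AddSubgroup.mem_sup_left hb)⟩ : (A₁ ⊔ A₂ : AddSubgroup W)) ∈ _ from hab)
  have hxy' : (x : W) + y = a + b := congrArg Subtype.val hxy
  refine ⟨y, y.2, hOV hy, ?_⟩
  rw [show a - (y : W) = x - b by rw [sub_eq_sub_iff_add_eq_add, ← hxy']]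
  exact A₁.sub_mem x.2 hb

theorem exists_isCompact_add_mem {p : ℕ} (hW : IsUnionOfProP p W)
    (h₁ : IsClosed (A₁ : Set W)) (h₂ : IsClosed (A₂ : Set W))
    (h₁₂ : IsClosed ((A₁ ⊔ A₂ : AddSubgroup W) : Set W)) {Ω : Set W} (hΩ : IsCompact Ω) :
    ∃ L : Set W, IsCompact L ∧
      ∀ a ∈ A₂, ∀ b ∈ A₁, a + b ∈ Ω → ∃ l ∈ A₂, l ∈ L ∧ a - l ∈ A₁ := by
  let ι := {L : AddSubgroup W // IsOpen (L : Set W) ∧ IsCompact (L : Set W)}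
  obtain ⟨L₀, hL₀, hL₀', -⟩ := hW.small _ Filter.univ_mem
  have : Nonempty ι := ⟨⟨L₀, hL₀, hL₀'⟩⟩
  have hc : Continuous fun x : A₁ × A₂ => (x.2 : W) := continuous_subtype_val.comp continuous_snd
  obtain ⟨L, hL⟩ := (h₁₂.isClosedEmbedding_subtypeVal.isCompact_preimage hΩ).elim_directed_cover
    (fun L : ι => AddSubgroup.sumMap A₁ A₂ '' ((fun x => (x.2 : W)) ⁻¹' (L.1 : Set W)))
    (fun L => AddSubgroup.isOpenMap_sumMap hW h₁ h₂ h₁₂ _ (L.2.1.preimage hc)) (by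
      rintro ⟨x, hx⟩ -
      obtain ⟨a, ha, b, hb, rfl⟩ := AddSubgroup.mem_sup.mp hx
      obtain ⟨L, hL, hL', hbL⟩ := hW.large {b} isCompact_singleton
      exact Set.mem_iUnion.mpr ⟨⟨L, hL, hL'⟩, (⟨a, ha⟩, ⟨b, hb⟩), hbL rfl, rfl⟩) (by
      intro L L'
      obtain ⟨M, hM, hM', hLM⟩ := hW.large _ (L.2.2.union L'.2.2)
      exact ⟨⟨M, hM, hM'⟩, Set.image_mono fun x hx => hLM (Or.inl hx),
        Set.image_mono fun x hx => hLM (Or.inr hx)⟩)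
  refine ⟨L.1, L.2.2, fun a ha b hb hab => ?_⟩
  obtain ⟨⟨x, y⟩, hy, hxy⟩ := hL (show (⟨a + b, add_mem (AddSubgroup.mem_sup_right ha)
    (AddSubgroup.mem_sup_left hb)⟩ : (A₁ ⊔ A₂ : AddSubgroup W)) ∈ _ from hab)
  have hxy' : (x : W) + y = a + b := congrArg Subtype.val hxy
  refine ⟨y, y.2, hy, ?_⟩
  rw [show a - (y : W) = x - b by rw [sub_eq_sub_iff_add_eq_add, ← hxy']]
  exact A₁.sub_mem x.2 hb

end OpenSum

/-! ## Haar measures on locally pro-`p` groups -/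

section Haar

variable {G B : Type*} [AddCommGroup G]

theorem QuotientAddGroup.out_sub_mem (U : AddSubgroup G) (x : G) :
    (QuotientAddGroup.mk x : G ⧸ U).out - x ∈ U := by
  have := QuotientAddGroup.eq.mp (QuotientAddGroup.out_eq' (QuotientAddGroup.mk x : G ⧸ U)).symm
  rwa [neg_add_eq_sub] at this

/-- `f` is constant on the cosets of `U`. -/
def IsInvariantUnder (U : AddSubgroup G) (f : G → B) : Prop := ∀ u ∈ U, ∀ x, f (x + u) = f x

theorem IsInvariantUnder.mono {U U' : AddSubgroup G} {f : G → B} (h : IsInvariantUnder U f)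
    (hU : U' ≤ U) : IsInvariantUnder U' f := fun u hu => h u (hU hu)

theorem IsInvariantUnder.apply_out {U : AddSubgroup G} {f : G → B} (h : IsInvariantUnder U f)
    (x : G) : f (QuotientAddGroup.mk x : G ⧸ U).out = f x := by
  have := h _ (QuotientAddGroup.out_sub_mem U x) x
  rwa [add_sub_cancel] at this

variable [CommRing B] [TopologicalSpace G] [IsTopologicalAddGroup G]

theorem CcSmooth.exists_isInvariantUnder
    (hsmall : ∀ U ∈ 𝓝 (0 : G), ∃ L : AddSubgroup G,
      IsOpen (L : Set G) ∧ IsCompact (L : Set G) ∧ (L : Set G) ⊆ U) (f : CcSmooth G B) :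
    ∃ U : AddSubgroup G, IsOpen (U : Set G) ∧ IsInvariantUnder U (f : G → B) := by
  let ι := {U : AddSubgroup G // IsOpen (U : Set G)}
  let S : ι → Set G := fun U => {x | ∀ u ∈ U.1, (f : G → B) (x + u) = (f : G → B) x}
  have hS : ∀ U, IsOpen (S U) := by
    intro U
    rw [isOpen_iff_mem_nhds]
    intro x hx
    have e1 : ∀ᶠ y in 𝓝 x, y - x ∈ U.1 :=
      (U.2.preimage (continuous_id.sub continuous_const)).mem_nhds (by simp)
    filter_upwards [e1] with y hy u hu
    have h1 := hx _ (U.1.add_mem hy hu)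
    have h2 := hx _ hy
    rw [show x + (y - x + u) = y + u by abel] at h1
    rw [add_sub_cancel] at h2
    rw [h1, h2]
  have : Nonempty ι := ⟨⟨⊤, isOpen_univ⟩⟩
  obtain ⟨U, hU⟩ := IsCompact.elim_directed_cover f.2.2 S hS (by
      rintro x -
      have hc : Continuous fun u : G => x + u := continuous_const.add continuous_id
      obtain ⟨L, hL, -, hLU⟩ := hsmall _ (((f.2.1.isOpen_fiber ((f : G → B) x)).preimage
        hc).mem_nhds (by simp))
      exact Set.mem_iUnion.mpr ⟨⟨L, hL⟩, fun u hu => hLU hu⟩) (by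
      intro U V
      exact ⟨⟨U.1 ⊓ V.1, U.2.inter V.2⟩, fun x hx u hu => hx u hu.1, fun x hx u hu => hx u hu.2⟩)
  have hne : ∀ x, (f : G → B) x ≠ 0 → x ∈ S U := fun x hx => hU (subset_tsupport _ hx)
  refine ⟨U.1, U.2, fun u hu x => ?_⟩
  by_cases hx : (f : G → B) x = 0
  · by_contra h
    rw [hx] at h
    have := hne _ h (-u) (U.1.neg_mem hu)
    rw [add_neg_cancel_right, hx] at this
    exact h this.symm
  · exact hne x hx u hu

theorem CcSmooth.finite_support_out (f : CcSmooth G B) {U : AddSubgroup G}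
    (hU : IsOpen (U : Set G)) :
    (Function.support fun q : G ⧸ U => (f : G → B) q.out).Finite := by
  have : DiscreteTopology (G ⧸ U) := QuotientAddGroup.discreteTopology hU
  have hfin : ((QuotientAddGroup.mk : G → G ⧸ U) '' tsupport (f : G → B)).Finite :=
    (IsCompact.image f.2.2 QuotientAddGroup.continuous_mk).finite_of_discrete
  exact hfin.subset fun q hq => ⟨q.out, subset_tsupport _ hq, QuotientAddGroup.out_eq' q⟩

/-- Each coset of `U` splits into `[U : U']` cosets of `U'`, on all of which `f` has the same value.
-/
theorem CcSmooth.finsum_out_eq (f : CcSmooth G B) {U U' K : AddSubgroup G}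
    (hU' : IsOpen (U' : Set G)) (hU : IsOpen (U : Set G))
    (hK : IsCompact (K : Set G)) (hUU : U' ≤ U) (hUK : U ≤ K)
    (hf : IsInvariantUnder U (f : G → B)) :
    ∑ᶠ q : G ⧸ U', (f : G → B) q.out
      = (U'.relIndex U : B) * ∑ᶠ q : G ⧸ U, (f : G → B) q.out := by
  have hfin : Finite (U ⧸ U'.addSubgroupOf U) :=
    finite_quotient_of_subset_isCompact hK hUK hU'
  have := Fintype.ofFinite (U ⧸ U'.addSubgroupOf U)
  let e := AddSubgroup.quotientEquivProdOfLE hUU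
  have h1 : ∀ q : G ⧸ U', (f : G → B) q.out = (f : G → B) (e q).1.out := by
    intro q
    obtain ⟨x, rfl⟩ := QuotientAddGroup.mk_surjective q
    have h2 : (e (QuotientAddGroup.mk x)).1 = QuotientAddGroup.mk x := rfl
    rw [h2, hf.apply_out, (hf.mono hUU).apply_out]
  rw [finsum_congr h1, finsum_comp_equiv e (f := fun x => (f : G → B) x.1.out), finsum_curry]
  · have h3 : ∀ q : G ⧸ U, ∑ᶠ _ : U ⧸ U'.addSubgroupOf U, (f : G → B) q.out
        = (U'.relIndex U : B) * (f : G → B) q.out := by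
      intro q
      rw [finsum_eq_sum_of_fintype, Finset.sum_const, nsmul_eq_mul, Finset.card_univ,
        ← Nat.card_eq_fintype_card]
      rfl
    rw [finsum_congr h3, mul_finsum' _ _ (CcSmooth.finite_support_out f hU)]
  · refine ((CcSmooth.finite_support_out f hU).prod Set.finite_univ).subset ?_
    rintro ⟨q, r⟩ hq
    exact ⟨hq, trivial⟩

theorem isUnit_relIndex {p : ℕ} (hp : p.Prime) (hpB : IsUnit (p : B))
    (htors : ∀ (x : G) (U : AddSubgroup G), IsOpen (U : Set G) → ∃ k : ℕ, p ^ k • x ∈ U)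
    {U K : AddSubgroup G} (hU : IsOpen (U : Set G)) (hK : IsCompact (K : Set G)) :
    IsUnit (U.relIndex K : B) := by
  have hfin : Finite (K ⧸ U.addSubgroupOf K) :=
    finite_quotient_of_subset_isCompact hK subset_rfl hU
  obtain ⟨k, hk⟩ := exists_card_quotient_eq_pow hp htors (N := K) hU
  have : U.relIndex K = p ^ k := hk
  rw [this, Nat.cast_pow]
  exact hpB.pow k

theorem exists_isInvertibleHaar {p : ℕ} (hp : p.Prime) (hpB : IsUnit (p : B))
    (hsmall : ∀ U ∈ 𝓝 (0 : G), ∃ L : AddSubgroup G,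
      IsOpen (L : Set G) ∧ IsCompact (L : Set G) ∧ (L : Set G) ⊆ U)
    (htors : ∀ (x : G) (U : AddSubgroup G), IsOpen (U : Set G) → ∃ k : ℕ, p ^ k • x ∈ U) :
    ∃ μ : CcSmooth G B →ₗ[B] B, IsInvertibleHaar μ := by
  classical
  obtain ⟨K, hK, hK', -⟩ := hsmall _ Filter.univ_mem
  have hunit : ∀ {U : AddSubgroup G}, IsOpen (U : Set G) → IsUnit (U.relIndex K : B) :=
    fun hU => isUnit_relIndex hp hpB htors hU hK'
  have hchoose : ∀ f : CcSmooth G B, ∃ U : AddSubgroup G, IsOpen (U : Set G) ∧ U ≤ K ∧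
      IsInvariantUnder U (f : G → B) := by
    intro f
    obtain ⟨U, hU, hf⟩ := CcSmooth.exists_isInvariantUnder hsmall f
    exact ⟨U ⊓ K, hU.inter hK, inf_le_right, hf.mono inf_le_left⟩
  -- The integral is `[K : U]⁻¹ ∑ f` over `G ⧸ U`, for any `U ≤ K` under which `f` is invariant; two
  -- choices are compared on their intersection. `K` itself has measure 1.
  have hval : ∀ f : CcSmooth G B, ∃ b : B, ∀ U : AddSubgroup G, IsOpen (U : Set G) → U ≤ K →
      IsInvariantUnder U (f : G → B) →
      (U.relIndex K : B) * b = ∑ᶠ q : G ⧸ U, (f : G → B) q.out := by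
    intro f
    obtain ⟨U, hU, hUK, hf⟩ := hchoose f
    obtain ⟨u, hu⟩ := hunit hU
    refine ⟨((u⁻¹ : Bˣ) : B) * ∑ᶠ q : G ⧸ U, (f : G → B) q.out, fun V hV hVK hfV => ?_⟩
    have hX : IsOpen ((U ⊓ V : AddSubgroup G) : Set G) := hU.inter hV
    have h1 := CcSmooth.finsum_out_eq f hX hU hK' inf_le_left hUK hf
    have h2 := CcSmooth.finsum_out_eq f hX hV hK' inf_le_right hVK hfV
    have i1 : (((U ⊓ V).relIndex U : ℕ) : B) * (U.relIndex K : B) = ((U ⊓ V).relIndex K : B) := by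
      rw [← Nat.cast_mul, AddSubgroup.relIndex_mul_relIndex _ _ _ inf_le_left hUK]
    have i2 : (((U ⊓ V).relIndex V : ℕ) : B) * (V.relIndex K : B) = ((U ⊓ V).relIndex K : B) := by
      rw [← Nat.cast_mul, AddSubgroup.relIndex_mul_relIndex _ _ _ inf_le_right hVK]
    have huV : IsUnit ((U ⊓ V).relIndex V : B) := by
      have := hunit hX
      rw [← i2] at this
      exact isUnit_of_mul_isUnit_left this
    apply huV.mul_left_cancel
    rw [← h2, h1, ← mul_assoc, i2, ← i1, ← hu]
    rw [mul_assoc, Units.mul_inv_cancel_left]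
  choose m hm using hval
  have huniq : ∀ (f : CcSmooth G B) (b : B) (U : AddSubgroup G), IsOpen (U : Set G) → U ≤ K →
      IsInvariantUnder U (f : G → B) →
      (U.relIndex K : B) * b = ∑ᶠ q : G ⧸ U, (f : G → B) q.out → m f = b :=
    fun f b U hU hUK hf h => (hunit hU).mul_left_cancel ((hm f U hU hUK hf).trans h.symm)
  let μ : CcSmooth G B →ₗ[B] B :=
    { toFun := m
      map_add' := fun f g => by
        obtain ⟨U, hU, hUK, hf⟩ := hchoose f
        obtain ⟨V, hV, -, hg⟩ := hchoose g
        have hf' : IsInvariantUnder (U ⊓ V) (f : G → B) := hf.mono inf_le_left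
        have hg' : IsInvariantUnder (U ⊓ V) (g : G → B) := hg.mono inf_le_right
        have hX : IsOpen ((U ⊓ V : AddSubgroup G) : Set G) := hU.inter hV
        have hXK : U ⊓ V ≤ K := inf_le_left.trans hUK
        refine huniq _ _ (U ⊓ V) hX hXK (fun u hu x => ?_) ?_
        · exact congrArg₂ (· + ·) (hf' u hu x) (hg' u hu x)
        · rw [mul_add, hm f _ hX hXK hf', hm g _ hX hXK hg',
            ← finsum_add_distrib (CcSmooth.finite_support_out f hX) (CcSmooth.finite_support_out g hX)]
          rfl
      map_smul' := fun c f => by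
        obtain ⟨U, hU, hUK, hf⟩ := hchoose f
        refine huniq _ _ U hU hUK (fun u hu x => ?_) ?_
        · exact congrArg (c * ·) (hf u hu x)
        · rw [RingHom.id_apply, smul_eq_mul, mul_left_comm, hm f U hU hUK hf,
            mul_finsum' _ _ (CcSmooth.finite_support_out f hU)]
          rfl }
  refine ⟨μ, ?_, ?_⟩
  · intro x f f' hff
    obtain ⟨U, hU, hUK, hf⟩ := hchoose f
    have hf' : IsInvariantUnder U (f' : G → B) := fun u hu y => by
      rw [hff, hff, ← add_assoc, hf u hu]
    refine huniq _ _ U hU hUK hf' ?_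
    refine (hm f U hU hUK hf).trans ?_
    rw [← finsum_comp_equiv (Equiv.addLeft (QuotientAddGroup.mk x : G ⧸ U))]
    refine finsum_congr fun q => ?_
    obtain ⟨y, rfl⟩ := QuotientAddGroup.mk_surjective q
    rw [hf'.apply_out, hff]
    exact hf.apply_out (x + y)
  · rw [Ideal.eq_top_iff_one]
    have hclopen : IsClopen (K : Set G) := ⟨AddSubgroup.isClosed_of_isOpen K hK, hK⟩
    let f : CcSmooth G B := ⟨Set.indicator (K : Set G) 1,
      (LocallyConstant.charFn B hclopen).isLocallyConstant,
      HasCompactSupport.intro' hK' hclopen.1 fun x hx => Set.indicator_of_notMem hx _⟩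
    have hfK : IsInvariantUnder K (f : G → B) := fun u hu x => by
      change Set.indicator (K : Set G) 1 (x + u) = Set.indicator (K : Set G) (1 : G → B) x
      by_cases hx : x ∈ K
      · rw [Set.indicator_of_mem (K.add_mem hx hu), Set.indicator_of_mem hx]
        rfl
      · rw [Set.indicator_of_notMem hx, Set.indicator_of_notMem]
        exact fun h => hx ((AddSubgroup.add_mem_cancel_right K hu).mp h)
    have h1 : m f = 1 := by
      refine huniq f 1 K hK le_rfl hfK ?_
      rw [finsum_eq_single _ (QuotientAddGroup.mk 0 : G ⧸ K), hfK.apply_out]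
      · change _ = Set.indicator (K : Set G) (1 : G → B) 0
        rw [Set.indicator_of_mem K.zero_mem, AddSubgroup.relIndex_self]
        simp
      · intro q hq
        obtain ⟨y, rfl⟩ := QuotientAddGroup.mk_surjective q
        rw [hfK.apply_out]
        refine Set.indicator_of_notMem (fun hy => hq ?_) _
        rw [QuotientAddGroup.mk_zero]
        exact (QuotientAddGroup.eq_zero_iff y).mpr hy
    exact Ideal.subset_span ⟨K, f, hK, hK', rfl, h1.symm⟩

theorem CcSmooth.comp_addLeft_mem (f : CcSmooth G B) (x : G) :
    (fun y => (f : G → B) (x + y)) ∈ CcSmooth G B :=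
  ⟨f.2.1.comp_continuous (continuous_const.add continuous_id),
    HasCompactSupport.comp_homeomorph f.2.2 (Homeomorph.addLeft x)⟩

/-- The measure of a compact open subgroup is a multiple of the measure of any open subgroup of
it. -/
theorem exists_natCast_mul_of_le {μ : CcSmooth G B →ₗ[B] B} (hμ : ∀ (x : G) (f f' : CcSmooth G B),
    (∀ y, (f' : G → B) y = (f : G → B) (x + y)) → μ f' = μ f) {D K : AddSubgroup G}
    (hD : IsOpen (D : Set G)) (hK : IsCompact (K : Set G)) (hDK : D ≤ K) {f g : CcSmooth G B}
    (hf : (f : G → B) = Set.indicator (D : Set G) 1)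
    (hg : (g : G → B) = Set.indicator (K : Set G) 1) : ∃ n : ℕ, μ g = n * μ f := by
  classical
  have hfin : Finite (K ⧸ D.addSubgroupOf K) :=
    finite_quotient_of_subset_isCompact hK subset_rfl hD
  have := Fintype.ofFinite (K ⧸ D.addSubgroupOf K)
  let F : K ⧸ D.addSubgroupOf K → CcSmooth G B := fun q => ⟨_, CcSmooth.comp_addLeft_mem f (-(q.out : G))⟩
  have hsum : g = ∑ q, F q := by
    refine Subtype.ext (funext fun y => ?_)
    rw [AddSubmonoidClass.coe_finsetSum, Finset.sum_apply, hg]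
    have hF : ∀ q, (F q : G → B) y = if -(q.out : G) + y ∈ D then 1 else 0 := fun q => by
      change (f : G → B) _ = _
      rw [hf]
      rfl
    simp only [hF]
    by_cases hy : y ∈ K
    · rw [Set.indicator_of_mem hy, Finset.sum_eq_single_of_mem
        (QuotientAddGroup.mk ⟨y, hy⟩ : K ⧸ D.addSubgroupOf K) (Finset.mem_univ _), if_pos]
      · rfl
      · have := QuotientAddGroup.eq.mp
          (QuotientAddGroup.out_eq' (QuotientAddGroup.mk ⟨y, hy⟩ : K ⧸ D.addSubgroupOf K))
        exact this
      · intro q _ hq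
        refine if_neg fun h => hq ?_
        rw [← QuotientAddGroup.out_eq' q]
        exact QuotientAddGroup.eq.mpr h
    · rw [Set.indicator_of_notMem hy, Finset.sum_eq_zero]
      intro q _
      refine if_neg fun h => hy ?_
      have := K.add_mem q.out.2 (hDK h)
      rwa [add_neg_cancel_left] at this
  refine ⟨Fintype.card (K ⧸ D.addSubgroupOf K), ?_⟩
  rw [hsum, map_sum, Finset.sum_congr rfl fun q _ => hμ (-(q.out : G)) f (F q) fun y => rfl,
    Finset.sum_const, nsmul_eq_mul, Finset.card_univ]

end Haar

/-! ## Intertwining operators -/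

section Intertwiner

theorem CcSmooth.ext_mk {F W B : Type*} [Field F] [AddCommGroup W] [Module F W]
    [TopologicalSpace W] [CommRing B] {form : LinearMap.BilinForm F W} {A₁ A₂ : AddSubgroup W}
    {f g : CcSmooth (A₂ ⧸ A₁.addSubgroupOf A₂) B}
    (h : ∀ a : Heis.over form A₂, (f : (A₂ ⧸ A₁.addSubgroupOf A₂) → B)
      (QuotientAddGroup.mk ⟨a.1.w, a.2⟩) = (g : (A₂ ⧸ A₁.addSubgroupOf A₂) → B)
      (QuotientAddGroup.mk ⟨a.1.w, a.2⟩)) : f = g := by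
  refine Subtype.ext (funext fun q => ?_)
  obtain ⟨a, rfl⟩ := QuotientAddGroup.mk_surjective q
  exact h (Heis.horizontal form (a : W) a.2)

variable {F W : Type*} [Field F] [AddCommGroup W] [Module F W] [TopologicalSpace F]
  [TopologicalSpace W] {R B : Type*} [CommRing R] [CommRing B]
  {p : ℕ} {form : LinearMap.BilinForm F W} {ψ : AddChar F Rˣ} {φ : R →+* B}
  {A₁ A₂ : AddSubgroup W} {χ₁ : Heis.over form A₁ →* Bˣ} {χ₂ : Heis.over form A₂ →* Bˣ}

/-- The integrand of the intertwining operator, as a function on `A₂`. -/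
noncomputable def intertwinerIntegrand (χ₂ : Heis.over form A₂ →* Bˣ) (ω : W) (f : Heis form → B)
    (h : Heis form) (a : A₂) : B :=
  ((χ₂ (Heis.horizontal form (a : W) a.2))⁻¹ : Bˣ) * f ((⟨ω, 0⟩ : Heis form) * ⟨a, 0⟩ * h)

/-- Both characters restrict to `ψ` on the centre, so the central coordinate of `a` cancels. -/
theorem intertwinerIntegrand_eq (h₁ : IsPolarization φ ψ χ₁) (h₂ : IsPolarization φ ψ χ₂)
    (ω : W) (f : indModule form A₁ χ₁) (h : Heis form) (a : Heis.over form A₂) :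
    ((χ₂ a)⁻¹ : Bˣ) * (f : Heis form → B) ((⟨ω, 0⟩ : Heis form) * a * h)
      = intertwinerIntegrand χ₂ ω f h ⟨a.1.w, a.2⟩ := by
  have h3 : a = Heis.central form A₂ a.1.t * Heis.horizontal form a.1.w a.2 :=
    Subtype.ext (Heis.mk_eq_central_mul _ _)
  have h4 : ∀ x : Heis form, (⟨ω, 0⟩ : Heis form) * x * h
      = ⟨0, x.t⟩ * (⟨ω, 0⟩ * ⟨x.w, 0⟩ * h) := by
    rintro ⟨w, t⟩
    change (⟨ω, 0⟩ : Heis form) * ⟨w, t⟩ * h = ⟨0, t⟩ * (⟨ω, 0⟩ * ⟨w, 0⟩ * h)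
    rw [Heis.mk_eq_central_mul w t, ← mul_assoc, Heis.mul_comm_central]
    simp only [mul_assoc]
  have h5 := (congrArg χ₂ h3).trans (map_mul χ₂ _ _)
  rw [h4, h₁.apply_central_mul f.2.2.1, ← h₂.central, intertwinerIntegrand, h5, mul_inv,
    Units.val_mul]
  have hc : (((χ₂ (Heis.central form A₂ a.1.t))⁻¹ : Bˣ) : B) * χ₂ (Heis.central form A₂ a.1.t) = 1 :=
    Units.inv_mul _
  linear_combination ((((χ₂ (Heis.horizontal form a.1.w a.2))⁻¹ : Bˣ) : B)
    * (f : Heis form → B) (⟨ω, 0⟩ * ⟨a.1.w, 0⟩ * h)) * hc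

/-- Moving `c ∈ A₁ ∩ A₂` to the left past `(ω, 0)` contributes `ψ(⟨ω, c⟩)`, which cancels `χ₁(c)
χ₂(c)⁻¹ = ψ(⟨c, ω⟩)`: this is the role of the compatibility of `ω`. -/
theorem isInvariantUnder_intertwinerIntegrand (hd : IsDualityPairing p form ψ)
    (h₁ : IsPolarization φ ψ χ₁) (h₂ : IsPolarization φ ψ χ₂) {ψB : AddChar F Bˣ}
    (hψB : ∀ t, (ψB t : B) = φ (ψ t : R)) {ω : W} (hω : IsCompatible form ψB χ₁ χ₂ ω)
    (f : indModule form A₁ χ₁) (h : Heis form) :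
    IsInvariantUnder (A₁.addSubgroupOf A₂) (intertwinerIntegrand χ₂ ω f h) := by
  intro c hc a
  have hc₁ : (c : W) ∈ A₁ := hc
  let x := Heis.horizontal form (c : W) c.2 * Heis.horizontal form (a : W) a.2
  have e1 := intertwinerIntegrand_eq h₁ h₂ ω f h x
  have e2 : (⟨x.1.w, x.2⟩ : A₂) = a + c := Subtype.ext (add_comm _ _)
  rw [e2] at e1
  rw [← e1, intertwinerIntegrand, map_mul, mul_inv, Units.val_mul]
  have e3 : (⟨ω, 0⟩ : Heis form) * (Heis.horizontal form (c : W) c.2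
      * Heis.horizontal form (a : W) a.2 : Heis.over form A₂) * h
      = ⟨0, form ω c⟩ * (Heis.horizontal form (c : W) hc₁ * (⟨ω, 0⟩ * ⟨a, 0⟩ * h)) := by
    change (⟨ω, 0⟩ : Heis form) * (⟨c, 0⟩ * ⟨a, 0⟩) * h = ⟨0, form ω c⟩ * (⟨c, 0⟩ * (⟨ω, 0⟩ * ⟨a, 0⟩ * h))
    rw [← mul_assoc, Heis.mul_comm_of_isAlt hd.alt hd.two ⟨ω, 0⟩ ⟨c, 0⟩]
    simp only [mul_assoc]
  rw [e3, h₁.apply_central_mul f.2.2.1, indModule.apply_mul, ← hψB]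
  have e4 := congrArg (Units.val) (hω c hc₁ c.2)
  rw [Units.val_mul] at e4
  have e5 : (ψB (form ω c) : B) * ψB (form c ω) = 1 := by
    rw [← Units.val_mul, ← AddChar.map_add_eq_mul, hd.form_swap ω, neg_add_cancel,
      AddChar.map_zero_eq_one, Units.val_one]
  linear_combination ((((χ₂ (Heis.horizontal form (a : W) a.2))⁻¹ : Bˣ) : B)
    * (f : Heis form → B) (⟨ω, 0⟩ * ⟨a, 0⟩ * h)) * (e5 + (ψB (form ω c) : B) * e4)

theorem IsPolarization.isLocallyConstant_horizontal (h₂ : IsPolarization φ ψ χ₂) :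
    IsLocallyConstant fun a : A₂ => χ₂ (Heis.horizontal form (a : W) a.2) :=
  h₂.smooth.comp_continuous
    ((Heis.continuous_mk continuous_subtype_val continuous_const).subtype_mk _)

theorem isLocallyConstant_intertwinerIntegrand (hd : IsDualityPairing p form ψ)
    (h₂ : IsPolarization φ ψ χ₂) (ω : W)
    (f : indModule form A₁ χ₁) (h : Heis form) :
    IsLocallyConstant (intertwinerIntegrand χ₂ ω (f : Heis form → B) h) := by
  have := hd.topGroup
  have := hd.topRing
  have hc1 : Continuous fun a : A₂ => (a : W) := continuous_subtype_val
  have hc2 : Continuous fun a : A₂ => (⟨ω, 0⟩ : Heis form) * ⟨a, 0⟩ * h := by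
    refine Heis.continuous_mk (f := fun a : A₂ => ω + (a : W) + h.w)
      (g := fun a : A₂ => (0 + 0 + 1 / 2 * form ω a) + h.t + 1 / 2 * form (ω + (a : W)) h.w) ?_ ?_
    · exact (continuous_const.add hc1).add continuous_const
    · exact ((continuous_const.add (continuous_const.mul ((hd.continuous_right ω).comp hc1))).add
        continuous_const).add (continuous_const.mul
          ((hd.continuous_left h.w).comp (continuous_const.add hc1)))
  exact (h₂.isLocallyConstant_horizontal.comp fun u : Bˣ => ((u⁻¹ : Bˣ) : B)).mul
    (f.2.1.comp_continuous hc2)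

theorem exists_ccSmooth_of_isInvariantUnder {F₀ : A₂ → B}
    (hinv : IsInvariantUnder (A₁.addSubgroupOf A₂) F₀) (hloc : IsLocallyConstant F₀)
    (h₂ : IsClosed (A₂ : Set W)) {L : Set W} (hL : IsCompact L)
    (hsupp : ∀ a : A₂, F₀ a ≠ 0 → ∃ l ∈ A₂, l ∈ L ∧ (a : W) - l ∈ A₁) :
    ∃ f : CcSmooth (A₂ ⧸ A₁.addSubgroupOf A₂) B, ∀ a : A₂,
      (f : (A₂ ⧸ A₁.addSubgroupOf A₂) → B) (QuotientAddGroup.mk a) = F₀ a := by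
  let f : A₂ ⧸ A₁.addSubgroupOf A₂ → B := fun q => F₀ q.out
  have hf : ∀ a : A₂, f (QuotientAddGroup.mk a) = F₀ a := fun a => hinv.apply_out a
  have hflc : IsLocallyConstant f := by
    intro s
    refine isOpen_coinduced.mpr ?_
    have : (QuotientAddGroup.mk : A₂ → A₂ ⧸ A₁.addSubgroupOf A₂) ⁻¹' (f ⁻¹' s) = F₀ ⁻¹' s := by
      ext a
      simp only [Set.mem_preimage, hf]
    change IsOpen ((QuotientAddGroup.mk : A₂ → A₂ ⧸ A₁.addSubgroupOf A₂) ⁻¹' (f ⁻¹' s))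
    rw [this]
    exact hloc s
  have hcl : IsClosed (Function.support f) := (hflc.isOpen_fiber 0).isClosed_compl
  have hcpt : IsCompact (Function.support f) := by
    refine IsCompact.of_isClosed_subset ((h₂.isClosedEmbedding_subtypeVal.isCompact_preimage
      hL).image (continuous_quot_mk : Continuous
        (QuotientAddGroup.mk : A₂ → A₂ ⧸ A₁.addSubgroupOf A₂))) hcl ?_
    intro q hq
    obtain ⟨a, rfl⟩ := QuotientAddGroup.mk_surjective q
    rw [Function.mem_support, hf] at hq
    obtain ⟨l, hl, hlL, hal⟩ := hsupp a hq
    refine ⟨⟨l, hl⟩, hlL, QuotientAddGroup.eq.mpr ?_⟩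
    change -l + (a : W) ∈ A₁
    rwa [neg_add_eq_sub]
  exact ⟨⟨f, hflc, HasCompactSupport.intro' hcpt hcl fun x hx => Function.notMem_support.mp hx⟩, hf⟩

variable [IsDomain R] [CharZero R]

theorem exists_ccSmooth_integrand (hd : IsDualityPairing p form ψ)
    (h₁ : IsPolarization φ ψ χ₁) (h₂ : IsPolarization φ ψ χ₂)
    (h₁₂ : IsClosed ((A₁ ⊔ A₂ : AddSubgroup W) : Set W)) {ψB : AddChar F Bˣ}
    (hψB : ∀ t, (ψB t : B) = φ (ψ t : R)) {ω : W} (hω : IsCompatible form ψB χ₁ χ₂ ω)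
    (f : indModule form A₁ χ₁) (h : Heis form) :
    ∃ g : CcSmooth (A₂ ⧸ A₁.addSubgroupOf A₂) B, ∀ a : Heis.over form A₂,
      (g : (A₂ ⧸ A₁.addSubgroupOf A₂) → B) (QuotientAddGroup.mk ⟨a.1.w, a.2⟩)
        = ((χ₂ a)⁻¹ : Bˣ) * (f : Heis form → B) ((⟨ω, 0⟩ : Heis form) * a * h) := by
  have := hd.topGroup
  have := hd.t2
  obtain ⟨L, hL, hfL⟩ := h₁.exists_support_subset' hd f
  -- If the integrand is nonzero at `a`, then `ω + a + h.w ∈ A₁ + L`, so `a` lies modulo `A₁` in the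
  -- compact set `L - (ω + h.w)`.
  obtain ⟨L', hL', hLL'⟩ := exists_isCompact_add_mem hd.toIsUnionOfProP h₁.closed h₂.closed h₁₂
    (hL.image (continuous_id.sub (continuous_const (y := ω + h.w))))
  obtain ⟨g, hg⟩ := exists_ccSmooth_of_isInvariantUnder
    (isInvariantUnder_intertwinerIntegrand hd h₁ h₂ hψB hω f h)
    (isLocallyConstant_intertwinerIntegrand hd h₂ ω f h) h₂.closed hL' (fun a ha => by
      have hne := right_ne_zero_of_mul ha
      obtain ⟨b, hb, l, hl, hbl⟩ := AddSubgroup.mem_sup.mp (hfL _ hne)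
      refine hLL' a a.2 (-b) (A₁.neg_mem hb) ⟨l, hl, ?_⟩
      have h5 : b + l = ω + a + h.w := hbl
      change l - (ω + h.w) = a + -b
      rw [← sub_eq_zero, show l - (ω + h.w) - (a + -b) = (b + l) - (ω + a + h.w) by abel, h5,
        sub_self])
  exact ⟨g, fun a => (hg _).trans (intertwinerIntegrand_eq h₁ h₂ ω f h a).symm⟩

theorem exists_isIntertwiner (hd : IsDualityPairing p form ψ)
    (h₁ : IsPolarization φ ψ χ₁) (h₂ : IsPolarization φ ψ χ₂)
    (h₁₂ : IsClosed ((A₁ ⊔ A₂ : AddSubgroup W) : Set W)) {ψB : AddChar F Bˣ}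
    (hψB : ∀ t, (ψB t : B) = φ (ψ t : R)) {ω : W} (hω : IsCompatible form ψB χ₁ χ₂ ω)
    {μ : CcSmooth (A₂ ⧸ A₁.addSubgroupOf A₂) B →ₗ[B] B} (hμ : IsInvertibleHaar μ) :
    ∃ T : indModule form A₁ χ₁ →ₗ[B] indModule form A₂ χ₂, IsIntertwiner form χ₁ χ₂ μ ω T := by
  have := hd.topGroup
  choose g hg using fun f h => exists_ccSmooth_integrand hd h₁ h₂ h₁₂ hψB hω f h
  have hmem : ∀ f : indModule form A₁ χ₁, (fun h => μ (g f h)) ∈ indModule form A₂ χ₂ := by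
    intro f
    obtain ⟨U, hU, -, hfU⟩ := h₁.exists_invariant_of_mem_indModule hd f.2
    refine h₂.mem_indModule_of_invariant hd (fun b h => ?_) hU fun u hu h => ?_
    · have htr : g f (b * h) = (χ₂ b : B) • (⟨_, CcSmooth.comp_addLeft_mem (g f h)
          (QuotientAddGroup.mk ⟨b.1.w, b.2⟩)⟩ : CcSmooth (A₂ ⧸ A₁.addSubgroupOf A₂) B) := by
        refine CcSmooth.ext_mk (form := form) fun a => ?_
        rw [hg]
        change _ = (χ₂ b : B) * (g f h : (A₂ ⧸ A₁.addSubgroupOf A₂) → B)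
          (QuotientAddGroup.mk ⟨b.1.w, b.2⟩ + QuotientAddGroup.mk ⟨a.1.w, a.2⟩)
        have e1 : (QuotientAddGroup.mk ⟨b.1.w, b.2⟩ + QuotientAddGroup.mk ⟨a.1.w, a.2⟩ :
            A₂ ⧸ A₁.addSubgroupOf A₂) = QuotientAddGroup.mk ⟨(a * b).1.w, (a * b).2⟩ := by
          rw [← QuotientAddGroup.mk_add]
          congr 1
          exact Subtype.ext (add_comm _ _)
        rw [e1, hg, map_mul, mul_inv, Units.val_mul, Subgroup.coe_mul]
        simp only [mul_assoc]
        rw [mul_left_comm (χ₂ b : B), Units.mul_inv_cancel_left]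
      change μ (g f (b * h)) = χ₂ b * μ (g f h)
      rw [htr, map_smul, smul_eq_mul]
      congr 1
      exact hμ.1 (QuotientAddGroup.mk ⟨b.1.w, b.2⟩) (g f h) _ fun y => rfl
    · congr 1
      refine CcSmooth.ext_mk (form := form) fun a => ?_
      rw [hg, hg, ← mul_assoc, hfU u hu]
  refine ⟨{ toFun := fun f => ⟨_, hmem f⟩
            map_add' := fun f f' => Subtype.ext (funext fun h => ?_)
            map_smul' := fun c f => Subtype.ext (funext fun h => ?_) }, fun f h => ⟨g f h, hg f h, rfl⟩⟩
  · change μ (g (f + f') h) = μ (g f h) + μ (g f' h)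
    rw [← map_add]
    congr 1
    refine CcSmooth.ext_mk (form := form) fun a => ?_
    change _ = (g f h : (A₂ ⧸ A₁.addSubgroupOf A₂) → B) _
      + (g f' h : (A₂ ⧸ A₁.addSubgroupOf A₂) → B) _
    rw [hg, hg, hg, ← mul_add]
    rfl
  · change μ (g (c • f) h) = c • μ (g f h)
    rw [← map_smul]
    congr 1
    refine CcSmooth.ext_mk (form := form) fun a => ?_
    change _ = c * (g f h : (A₂ ⧸ A₁.addSubgroupOf A₂) → B) _
    rw [hg, hg, mul_left_comm]
    rfl

theorem IsIntertwiner.map_translate (hd : IsDualityPairing p form ψ)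
    (h₁ : IsPolarization φ ψ χ₁) (h₂ : IsPolarization φ ψ χ₂) {ω : W}
    {μ : CcSmooth (A₂ ⧸ A₁.addSubgroupOf A₂) B →ₗ[B] B}
    {T : indModule form A₁ χ₁ →ₗ[B] indModule form A₂ χ₂}
    (hT : IsIntertwiner form χ₁ χ₂ μ ω T) (x : Heis form) (f : indModule form A₁ χ₁) :
    T (indModule.translate hd h₁ x f) = indModule.translate hd h₂ x (T f) := by
  refine Subtype.ext (funext fun h => ?_)
  obtain ⟨g, hg, hgT⟩ := hT (indModule.translate hd h₁ x f) h
  obtain ⟨g', hg', hgT'⟩ := hT f (h * x)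
  rw [hgT, indModule.translate_apply, hgT']
  congr 1
  refine CcSmooth.ext_mk (form := form) fun a => ?_
  rw [hg, hg', indModule.translate_apply]
  simp only [mul_assoc]

/-- The values `(T f)(1)` form an ideal, so it is enough to reach `μ` of each compact open `K`. A
sufficiently thin cut of `e`, translated by `(-ω, 0)`, has as integrand the indicator of an open
subgroup `D ≤ K`, and the measure of `K` is an integer multiple of that of `D`. -/
theorem IsIntertwiner.exists_apply_one_eq_one (hd : IsDualityPairing p form ψ)
    (h₁ : IsPolarization φ ψ χ₁) (h₂ : IsPolarization φ ψ χ₂)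
    (h₁₂ : IsClosed ((A₁ ⊔ A₂ : AddSubgroup W) : Set W)) {ω : W}
    {μ : CcSmooth (A₂ ⧸ A₁.addSubgroupOf A₂) B →ₗ[B] B} (hμ : IsInvertibleHaar μ)
    {T : indModule form A₁ χ₁ →ₗ[B] indModule form A₂ χ₂}
    (hT : IsIntertwiner form χ₁ χ₂ μ ω T) : ∃ f, (T f : Heis form → B) 1 = 1 := by
  classical
  have := hd.topGroup
  have := hd.t2
  let ev : indModule form A₁ χ₁ →ₗ[B] B :=
    LinearMap.proj (φ := fun _ : Heis form => B) 1 ∘ₗ (indModule form A₂ χ₂).subtype ∘ₗ T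
  have hev : valueIdeal μ ≤ LinearMap.range ev := by
    refine Ideal.span_le.mpr ?_
    rintro b ⟨K, k, hK, hK', hk, rfl⟩
    obtain ⟨e, he⟩ := h₁.exists_apply_one_eq_one hd
    obtain ⟨U₀, hU₀, -, heU₀⟩ := h₁.exists_invariant_of_mem_indModule hd e.2
    obtain ⟨V₁, hV₁, hχV₁⟩ := h₂.exists_apply_horizontal_eq_one
    have hKpre : (QuotientAddGroup.mk : A₂ → A₂ ⧸ A₁.addSubgroupOf A₂) ⁻¹' (K : Set _)
        ∈ 𝓝 (0 : A₂) := (hK.preimage continuous_quot_mk).mem_nhds K.zero_mem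
    obtain ⟨V₂, hV₂, hKV₂⟩ := mem_nhds_subtype _ _ _ |>.mp hKpre
    have hV₃ : (fun l => form ω l) ⁻¹' (ψ ⁻¹' {1}) ∈ 𝓝 (0 : W) :=
      ((hd.locConst.isOpen_fiber 1).preimage (hd.continuous_right ω)).mem_nhds (by simp)
    -- `U` is chosen so that an element of `A₂ ∩ P` is congruent modulo `A₁` to some `l ∈ A₂` at
    -- which `e`, `χ₂` and `ψ(⟨ω, ·⟩)` are all 1 and whose class is in `K`.
    obtain ⟨U, hU, hUV⟩ := exists_nhds_add_mem hd.toIsUnionOfProP h₁.closed h₂.closed h₁₂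
      (Filter.inter_mem (hU₀.mem_nhds U₀.zero_mem) (Filter.inter_mem hV₁
        (Filter.inter_mem hV₂ hV₃)))
    obtain ⟨M, hM, hM', hMU⟩ := hd.exists_perp_subset hU
    set P := perp form ψ (A₁ ⊓ M) with hP
    have hPopen : IsOpen (P : Set W) := hd.isOpen_perp (hM'.inter_left h₁.closed)
    have hAP : A₁ ≤ P := h₁.le_perp inf_le_left
    have hPl : ∀ a ∈ A₂, a ∈ P → ∃ l ∈ A₂, l ∈ (U₀ : Set W) ∩ (V₁ ∩ (V₂ ∩
        (fun l => form ω l) ⁻¹' (ψ ⁻¹' {1}))) ∧ a - l ∈ A₁ := by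
      intro a ha haP
      obtain ⟨b, hb, u, hu, hbu⟩ := AddSubgroup.mem_sup.mp (hd.perp_inf_le h₁.perp_eq hM haP)
      refine hUV a ha (-b) (A₁.neg_mem hb) ?_
      rw [← hbu, add_comm b u, add_neg_cancel_right]
      exact hMU hu
    obtain ⟨c, hc⟩ := h₁.exists_isCut hd hM' 0 e
    obtain ⟨g, hg, hgT⟩ := hT (indModule.translate hd h₁ ⟨-ω, 0⟩ c) 1
    have hval : ∀ a : A₂, (g : (A₂ ⧸ A₁.addSubgroupOf A₂) → B) (QuotientAddGroup.mk a)
        = ((χ₂ (Heis.horizontal form (a : W) a.2))⁻¹ : Bˣ)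
          * (φ (ψ (form ω a) : R) * (c : Heis form → B) ⟨a, 0⟩) := by
      intro a
      refine (hg (Heis.horizontal form (a : W) a.2)).trans ?_
      congr 1
      rw [indModule.translate_apply, mul_one]
      change (c : Heis form → B) (⟨ω, 0⟩ * ⟨a, 0⟩ * ⟨-ω, 0⟩) = _
      rw [Heis.mul_comm_of_isAlt hd.alt hd.two ⟨ω, 0⟩ ⟨a, 0⟩, mul_assoc, mul_assoc,
        Heis.horizontal_mul_neg hd.alt, mul_one, h₁.apply_central_mul c.2.2.1]
    let D : AddSubgroup (A₂ ⧸ A₁.addSubgroupOf A₂) :=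
      (P.addSubgroupOf A₂).map (QuotientAddGroup.mk' _)
    have hD : ∀ a : A₂, (QuotientAddGroup.mk a : A₂ ⧸ A₁.addSubgroupOf A₂) ∈ D ↔ (a : W) ∈ P := by
      intro a
      constructor
      · rintro ⟨b, hb, hba⟩
        have h3 : -b + a ∈ A₁.addSubgroupOf A₂ := QuotientAddGroup.eq.mp hba
        have hb' : (b : W) ∈ P := hb
        have : (b : W) + (-(b : W) + a) ∈ P := P.add_mem hb' (hAP (h3 : -(b : W) + a ∈ A₁))
        rwa [add_neg_cancel_left] at this
      · exact fun ha => ⟨a, ha, rfl⟩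
    have hDopen : IsOpen (D : Set (A₂ ⧸ A₁.addSubgroupOf A₂)) := by
      refine isOpen_coinduced.mpr ?_
      have : (QuotientAddGroup.mk : A₂ → A₂ ⧸ A₁.addSubgroupOf A₂) ⁻¹' (D : Set _)
          = Subtype.val ⁻¹' (P : Set W) := Set.ext fun a => hD a
      change IsOpen ((QuotientAddGroup.mk : A₂ → A₂ ⧸ A₁.addSubgroupOf A₂) ⁻¹' (D : Set _))
      rw [this]
      exact hPopen.preimage continuous_subtype_val
    have hDK : D ≤ K := by
      intro q hq
      obtain ⟨a, rfl⟩ := QuotientAddGroup.mk_surjective q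
      obtain ⟨l, hl, hlV, hal⟩ := hPl a a.2 ((hD a).mp hq)
      have h3 : (QuotientAddGroup.mk a : A₂ ⧸ A₁.addSubgroupOf A₂)
          = QuotientAddGroup.mk (⟨l, hl⟩ : A₂) := by
        refine (QuotientAddGroup.eq.mpr ?_).symm
        change -l + (a : W) ∈ A₁
        rwa [neg_add_eq_sub]
      rw [h3]
      exact hKV₂ (show ((⟨l, hl⟩ : A₂) : W) ∈ V₂ from hlV.2.2.1)
    have hgD : (g : (A₂ ⧸ A₁.addSubgroupOf A₂) → B) = Set.indicator (D : Set _) 1 := by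
      funext q
      obtain ⟨a, rfl⟩ := QuotientAddGroup.mk_surjective q
      by_cases ha : (a : W) ∈ P
      · rw [Set.indicator_of_mem ((hD a).mpr ha)]
        obtain ⟨l, hl, ⟨hlU, hlV₁, -, hlψ⟩, hal⟩ := hPl a a.2 ha
        have h3 : (QuotientAddGroup.mk a : A₂ ⧸ A₁.addSubgroupOf A₂)
            = QuotientAddGroup.mk (⟨l, hl⟩ : A₂) := by
          refine (QuotientAddGroup.eq.mpr ?_).symm
          change -l + (a : W) ∈ A₁
          rwa [neg_add_eq_sub]
        have hlP : l ∈ P := by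
          have := P.sub_mem ha (hAP hal)
          rwa [sub_sub_cancel] at this
        have hel : (c : Heis form → B) ⟨l, 0⟩ = 1 := by
          rw [(hc ⟨l, 0⟩).1 (by rwa [sub_zero]), ← he, ← heU₀ l hlU 1, one_mul]
        have hlψ' : ψ (form ω l) = 1 := hlψ
        rw [h3, hval, hel, hχV₁ l hl hlV₁, hlψ']
        simp
      · rw [Set.indicator_of_notMem (fun h => ha ((hD a).mp h)), hval,
          (hc ⟨a, 0⟩).2 (by rwa [sub_zero]), mul_zero, mul_zero]
    obtain ⟨n, hn⟩ := exists_natCast_mul_of_le hμ.1 hDopen hK' hDK hgD hk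
    refine ⟨(n : B) • indModule.translate hd h₁ ⟨-ω, 0⟩ c, ?_⟩
    rw [map_smul, hn, ← hgT]
    rfl
  rw [hμ.2, top_le_iff] at hev
  obtain ⟨f, hf⟩ : (1 : B) ∈ LinearMap.range ev := hev ▸ Submodule.mem_top
  exact ⟨f, hf⟩

theorem IsIntertwiner.bijective (hd : IsDualityPairing p form ψ)
    (h₁ : IsPolarization φ ψ χ₁) (h₂ : IsPolarization φ ψ χ₂)
    (h₁₂ : IsClosed ((A₁ ⊔ A₂ : AddSubgroup W) : Set W)) {ω : W}
    {μ : CcSmooth (A₂ ⧸ A₁.addSubgroupOf A₂) B →ₗ[B] B} (hμ : IsInvertibleHaar μ)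
    {T : indModule form A₁ χ₁ →ₗ[B] indModule form A₂ χ₂}
    (hT : IsIntertwiner form χ₁ χ₂ μ ω T) : Function.Bijective T := by
  obtain ⟨f₀, hf₀⟩ := hT.exists_apply_one_eq_one hd h₁ h₂ h₁₂ hμ
  have hker : ∀ x, ∀ f ∈ LinearMap.ker T, indModule.translate hd h₁ x f ∈ LinearMap.ker T := by
    intro x f hf
    rw [LinearMap.mem_ker] at hf ⊢
    rw [hT.map_translate hd h₁ h₂, hf, map_zero]
  constructor
  · rw [injective_iff_map_eq_zero]
    intro f hf
    refine Subtype.ext (funext fun h => ?_)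
    let f' := indModule.translate hd h₁ h f
    have hf' : f' ∈ LinearMap.ker T := hker h f hf
    set b := (f' : Heis form → B) 1 with hb
    obtain ⟨e, he⟩ := h₁.exists_apply_one_eq_one hd
    obtain ⟨M, -, hM', hM1⟩ := h₁.exists_vanishing hd (f' - b • e) (by
      change (f' : Heis form → B) 1 - b * (e : Heis form → B) 1 = 0
      rw [he, mul_one, hb, sub_self])
    obtain ⟨g', hg', hcut'⟩ := h₁.exists_isCut_mem hd hM' 0 hker hf'
    obtain ⟨g, hcut⟩ := h₁.exists_isCut hd hM' 0 e
    have hgg : b • g = g' := by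
      refine Subtype.ext (funext fun y => ?_)
      change b * (g : Heis form → B) y = (g' : Heis form → B) y
      by_cases hy : y.w - 0 ∈ perp form ψ (A₁ ⊓ M)
      · rw [(hcut y).1 hy, (hcut' y).1 hy]
        have h3 := hM1 y (by rwa [sub_zero] at hy)
        exact (sub_eq_zero.mp h3).symm
      · rw [(hcut y).2 hy, (hcut' y).2 hy, mul_zero]
    -- Near the identity `f'` coincides with `b • e`, so `b • g` lies in the kernel, with `g 1 = 1`.
    -- The elements whose multiple by `b` is in the kernel therefore form all of `V`; for `f₀` this
    -- says `b = b (T f₀)(1) = 0`.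
    have htop := h₁.eq_top_of_translate_mem hd
      (N := (LinearMap.ker T).comap (LinearMap.lsmul B (indModule form A₁ χ₁) b))
      (fun x f hf => by
        rw [Submodule.mem_comap] at hf ⊢
        have := hker x _ hf
        rwa [LinearMap.lsmul_apply, map_smul] at this)
      (f₀ := g) (by
        rw [Submodule.mem_comap, LinearMap.lsmul_apply, hgg]
        exact hg')
      (by rw [(hcut 1).1 (by simp), he])
    have hmem : f₀ ∈ (LinearMap.ker T).comap (LinearMap.lsmul B (indModule form A₁ χ₁) b) :=
      htop ▸ Submodule.mem_top
    rw [Submodule.mem_comap, LinearMap.lsmul_apply, LinearMap.mem_ker, map_smul] at hmem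
    have h4 := congrFun (congrArg Subtype.val hmem) 1
    change b * (T f₀ : Heis form → B) 1 = 0 at h4
    rw [hf₀, mul_one, hb, indModule.translate_apply, one_mul] at h4
    exact h4
  · rw [← LinearMap.range_eq_top]
    refine h₂.eq_top_of_translate_mem hd ?_ ⟨f₀, rfl⟩ hf₀
    rintro x _ ⟨f, rfl⟩
    exact ⟨_, hT.map_translate hd h₁ h₂ x f⟩

end Intertwiner

/-! ## The action of the symplectic group -/

section Symplectic

variable {F W : Type*} [Field F] [AddCommGroup W] [Module F W] {form : LinearMap.BilinForm F W}

theorem SpGroup.inv_apply_apply (g : SpGroup form) (w : W) :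
    ((g⁻¹ : SpGroup form) : W ≃ₗ[F] W) ((g : W ≃ₗ[F] W) w) = w := by
  change ((g : W ≃ₗ[F] W)⁻¹ * (g : W ≃ₗ[F] W)) w = w
  rw [inv_mul_cancel]
  rfl

theorem SpGroup.apply_inv_apply (g : SpGroup form) (w : W) :
    (g : W ≃ₗ[F] W) (((g⁻¹ : SpGroup form) : W ≃ₗ[F] W) w) = w := by
  change ((g : W ≃ₗ[F] W) * (g : W ≃ₗ[F] W)⁻¹) w = w
  rw [mul_inv_cancel]
  rfl

theorem Heis.act_mul (g : SpGroup form) (x y : Heis form) :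
    Heis.act g (x * y) = Heis.act g x * Heis.act g y := by
  refine Heis.ext (map_add _ _ _) ?_
  change x.t + y.t + 1 / 2 * form x.w y.w = x.t + y.t + 1 / 2 * form
    ((g : W ≃ₗ[F] W) x.w) ((g : W ≃ₗ[F] W) y.w)
  rw [g.2]

theorem Heis.mul_act (g g' : SpGroup form) (x : Heis form) :
    Heis.act (g * g') x = Heis.act g (Heis.act g' x) := rfl

theorem Heis.act_one (x : Heis form) : Heis.act (1 : SpGroup form) x = x := rfl

theorem Heis.act_inv_act (g : SpGroup form) (x : Heis form) :
    Heis.act g⁻¹ (Heis.act g x) = x := by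
  rw [← Heis.mul_act, inv_mul_cancel, Heis.act_one]

theorem Heis.act_act_inv (g : SpGroup form) (x : Heis form) :
    Heis.act g (Heis.act g⁻¹ x) = x := by
  rw [← Heis.mul_act, mul_inv_cancel, Heis.act_one]

theorem mem_moveSubgroup {g : SpGroup form} {A : AddSubgroup W} {w : W} :
    w ∈ moveSubgroup g A ↔ ((g⁻¹ : SpGroup form) : W ≃ₗ[F] W) w ∈ A := by
  constructor
  · rintro ⟨a, ha, rfl⟩
    have : ((g⁻¹ : SpGroup form) : W ≃ₗ[F] W) ((g : W ≃ₗ[F] W) a) = a := SpGroup.inv_apply_apply g a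
    exact this.symm ▸ ha
  · exact fun h => ⟨_, h, SpGroup.apply_inv_apply g w⟩

theorem apply_mem_moveSubgroup {g : SpGroup form} {A : AddSubgroup W} {w : W} (hw : w ∈ A) :
    (g : W ≃ₗ[F] W) w ∈ moveSubgroup g A := ⟨w, hw, rfl⟩

theorem form_inv_apply (g : SpGroup form) (x y : W) :
    form (((g⁻¹ : SpGroup form) : W ≃ₗ[F] W) x) y = form x ((g : W ≃ₗ[F] W) y) := by
  conv_rhs => rw [← SpGroup.apply_inv_apply g x]
  exact (g.2 _ _).symm

variable [TopologicalSpace F] [TopologicalSpace W]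

theorem SpGroup.continuous [IsModuleTopology F W] [IsTopologicalRing F] (g : SpGroup form) :
    Continuous (g : W ≃ₗ[F] W) := by
  have : IsTopologicalAddGroup W := IsModuleTopology.topologicalAddGroup F W
  exact IsModuleTopology.continuous_of_linearMap (g : W ≃ₗ[F] W).toLinearMap

theorem Heis.continuous_act [IsModuleTopology F W] [IsTopologicalRing F] (g : SpGroup form) :
    Continuous (Heis.act g) :=
  Heis.continuous_mk ((SpGroup.continuous g).comp Heis.continuous_w) Heis.continuous_t

variable {R B : Type*} [CommRing R] [CommRing B]
  {p : ℕ} {ψ : AddChar F Rˣ} {φ : R →+* B}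
  {A : AddSubgroup W} {χ : Heis.over form A →* Bˣ}

theorem IsPolarization.moveChar [IsModuleTopology F W] [IsTopologicalRing F]
    (hA : IsPolarization φ ψ χ) (g : SpGroup form) : IsPolarization φ ψ (moveChar g χ) where
  closed := by
    have : (moveSubgroup g A : Set W) = ((g⁻¹ : SpGroup form) : W ≃ₗ[F] W) ⁻¹' (A : Set W) :=
      Set.ext fun w => mem_moveSubgroup
    rw [this]
    exact hA.closed.preimage (SpGroup.continuous g⁻¹)
  perp_eq := by
    ext w
    have h0 := SetLike.ext_iff.mp hA.perp_eq (((g⁻¹ : SpGroup form) : W ≃ₗ[F] W) w)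
    rw [mem_moveSubgroup, ← h0, mem_perp, mem_perp]
    constructor
    · intro h a ha
      rw [form_inv_apply]
      exact h _ (apply_mem_moveSubgroup ha)
    · rintro h _ ⟨a, ha, rfl⟩
      have := h a ha
      rwa [form_inv_apply] at this
  smooth := hA.smooth.comp_continuous
    (((Heis.continuous_act g⁻¹).comp continuous_subtype_val).subtype_mk _)
  central t := by
    rw [← hA.central]
    exact congrArg (fun x => (χ x : B))
      (Subtype.ext (Heis.ext (map_zero ((g⁻¹ : SpGroup form) : W ≃ₗ[F] W)) rfl))

theorem exists_isInvertibleHaar_quotient (hd : IsDualityPairing p form ψ) (φ : R →+* B)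
    {A₁ A₂ : AddSubgroup W} (h₂ : IsClosed (A₂ : Set W)) :
    ∃ μ : CcSmooth (A₂ ⧸ A₁.addSubgroupOf A₂) B →ₗ[B] B, IsInvertibleHaar μ := by
  have := hd.topGroup
  have hpB : IsUnit (p : B) := by
    have := hd.unit.map φ
    rwa [map_natCast] at this
  have hc : Continuous (QuotientAddGroup.mk : A₂ → A₂ ⧸ A₁.addSubgroupOf A₂) := continuous_quot_mk
  refine exists_isInvertibleHaar hd.prime hpB ?_ ?_
  · intro U hU
    have hpre : (QuotientAddGroup.mk : A₂ → A₂ ⧸ A₁.addSubgroupOf A₂) ⁻¹' U ∈ 𝓝 (0 : A₂) :=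
      hc.continuousAt.preimage_mem_nhds hU
    obtain ⟨V, hV, hVU⟩ := mem_nhds_subtype _ _ _ |>.mp hpre
    obtain ⟨L, hL, hL', hLV⟩ := hd.small V hV
    refine ⟨(L.addSubgroupOf A₂).map (QuotientAddGroup.mk' _), ?_, ?_, ?_⟩
    · exact QuotientAddGroup.isOpenMap_coe _ (hL.preimage continuous_subtype_val)
    · exact (h₂.isClosedEmbedding_subtypeVal.isCompact_preimage hL').image hc
    · rintro _ ⟨a, ha, rfl⟩
      exact hVU (hLV ha)
  · intro q U hU
    obtain ⟨a, rfl⟩ := QuotientAddGroup.mk_surjective q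
    obtain ⟨V, hV, hVU⟩ := mem_nhds_subtype _ _ _ |>.mp
      ((hU.preimage hc).mem_nhds (x := 0) U.zero_mem)
    obtain ⟨L, hL, hL', hLV⟩ := hd.small V hV
    obtain ⟨k, hk⟩ := hd.tors (a : W) L hL
    exact ⟨k, hVU (show ((p ^ k • a : A₂) : W) ∈ V from hLV hk)⟩

variable [IsDomain R] [CharZero R]

theorem exists_isTransport [IsModuleTopology F W] (hd : IsDualityPairing p form ψ)
    (hA : IsPolarization φ ψ χ) (g : SpGroup form) :
    ∃ J : indModule form A χ →ₗ[B] indModule form (moveSubgroup g A) (moveChar g χ),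
      IsTransport g χ J := by
  have := hd.topRing
  have hmem : ∀ f : indModule form A χ, (fun h => (f : Heis form → B) (Heis.act g⁻¹ h)) ∈
      indModule form (moveSubgroup g A) (moveChar g χ) := by
    intro f
    obtain ⟨U, hU, -, hfU⟩ := hA.exists_invariant_of_mem_indModule hd f.2
    refine (hA.moveChar g).mem_indModule_of_invariant hd (fun a h => ?_)
      (U := U.comap ((g⁻¹ : SpGroup form) : W ≃ₗ[F] W).toLinearMap.toAddMonoidHom)
      (hU.preimage (SpGroup.continuous g⁻¹)) fun u hu h => ?_
    · rw [Heis.act_mul]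
      exact f.2.2.1 ⟨Heis.act g⁻¹ a, mem_moveSubgroup.mp a.2⟩ _
    · rw [Heis.act_mul]
      exact hfU _ hu _
  exact ⟨{ toFun := fun f => ⟨_, hmem f⟩
           map_add' := fun _ _ => rfl
           map_smul' := fun _ _ => rfl }, fun f h => rfl⟩

theorem IsTransport.bijective [IsModuleTopology F W] (hd : IsDualityPairing p form ψ)
    (hA : IsPolarization φ ψ χ) {g : SpGroup form}
    {J : indModule form A χ →ₗ[B] indModule form (moveSubgroup g A) (moveChar g χ)}
    (hJ : IsTransport g χ J) : Function.Bijective J := by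
  have := hd.topRing
  constructor
  · intro f f' hff
    refine Subtype.ext (funext fun h => ?_)
    have := congrFun (congrArg Subtype.val hff) (Heis.act g h)
    rwa [hJ, hJ, Heis.act_inv_act] at this
  · intro f
    obtain ⟨U, hU, -, hfU⟩ := (hA.moveChar g).exists_invariant_of_mem_indModule hd f.2
    have hmem : (fun h => (f : Heis form → B) (Heis.act g h)) ∈ indModule form A χ := by
      refine hA.mem_indModule_of_invariant hd (fun a h => ?_)
        (U := U.comap (g : W ≃ₗ[F] W).toLinearMap.toAddMonoidHom)
        (hU.preimage (SpGroup.continuous g)) fun u hu h => ?_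
      · rw [Heis.act_mul]
        refine (f.2.2.1 ⟨Heis.act g a, apply_mem_moveSubgroup a.2⟩ _).trans ?_
        exact congrArg (fun x => (χ x : B) * _) (Subtype.ext (Heis.act_inv_act g a))
      · rw [Heis.act_mul]
        exact hfU _ hu _
    refine ⟨⟨_, hmem⟩, Subtype.ext (funext fun h => ?_)⟩
    rw [hJ]
    exact congrArg _ (Heis.act_act_inv g h)

/-- `M` intertwines the Heisenberg representation and its twist by `g`. -/
def IsEquivariantFor (hd : IsDualityPairing p form ψ) (hA : IsPolarization φ ψ χ)
    (g : SpGroup form) (M : indModule form A χ ≃ₗ[B] indModule form A χ) : Prop :=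
  ∀ x f, M (indModule.translate hd hA x f) = indModule.translate hd hA (Heis.act g x) (M f)

theorem IsEquivariantFor.mul {hd : IsDualityPairing p form ψ} {hA : IsPolarization φ ψ χ}
    {g g' : SpGroup form} {M M' : indModule form A χ ≃ₗ[B] indModule form A χ}
    (h : IsEquivariantFor hd hA g M) (h' : IsEquivariantFor hd hA g' M') :
    IsEquivariantFor hd hA (g * g') (M * M') := fun x f => by
  rw [LinearEquiv.mul_apply, LinearEquiv.mul_apply, h', h, Heis.mul_act]

/-- `M⁻¹ M'` and `M'⁻¹ M` commute with the Heisenberg group, hence are scalars `c` and `c'`;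
evaluating on a function with value 1 at the identity shows `c c' = 1`. -/
theorem IsEquivariantFor.red_eq {hd : IsDualityPairing p form ψ} {hA : IsPolarization φ ψ χ}
    {g : SpGroup form} {M M' : indModule form A χ ≃ₗ[B] indModule form A χ}
    (h : IsEquivariantFor hd hA g M) (h' : IsEquivariantFor hd hA g M') :
    red B (indModule form A χ) M = red B (indModule form A χ) M' := by
  have hsymm : ∀ {N N' : indModule form A χ ≃ₗ[B] indModule form A χ},
      IsEquivariantFor hd hA g N → IsEquivariantFor hd hA g N' →
      ∃ c : B, ∀ f, N.symm (N' f) = c • f := by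
    intro N N' hN hN'
    refine hA.exists_smul_of_commute hd (N.symm.toLinearMap ∘ₗ N'.toLinearMap) fun x f => ?_
    change N.symm (N' _) = indModule.translate hd hA x (N.symm (N' f))
    rw [LinearEquiv.symm_apply_eq, hN, LinearEquiv.apply_symm_apply, hN']
  obtain ⟨c, hc⟩ := hsymm h h'
  obtain ⟨c', hc'⟩ := hsymm h' h
  obtain ⟨e, he⟩ := hA.exists_apply_one_eq_one hd
  have hcc : ∀ f : indModule form A χ, (c * c') • f = f := fun f => by
    rw [mul_smul, ← hc, map_smul, LinearEquiv.symm_apply_eq, ← map_smul, ← hc',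
      LinearEquiv.apply_symm_apply]
  have h1 : c * c' = 1 := by
    have := congrFun (congrArg Subtype.val (hcc e)) 1
    change (c * c') * (e : Heis form → B) 1 = (e : Heis form → B) 1 at this
    rwa [he, mul_one] at this
  refine QuotientGroup.eq.mpr ⟨⟨c, c', h1, by rw [mul_comm, h1]⟩, ?_⟩
  ext1 f
  exact (hc f).symm

theorem IsWeilOperator.isEquivariantFor [IsModuleTopology F W] {hd : IsDualityPairing p form ψ}
    {hA : IsPolarization φ ψ χ} {g : SpGroup form}
    {μ : CcSmooth (A ⧸ (moveSubgroup g A).addSubgroupOf A) B →ₗ[B] B} {ω : W}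
    {M : indModule form A χ ≃ₗ[B] indModule form A χ} (hM : IsWeilOperator g χ μ ω M) :
    IsEquivariantFor hd hA g M := by
  have := hd.topRing
  obtain ⟨J, T, hJ, hT, hMT⟩ := hM
  intro x f
  have h1 : ∀ f, M f = T (J f) := fun f => LinearMap.congr_fun hMT f
  have h2 : J (indModule.translate hd hA x f)
      = indModule.translate hd (hA.moveChar g) (Heis.act g x) (J f) := by
    refine Subtype.ext (funext fun h => ?_)
    rw [hJ, indModule.translate_apply, indModule.translate_apply, hJ, Heis.act_mul,
      Heis.act_inv_act]
  rw [h1, h1, h2, hT.map_translate hd]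

theorem exists_isWeilOperator [IsModuleTopology F W] (hd : IsDualityPairing p form ψ)
    (hA : IsPolarization φ ψ χ) (g : SpGroup form)
    (hcl : IsClosed ((moveSubgroup g A ⊔ A : AddSubgroup W) : Set W)) {ψB : AddChar F Bˣ}
    (hψB : ∀ t, (ψB t : B) = φ (ψ t : R))
    {μ : CcSmooth (A ⧸ (moveSubgroup g A).addSubgroupOf A) B →ₗ[B] B} {ω : W}
    (hμ : IsInvertibleHaar μ) (hω : IsCompatible form ψB (moveChar g χ) χ ω) :
    ∃ M : indModule form A χ ≃ₗ[B] indModule form A χ, IsWeilOperator g χ μ ω M := by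
  have := hd.topRing
  obtain ⟨J, hJ⟩ := exists_isTransport hd hA g
  obtain ⟨T, hT⟩ := exists_isIntertwiner hd (hA.moveChar g) hA hcl hψB hω hμ
  have hb : Function.Bijective (T ∘ₗ J) :=
    (hT.bijective hd (hA.moveChar g) hA hcl hμ).comp (hJ.bijective hd hA)
  exact ⟨LinearEquiv.ofBijective (T ∘ₗ J) hb, J, T, hJ, hT, rfl⟩

/-- Each `a ↦ χᵢ(a, 0)` is multiplicative up to the same cocycle `ψ(½⟨a, b⟩)`, so their quotient is
a smooth character of `A₁ ∩ A₂`, to which duality applies. -/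
theorem exists_isCompatible (hd : IsDualityPairing p form ψ) {A₁ A₂ : AddSubgroup W}
    {χ₁ : Heis.over form A₁ →* Rˣ} {χ₂ : Heis.over form A₂ →* Rˣ}
    (h₁ : IsPolarization (RingHom.id R) ψ χ₁) (h₂ : IsPolarization (RingHom.id R) ψ χ₂) :
    ∃ ω : W, IsCompatible form ψ χ₁ χ₂ ω := by
  have hmul : ∀ {A : AddSubgroup W} {χ : Heis.over form A →* Rˣ},
      IsPolarization (RingHom.id R) ψ χ → ∀ (a b : W) (ha : a ∈ A) (hb : b ∈ A),
      χ (Heis.horizontal form a ha) * χ (Heis.horizontal form b hb)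
        = ψ (1 / 2 * form a b) * χ (Heis.horizontal form (a + b) (A.add_mem ha hb)) := by
    intro A χ hA a b ha hb
    have h3 : χ (Heis.central form A (1 / 2 * form a b)) = ψ (1 / 2 * form a b) :=
      Units.ext (hA.central _)
    rw [← h3, ← map_mul, ← map_mul]
    congr 1
    exact Subtype.ext (Heis.horizontal_mul_horizontal a b)
  let θ : AddChar (A₁ ⊓ A₂ : AddSubgroup W) Rˣ :=
    { toFun := fun a => χ₁ (Heis.horizontal form (a : W) a.2.1)
        * (χ₂ (Heis.horizontal form (a : W) a.2.2))⁻¹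
      map_zero_eq_one' := by
        have e1 : Heis.horizontal form (0 : W) A₁.zero_mem = 1 := rfl
        have e2 : Heis.horizontal form (0 : W) A₂.zero_mem = 1 := rfl
        change χ₁ (Heis.horizontal form (0 : W) A₁.zero_mem)
          * (χ₂ (Heis.horizontal form (0 : W) A₂.zero_mem))⁻¹ = 1
        rw [e1, e2, map_one, map_one, inv_one, mul_one]
      map_add_eq_mul' := fun a b => by
        have e1 := hmul h₁ a b a.2.1 b.2.1
        have e2 := hmul h₂ a b a.2.2 b.2.2
        rw [mul_mul_mul_comm, e1, ← mul_inv, e2, mul_inv, mul_mul_mul_comm, mul_inv_cancel,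
          one_mul]
        rfl }
  obtain ⟨V₁, hV₁, hχ₁⟩ := h₁.exists_apply_horizontal_eq_one
  obtain ⟨V₂, hV₂, hχ₂⟩ := h₂.exists_apply_horizontal_eq_one
  obtain ⟨ω, hω⟩ := hd.exists_eq_pairing θ (Filter.inter_mem hV₁ hV₂) fun a ha => by
    change χ₁ _ * (χ₂ _)⁻¹ = 1
    rw [hχ₁ _ _ ha.1, hχ₂ _ _ ha.2, inv_one, mul_one]
  exact ⟨ω, fun a ha₁ ha₂ => hω ⟨a, ha₁, ha₂⟩⟩

end Symplectic

/-! ## The coefficient ring and the closedness of `gA + A` -/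

theorem isUnit_natCast_baseRing {p : ℕ} (hp : p ≠ 0) (K : Type*) [Field K] [CharZero K] :
    IsUnit (p : baseRing p K) := by
  have hpK : (p : K) ≠ 0 := Nat.cast_ne_zero.mpr hp
  let y : Algebra.adjoin ℤ {(p : K)⁻¹} := ⟨(p : K)⁻¹, Algebra.subset_adjoin rfl⟩
  have hy : (p : K)⁻¹ ∈ baseRing p K := isIntegral_algebraMap (x := y)
  refine IsUnit.of_mul_eq_one ⟨_, hy⟩ (Subtype.ext ?_)
  exact mul_inv_cancel₀ hpK

section LocalField

open ValuativeRel

theorem tendsto_pow_of_valuation_lt_one {F : Type*} [Field F] [ValuativeRel F]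
    [TopologicalSpace F] [IsNonarchimedeanLocalField F] {ϖ : F} (hϖ : valuation F ϖ < 1) :
    Tendsto (fun n : ℕ => ϖ ^ n) atTop (𝓝 0) := by
  refine (IsValuativeTopology.hasBasis_nhds_zero F).tendsto_right_iff.mpr fun γ _ => ?_
  obtain ⟨n, hn⟩ := exists_pow_mul_lt hϖ 1 γ
  filter_upwards [eventually_ge_atTop n] with m hm
  exact mul_one (ϖ ^ m) ▸ hn m hm

theorem isClosed_moveSubgroup_sup {F W : Type*} [Field F] [ValuativeRel F] [TopologicalSpace F]
    {p : ℕ} (hF : IsFiniteOrLocalField F p) [AddCommGroup W] [Module F W] [FiniteDimensional F W]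
    [TopologicalSpace W] [IsModuleTopology F W] {form : LinearMap.BilinForm F W}
    {R : Type*} [CommRing R] {ψ : AddChar F Rˣ} (hd : IsDualityPairing p form ψ)
    {A : AddSubgroup W} (hA : IsClosed (A : Set W))
    (hsum : ringChar F = 0 ∨ (∀ x ∈ (valuation F).integer, ∀ a ∈ A, x • a ∈ A) ∨
      (∀ g : SpGroup form, IsClosed ((moveSubgroup g A ⊔ A : AddSubgroup W) : Set W)))
    (g : SpGroup form) : IsClosed ((moveSubgroup g A ⊔ A : AddSubgroup W) : Set W) := by
  have := hd.topRing
  have := hd.topGroup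
  have := hd.t2
  have hprime := hF.prime
  rcases hF with ⟨_, _, _⟩ | ⟨_, _⟩
  · have : Finite W := Module.finite_of_finite F
    exact (Set.toFinite _).isClosed
  have key : ∀ ϖ : F, ϖ ≠ 0 → valuation F ϖ < 1 → (∀ a ∈ A, ϖ • a ∈ A) →
      IsClosed ((moveSubgroup g A ⊔ A : AddSubgroup W) : Set W) := by
    intro ϖ hϖ0 hϖ hϖA
    obtain ⟨L, hL, hL', -⟩ := hd.small _ univ_mem
    have : ContinuousSMul F W := IsModuleTopology.toContinuousSMul F W
    refine isClosed_sup_of_smul_mem hϖ0 (tendsto_pow_of_valuation_lt_one hϖ) ?_ hA ?_ hϖA hL hL'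
    · have : (moveSubgroup g A : Set W) = ((g⁻¹ : SpGroup form) : W ≃ₗ[F] W) ⁻¹' (A : Set W) :=
        Set.ext fun w => mem_moveSubgroup
      rw [this]
      exact hA.preimage (SpGroup.continuous g⁻¹)
    · rintro _ ⟨a, ha, rfl⟩
      exact ⟨ϖ • a, hϖA a ha, map_smul (g : W ≃ₗ[F] W) ϖ a⟩
  rcases hsum with h | h | h
  -- In characteristic zero any subgroup is stable under `p`, which is topologically nilpotent; the
  -- second case uses any nonzero `ϖ` of valuation less than 1.
  · have : CharZero F := (CharP.ringChar_zero_iff_CharZero F).mp h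
    refine key p (Nat.cast_ne_zero.mpr hprime.ne_zero) valuation_natCast_lt_one fun a ha => ?_
    rw [Nat.cast_smul_eq_nsmul]
    exact A.nsmul_mem ha p
  · obtain ⟨ϖ, h0, h1⟩ := Valuation.IsNontrivial.exists_lt_one (v := valuation F)
    exact key ϖ (by simpa using h0) h1 (h ϖ h1.le)
  · exact h g

end LocalField

/-! ## The fiber product as a central extension -/

section Extension

variable {B V S : Type*} [CommRing B] [AddCommGroup V] [Module B V] [Group S]

theorem scalarHom_comm (b : Bˣ) (M : V ≃ₗ[B] V) : scalarHom B V b * M = M * scalarHom B V b := by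
  ext v
  exact (M.map_smul (b : B) v).symm

theorem exists_groupExtension_fiberProduct (σ : S →* PGL B V)
    (hinj : Function.Injective (scalarHom B V)) :
    ∃ E : GroupExtension Bˣ (fiberProduct σ) S,
      E.rightHom = fiberProduct.toBase σ ∧
      (∀ b : Bˣ, (E.inl b : S × (V ≃ₗ[B] V)) = (1, scalarHom B V b)) ∧
      E.inl.range ≤ Subgroup.center (fiberProduct σ) := by
  have hred : ∀ M : V ≃ₗ[B] V, red B V M = 1 ↔ M ∈ (scalarHom B V).range :=
    fun M => QuotientGroup.eq_one_iff M
  have hmem : ∀ b : Bˣ, ((1, scalarHom B V b) : S × (V ≃ₗ[B] V)) ∈ fiberProduct σ := fun b => by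
    change σ 1 = red B V (scalarHom B V b)
    rw [map_one, (hred _).mpr ⟨b, rfl⟩]
  let i : Bˣ →* fiberProduct σ :=
    ((MonoidHom.inr S (V ≃ₗ[B] V)).comp (scalarHom B V)).codRestrict (fiberProduct σ) hmem
  refine ⟨{ inl := i
            rightHom := fiberProduct.toBase σ
            inl_injective := fun b b' h => hinj (congrArg (fun x => x.1.2) h)
            range_inl_eq_ker_rightHom := ?_
            rightHom_surjective := fun g => ?_ }, rfl, fun b => rfl, ?_⟩
  · ext ⟨⟨g, M⟩, hx⟩
    constructor
    · rintro ⟨b, hb⟩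
      exact (congrArg (fun x => x.1.1) hb).symm
    · intro h
      have hg : g = 1 := h
      subst hg
      have hM : σ 1 = red B V M := hx
      rw [map_one] at hM
      obtain ⟨b, rfl⟩ := (hred M).mp hM.symm
      exact ⟨b, rfl⟩
  · obtain ⟨M, hM⟩ := QuotientGroup.mk'_surjective (scalarHom B V).range (σ g)
    exact ⟨⟨(g, M), hM.symm⟩, rfl⟩
  · rintro _ ⟨b, rfl⟩
    rw [Subgroup.mem_center_iff]
    rintro ⟨⟨g, M⟩, hx⟩
    refine Subtype.ext (Prod.ext ?_ (scalarHom_comm b M).symm)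
    exact (mul_one g).trans (one_mul g).symm

end Extension

/-! ### The morphism to `PGL` and the Weil extension -/

theorem mainTheorem4 {F : Type*} [Field F] [ValuativeRel F] [TopologicalSpace F]
    (p : ℕ) (hF : IsFiniteOrLocalField F p) (hF2 : ringChar F ≠ 2)
    {K : Type*} [Field K] [Algebra ℚ K] [IsCyclotomicExtension (cyclotomicOrders F p) ℚ K]
    {B : Type*} [CommRing B] [Algebra (baseRing p K) B]
    {W : Type*} [AddCommGroup W] [Module F W] [FiniteDimensional F W]
    [TopologicalSpace W] [IsModuleTopology F W]
    (form : LinearMap.BilinForm F W) (halt : form.IsAlt) (hnd : form.Nondegenerate)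
    (ψ : AddChar F (baseRing p K)ˣ) (hψ : IsLocallyConstant ψ) (hψ1 : ψ ≠ 1)
    (A : AddSubgroup W) (hA : IsSelfDual form ψ A)
    (hsum : ringChar F = 0 ∨
      (∀ x ∈ (ValuativeRel.valuation F).integer, ∀ a ∈ A, x • a ∈ A) ∨
      (∀ g : SpGroup form, IsClosed ((moveSubgroup g A ⊔ A : AddSubgroup W) : Set W)))
    (χ : Heis.over form A →* (baseRing p K)ˣ) (hχ : IsLocallyConstant χ)
    (hχψ : ∀ t : F, χ (Heis.central form A t) = ψ t)
    (ψB : AddChar F Bˣ)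
    (hψB : ψB = (Units.map (algebraMap (baseRing p K) B).toMonoidHom).compAddChar ψ)
    (χB : Heis.over form A →* Bˣ)
    (hχB : χB = (Units.map (algebraMap (baseRing p K) B).toMonoidHom).comp χ) :
    (∀ (g : SpGroup form) (μ : CcSmooth (A ⧸ (moveSubgroup g A).addSubgroupOf A) B →ₗ[B] B)
        (ω : W), IsInvertibleHaar μ → IsCompatible form ψB (moveChar g χB) χB ω →
        ∃ M : indModule form A χB ≃ₗ[B] indModule form A χB, IsWeilOperator g χB μ ω M) ∧
    ∃ σ : SpGroup form →* PGL B (indModule form A χB),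
      (∀ g : SpGroup form, weilClass ψB χB g = {σ g}) ∧
      (red B (indModule form A χB)).comp (fiberProduct.toGL σ)
        = σ.comp (fiberProduct.toBase σ) ∧
      ∃ E : GroupExtension Bˣ (fiberProduct σ) (SpGroup form),
        E.rightHom = fiberProduct.toBase σ ∧
        (∀ b : Bˣ, (E.inl b : SpGroup form × (indModule form A χB ≃ₗ[B] indModule form A χB))
          = (1, scalarHom B (indModule form A χB) b)) ∧
        E.inl.range ≤ Subgroup.center (fiberProduct σ) := by
  have : CharZero K := algebraRat.charZero K
  have hd : IsDualityPairing p form ψ := hF.isDualityPairing halt hnd hψ hψ1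
    (isUnit_natCast_baseRing hF.prime.ne_zero K) (Ring.two_ne_zero hF2)
  have := hd.topRing
  have hperp : perp form ψ A = A := SetLike.coe_injective hA.2
  have hpol : IsPolarization (RingHom.id (baseRing p K)) ψ χ :=
    ⟨hA.1, hperp, hχ, fun t => congrArg Units.val (hχψ t)⟩
  let φ := algebraMap (baseRing p K) B
  have hpolB : IsPolarization φ ψ χB :=
    ⟨hA.1, hperp, by rw [hχB]; exact hχ.comp (Units.map φ.toMonoidHom), fun t => by
      rw [hχB]; exact congrArg (fun u => φ (Units.val u)) (hχψ t)⟩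
  have hψB' : ∀ t, (ψB t : B) = φ (ψ t : baseRing p K) := fun t => by rw [hψB]; rfl
  have hcl := isClosed_moveSubgroup_sup hF hd hA.1 hsum
  have hweil : ∀ (g : SpGroup form)
      (μ : CcSmooth (A ⧸ (moveSubgroup g A).addSubgroupOf A) B →ₗ[B] B) (ω : W),
      IsInvertibleHaar μ → IsCompatible form ψB (moveChar g χB) χB ω →
      ∃ M : indModule form A χB ≃ₗ[B] indModule form A χB, IsWeilOperator g χB μ ω M :=
    fun g μ ω hμ hω => exists_isWeilOperator hd hpolB g (hcl g) hψB' hμ hω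
  have hex : ∀ g : SpGroup form, ∃ (μ : CcSmooth (A ⧸ (moveSubgroup g A).addSubgroupOf A) B →ₗ[B] B)
      (ω : W) (M : indModule form A χB ≃ₗ[B] indModule form A χB), IsInvertibleHaar μ ∧
      IsCompatible form ψB (moveChar g χB) χB ω ∧ IsWeilOperator g χB μ ω M := by
    intro g
    obtain ⟨μ, hμ⟩ := exists_isInvertibleHaar_quotient hd φ (A₁ := moveSubgroup g A) hA.1
    -- Duality needs a domain of characteristic zero, so `ω` is found over the base ring and the
    -- identity is then pushed to `B`.
    obtain ⟨ω, hω⟩ := exists_isCompatible hd (hpol.moveChar g) hpol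
    have hωB : IsCompatible form ψB (moveChar g χB) χB ω := fun a h₁ h₂ => by
      subst hχB hψB
      have := congrArg (Units.map (algebraMap (baseRing p K) B).toMonoidHom) (hω a h₁ h₂)
      rwa [map_mul, map_inv] at this
    obtain ⟨M, hM⟩ := hweil g μ ω hμ hωB
    exact ⟨μ, ω, M, hμ, hωB, hM⟩
  choose μ ω M hμ hω hM using hex
  have hMe : ∀ g, IsEquivariantFor hd hpolB g (M g) := fun g => (hM g).isEquivariantFor
  let σ : SpGroup form →* PGL B (indModule form A χB) :=
    -- `M (g * g')` and `M g * M g'` are both equivariant for `g * g'`, so they have the same class.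
    MonoidHom.mk' (fun g => red B (indModule form A χB) (M g)) fun g g' => by
      rw [← map_mul]
      exact (hMe (g * g')).red_eq ((hMe g).mul (hMe g'))
  refine ⟨hweil, σ, fun g => Set.Subset.antisymm ?_ ?_, MonoidHom.ext fun x => x.2.symm,
    exists_groupExtension_fiberProduct σ fun b b' h => ?_⟩
  · rintro _ ⟨μ', ω', M', -, -, hM', rfl⟩
    exact hM'.isEquivariantFor.red_eq (hMe g)
  · rintro _ rfl
    exact ⟨μ g, ω g, M g, hμ g, hω g, hM g, rfl⟩
  -- Scalars act faithfully on `V_A`: they can be read off from the value at the identity of their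
  -- action on `e`.
  · obtain ⟨e, he⟩ := hpolB.exists_apply_one_eq_one hd
    have h1 := congrFun (congrArg Subtype.val (LinearEquiv.congr_fun h e)) 1
    change (b : B) * (e : Heis form → B) 1 = b' * (e : Heis form → B) 1 at h1
    rw [he, mul_one, mul_one] at h1
    exact Units.ext h1
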